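/- Let $m\ge 1$ and let $H^m$ be the Heisenberg group, i.e. $\mathbb R^{2m+1}$ with points $q=(x,y,t)$, $x,y\in\mathbb R^m$, $t\in\mathbb R$, with the left-invariant vector fields $X_j=\partial_{x_j}+2y_j\partial_t$, $Y_j=\partial_{y_j}-2x_j\partial_t$ ($1\le j\le m$). For $u,v\in C^1(H^m)$ put $$\nabla_{H^m}u\cdot\nabla_{H^m}v=\sum_{j=1}^m\big(X_ju\,X_jv+Y_ju\,Y_jv\big),\qquad |\nabla_{H^m}u|_{H^m}=(\nabla_{H^m}u\cdot\nabla_{H^m}u)^{1/2}.$$ Let $p>1$ and let $f,l:[0,\infty)\to\mathbb R$ be continuous functions, positive on $(0,\infty)$, with $f$ non-decreasing, and with $l$ $C$-monotone non-decreasing: there is $C\ge1$ such that $\sup_{s\in[0,t]}l(s)\le C\,l(t)$ for all $t\ge0$. Assume that $$\frac{t^{p-1}}{l(t)}\to0\ \text{ as }t\to0^+,\qquad l(t)\le B_1+B_2t^{\mu}\quad\forall\,t\ge0,$$ with constants $B_1,B_2>0$ and $0\le\mu<1$, and that for some constant $\Lambda>0$ $$s^p\,l(t)\le\Lambda\,l(st)\qquad\forall\,s\in[0,1],\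 t\ge0.$$ Put $$F(t)=\int_0^tf(s)\,ds,\qquad K(t)=(p-1)\int_0^t\frac{s^{p-1}}{l(s)}\,ds\qquad(t\ge0),$$ and let $K^{-1}:[0,\infty)\to[0,\infty)$ be the inverse function of $K$. A solution $u\in C^1(H^m)$, $u\ge0$, of the inequality $\Delta^p_{H^m}u\ge f(u)\,l(|\nabla_{H^m}u|_{H^m})$ on $H^m$ is understood in the weak sense: for every $\zeta\in C_0^\infty(H^m)$ with $\zeta\ge0$, $$-\int_{\mathbb R^{2m+1}}|\nabla_{H^m}u|_{H^m}^{p-2}\,\nabla_{H^m}u\cdot\nabla_{H^m}\zeta\ \ge\ \int_{\mathbb R^{2m+1}}f(u)\,l(|\nabla_{H^m}u|_{H^m})\,\zeta .$$ Then the following conditions are equivalent: (i) there exists a non-negative, non-constant solution $u\in C^1(H^m)$ of $\Delta^p_{H^m}u\ge f(u)\,l(|\nabla_{H^m}u|_{H^m})$ on $H^m$; (ii) $\dfrac{1}{K^{-1}(F(t))}\notin L^1(+\infty)$, i.e. $1/K^{-1}(F(t))$ is not integrable on any neighbourhood of $+\infty$. -/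

import Mathlib

open MeasureTheory Filter Topology Set
open scoped ContDiff

namespace Heisenberg

/-- The underlying manifold `ℝ^(2m+1)` of the Heisenberg group `H^m`; a point is
`q = (x, y, t)` with `x y : Fin m → ℝ` and `t : ℝ`, and `z = (x, y)`. The group law is
`q ∘ q' = (x + x', y + y', t + t' + 2 ∑ i, (y i * x' i - x i * y' i))`; its Haar measure is the
Lebesgue measure `volume`. It enters below through its left-invariant fields `X`, `Y`. -/
abbrev H (m : ℕ) : Type := (Fin m → ℝ) × (Fin m → ℝ) × ℝ

variable {m : ℕ}

/-- The derivative of `u` along the left-invariant field `X_j = ∂/∂x_j + 2 y_j ∂/∂t`. -/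
noncomputable def X (j : Fin m) (u : H m → ℝ) (q : H m) : ℝ :=
  fderiv ℝ u q (Pi.single j 1, 0, 2 * q.2.1 j)

/-- The derivative of `u` along the left-invariant field `Y_j = ∂/∂y_j - 2 x_j ∂/∂t`. -/
noncomputable def Y (j : Fin m) (u : H m → ℝ) (q : H m) : ℝ :=
  fderiv ℝ u q (0, Pi.single j 1, -2 * q.1 j)

/-- The product `∇u · ∇v` of the Heisenberg gradients of `u` and `v`, at the point `q`. -/
noncomputable def gradDot (u v : H m → ℝ) (q : H m) : ℝ :=
  ∑ j, (X j u q * X j v q + Y j u q * Y j v q)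

/-- The length `|∇u|` of the Heisenberg gradient of `u`, at the point `q`. -/
noncomputable def gradNorm (u : H m → ℝ) (q : H m) : ℝ :=
  Real.sqrt (gradDot u u q)

/-- `u` is an entire weak classical solution of `Δ^p u ≥ f(u) l(|∇u|)` on `H^m`: it is `C^1`, and
for all non-negative smooth compactly supported `ζ`,
`-∫ |∇u|^(p-2) ∇u · ∇ζ ≥ ∫ f(u) l(|∇u|) ζ`. (Where `∇u = 0`, the integrand on the left is `0`,
also for `p < 2`.) -/
def IsWeakSolution (p : ℝ) (f l : ℝ → ℝ) (u : H m → ℝ) : Prop :=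
  ContDiff ℝ 1 u ∧
    ∀ ζ : H m → ℝ, ContDiff ℝ ∞ ζ → HasCompactSupport ζ → (∀ q, 0 ≤ ζ q) →
      -∫ q, gradNorm u q ^ (p - 2) * gradDot u ζ q ≥ ∫ q, f (u q) * l (gradNorm u q) * ζ q

end Heisenberg

namespace KellerOsserman

/-- Condition on `f`: continuous and increasing (in the wide sense) on `[0, ∞)`, positive
on `(0, ∞)`. -/
structure CondF (f : ℝ → ℝ) : Prop where
  cont : ContinuousOn f (Ici 0)
  pos : ∀ t, 0 < t → 0 < f t
  mono : MonotoneOn f (Ici 0)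

/-- `l` is `C`-monotone non-decreasing on `[0, ∞)`, for some `C ≥ 1`:
`sup_{s ∈ [0, t]} l(s) ≤ C l(t)` for all `t ≥ 0`. -/
def CMonotone (l : ℝ → ℝ) : Prop :=
  ∃ C : ℝ, 1 ≤ C ∧ ∀ t, 0 ≤ t → ∀ s ∈ Icc 0 t, l s ≤ C * l t

/-- Condition on `l`: continuous on `[0, ∞)`, positive on `(0, ∞)`, `C`-monotone
non-decreasing on `[0, ∞)`. -/
structure CondL (l : ℝ → ℝ) : Prop where
  cont : ContinuousOn l (Ici 0)
  pos : ∀ t, 0 < t → 0 < l t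
  cmono : CMonotone l

/-- `F(t) = ∫_0^t f(s) ds`. -/
noncomputable def F (f : ℝ → ℝ) (t : ℝ) : ℝ := ∫ s in (0 : ℝ)..t, f s

/-- `K(t) = ∫_0^t s φ'(s) / l(s) ds` for `φ(s) = s^(p-1)`, so that `s φ'(s) = (p-1) s^(p-1)`. -/
noncomputable def K (p : ℝ) (l : ℝ → ℝ) (t : ℝ) : ℝ :=
  ∫ s in (0 : ℝ)..t, (p - 1) * s ^ (p - 1) / l s

/-- The inverse of `K : [0, ∞) → [0, ∞)`. -/
noncomputable def Kinv (p : ℝ) (l : ℝ → ℝ) : ℝ → ℝ :=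
  Function.invFunOn (K p l) (Ici 0)

/-- The generalized Keller-Osserman condition `1 / K⁻¹(F(t)) ∈ L^1(+∞)`: integrability on some
neighbourhood of `+∞`. -/
def KO (p : ℝ) (f l : ℝ → ℝ) : Prop :=
  IntegrableAtFilter (fun t => 1 / Kinv p l (F f t)) atTop volume

end KellerOsserman

/-! For an increasing function v of one variable, K(v') = F(v) is a first integral of (v'^(p-1))' =
f(v) l(v'). The problem is therefore governed by the time ∫ ds / K⁻¹(F(s)) that a profile with v' =
K⁻¹(F(v)) needs to reach infinity.

If that time is infinite, the profile V is global (`exists_profile`), and u(q) = |V(x_j)| solves the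
inequality with equality, since on functions of x_j alone the operator is the one-dimensional
p-Laplacian (`isWeakSolution_of_profile`).

If it is finite, it suffices to show u(b) ≤ u(0) for every b: left translations preserve solutions
(`comp_lmul`), so then all values agree. Suppose u(0) < A < u(b). Put k = K⁻¹(δF) with δ small and
let Γ, with Γ(A) = 0, be a primitive of 1/k; the Keller-Osserman condition makes Γ bounded above.
Let r be the Korányi gauge. The radial function v with Γ(v) = r blows up at finite radius, but it is
g = Γ(u - η) that is compared with r. Testing the inequality for u with k(u - η)^(1-p) W gives, in
weak form, Δ^p g ≥ k^(1-p) f(u) l(k|∇g|) - (p-1) k' |∇g|^p (`flux_mul_rpow`), while Δ^p r = (2m+1)/r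
|∇r|^p away from the origin (`integral_flux_gauge`). The shift η is such that g - r has a positive
but small supremum (`exists_shift`), and W is the square of (g - r)₊.

Subtracting the two relations yields a function J with ∫ J ≤ 0. Yet J ≥ 0 pointwise (`absorption`).
Where |∇g| and |∇r| differ by a factor of at least 2, the monotonicity of the p-Laplacian
contributes a term linear in (g - r)₊, which beats the quadratic error. Where they are comparable,
the hypothesis s^p l(t) ≤ Λ l(st) bounds the right-hand side of the inequality from below, and the
choice of δ (`exists_slope`) lets it dominate. Since J > 0 where g > r off the axis z = 0, this is a
contradiction. -/

namespace KellerOsserman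

/-! ### Calculus of K, its inverse, and F. -/

/-- The standing hypotheses on `p` and `l` that make `K p l` an increasing bijection of `[0, ∞)`. -/
structure KHyp (p : ℝ) (l : ℝ → ℝ) : Prop where
  one_lt : 1 < p
  condL : CondL l
  tendsto : Tendsto (fun t : ℝ => t ^ (p - 1) / l t) (𝓝[>] 0) (𝓝 0)
  growth : ∃ B₁ B₂ μ : ℝ, 0 < B₁ ∧ 0 < B₂ ∧ 0 ≤ μ ∧ μ < 1 ∧
    ∀ t : ℝ, 0 ≤ t → l t ≤ B₁ + B₂ * t ^ μ

variable {p : ℝ} {f l : ℝ → ℝ}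

theorem CondL.nonneg (hl : CondL l) {t : ℝ} (ht : 0 ≤ t) : 0 ≤ l t := by
  have h1 : Tendsto l (𝓝[>] 0) (𝓝 (l 0)) :=
    ((hl.cont 0 self_mem_Ici).mono Ioi_subset_Ici_self).tendsto
  rcases ht.eq_or_lt with rfl | h
  · exact ge_of_tendsto h1 (eventually_mem_nhdsWithin.mono fun x hx => (hl.pos x hx).le)
  · exact (hl.pos t h).le

theorem CondF.nonneg (hf : CondF f) {t : ℝ} (ht : 0 ≤ t) : 0 ≤ f t := by
  have h1 : Tendsto f (𝓝[>] 0) (𝓝 (f 0)) :=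
    ((hf.cont 0 self_mem_Ici).mono Ioi_subset_Ici_self).tendsto
  rcases ht.eq_or_lt with rfl | h
  · exact ge_of_tendsto h1 (eventually_mem_nhdsWithin.mono fun x hx => (hf.pos x hx).le)
  · exact (hf.pos t h).le

/-- A primitive of a function continuous on `[0, ∞)`. -/
theorem hasDerivAt_primitive {g : ℝ → ℝ} (hg : ContinuousOn g (Ici 0)) {t : ℝ} (ht : 0 < t) :
    HasDerivAt (fun t => ∫ s in (0 : ℝ)..t, g s) (g t) t := by
  have hnt : Ici (0 : ℝ) ∈ 𝓝 t := Ici_mem_nhds ht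
  refine intervalIntegral.integral_hasDerivAt_right ?_ ?_ (hg.continuousAt hnt)
  · exact (hg.mono (by rw [uIcc_of_le ht.le]; exact Icc_subset_Ici_self)).intervalIntegrable
  · exact (hg.mono Ioi_subset_Ici_self).stronglyMeasurableAtFilter isOpen_Ioi t ht

theorem continuousOn_primitive {g : ℝ → ℝ} (hg : ContinuousOn g (Ici 0)) :
    ContinuousOn (fun t => ∫ s in (0 : ℝ)..t, g s) (Ici 0) := by
  intro t ht
  have h := intervalIntegral.continuousOn_primitive_interval (a := 0) (b := t + 1) (f := g) (μ := volume)
    ((hg.mono (by rw [uIcc_of_le (by linarith [mem_Ici.1 ht])]; exact Icc_subset_Ici_self)).integrableOn_compact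
      isCompact_uIcc)
  rw [uIcc_of_le (by linarith [mem_Ici.1 ht])] at h
  refine (h t ⟨ht, by linarith⟩).mono_of_mem_nhdsWithin ?_
  rw [← Ici_inter_Iic]
  exact inter_mem_nhdsWithin _ (Iic_mem_nhds (by linarith))

theorem strictMonoOn_primitive {g : ℝ → ℝ} (hg : ContinuousOn g (Ici 0))
    (hpos : ∀ t, 0 < t → 0 < g t) :
    StrictMonoOn (fun t => ∫ s in (0 : ℝ)..t, g s) (Ici 0) := by
  refine strictMonoOn_of_deriv_pos (convex_Ici 0) (continuousOn_primitive hg) ?_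
  intro t ht
  rw [interior_Ici] at ht
  rw [(hasDerivAt_primitive hg ht).deriv]
  exact hpos t ht

namespace KHyp

theorem kernel_pos (h : KHyp p l) {t : ℝ} (ht : 0 < t) : 0 < (p - 1) * t ^ (p - 1) / l t :=
  div_pos (mul_pos (by linarith [h.one_lt]) (Real.rpow_pos_of_pos ht _)) (h.condL.pos t ht)

/-- Continuity at 0 is exactly the hypothesis t^(p-1)/l(t) → 0; the value there is 0 also when l(0)
= 0, by the convention x / 0 = 0. -/
theorem kernel_continuousOn (h : KHyp p l) :
    ContinuousOn (fun t : ℝ => (p - 1) * t ^ (p - 1) / l t) (Ici 0) := by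
  have hp : 0 < p - 1 := by linarith [h.one_lt]
  intro t ht
  rcases (mem_Ici.1 ht).eq_or_lt with rfl | h0
  · rw [← Ioi_insert, continuousWithinAt_insert_self]
    have : (p - 1) * (0 : ℝ) ^ (p - 1) / l 0 = 0 := by simp [Real.zero_rpow hp.ne']
    rw [ContinuousWithinAt, this]
    simpa [mul_div_assoc] using h.tendsto.const_mul (p - 1)
  · refine ContinuousWithinAt.div ?_ (h.condL.cont t ht) (h.condL.pos t h0).ne'
    exact (continuousAt_const.mul (Real.continuousAt_rpow_const _ _ (Or.inl h0.ne'))).continuousWithinAt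

theorem hasDerivAt_K (h : KHyp p l) {t : ℝ} (ht : 0 < t) :
    HasDerivAt (K p l) ((p - 1) * t ^ (p - 1) / l t) t :=
  hasDerivAt_primitive h.kernel_continuousOn ht

theorem continuousOn_K (h : KHyp p l) : ContinuousOn (K p l) (Ici 0) :=
  continuousOn_primitive h.kernel_continuousOn

theorem strictMonoOn_K (h : KHyp p l) : StrictMonoOn (K p l) (Ici 0) :=
  strictMonoOn_primitive h.kernel_continuousOn fun _ => h.kernel_pos

theorem K_zero : K p l 0 = 0 := by simp [K]

theorem K_nonneg (h : KHyp p l) {t : ℝ} (ht : 0 ≤ t) : 0 ≤ K p l t := by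
  rw [← K_zero (p := p) (l := l)]
  exact h.strictMonoOn_K.monotoneOn self_mem_Ici ht ht

/-- For t ≥ 1 the growth bound gives l(t) ≤ (B₁ + B₂) t^μ, so the integrand of K dominates a
multiple of t^(p-1-μ), whose primitive is unbounded because μ < p. This makes K onto. -/
theorem tendsto_K (h : KHyp p l) : Tendsto (K p l) atTop atTop := by
  obtain ⟨B₁, B₂, μ, hB₁, hB₂, hμ₀, hμ₁, hg⟩ := h.growth
  have hp := h.one_lt
  set c := (p - 1) / (B₁ + B₂) with hc
  have hcpos : 0 < c := div_pos (by linarith) (by linarith)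
  -- compare with `c t ^ (p - μ) / (p - μ)` through the derivative of the difference
  have hmono : MonotoneOn (fun t => K p l t - c / (p - μ) * t ^ (p - μ)) (Ici 1) := by
    refine monotoneOn_of_deriv_nonneg (convex_Ici 1) ?_ ?_ ?_
    · refine (h.continuousOn_K.mono (Ici_subset_Ici.2 zero_le_one)).sub ?_
      exact continuousOn_const.mul (continuousOn_id.rpow_const fun x hx => Or.inr (by linarith))
    · intro t ht
      rw [interior_Ici] at ht
      have ht0 : 0 < t := zero_lt_one.trans ht
      exact ((h.hasDerivAt_K ht0).sub ((Real.hasDerivAt_rpow_const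
        (Or.inl ht0.ne')).const_mul _)).differentiableAt.differentiableWithinAt
    · intro t ht
      rw [interior_Ici] at ht
      have ht1 : 1 < t := ht
      have ht0 : 0 < t := zero_lt_one.trans ht
      have hd : HasDerivAt (fun t => K p l t - c / (p - μ) * t ^ (p - μ)) _ t :=
        (h.hasDerivAt_K ht0).sub ((Real.hasDerivAt_rpow_const (Or.inl ht0.ne')).const_mul _)
      rw [hd.deriv, sub_nonneg]
      have h1 : l t ≤ (B₁ + B₂) * t ^ μ := by
        have := Real.one_le_rpow ht1.le hμ₀
        nlinarith [hg t ht0.le]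
      have h2 : t ^ (p - 1) = t ^ (p - μ - 1) * t ^ μ := by
        rw [← Real.rpow_add ht0]; ring_nf
      have h3 : c / (p - μ) * ((p - μ) * t ^ (p - μ - 1)) = c * t ^ (p - μ - 1) := by
        have : p - μ ≠ 0 := by linarith
        field_simp
      rw [h3, le_div_iff₀ (h.condL.pos t ht0), h2, hc, div_mul_eq_mul_div, div_mul_eq_mul_div,
        div_le_iff₀ (by linarith)]
      have h4 : 0 ≤ (p - 1) * t ^ (p - μ - 1) :=
        mul_nonneg (by linarith) (Real.rpow_nonneg ht0.le _)
      nlinarith [mul_le_mul_of_nonneg_left h1 h4]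
  have hlim : Tendsto (fun t : ℝ => (K p l 1 - c / (p - μ) * 1 ^ (p - μ)) + c / (p - μ) * t ^ (p - μ))
      atTop atTop := by
    refine tendsto_atTop_add_const_left _ _ ?_
    exact (tendsto_rpow_atTop (by linarith)).const_mul_atTop (div_pos hcpos (by linarith))
  refine tendsto_atTop_mono' _ ?_ hlim
  filter_upwards [eventually_ge_atTop 1] with t ht
  have := hmono self_mem_Ici ht ht
  simp only at this
  linarith

/-- An extension of `K p l` from `[0, ∞)` to an order isomorphism of `ℝ`. -/
theorem exists_orderIso (h : KHyp p l) : ∃ e : ℝ ≃o ℝ, ∀ t, 0 ≤ t → e t = K p l t := by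
  -- K on the right and the identity on the left, so that the theory of order isomorphisms of ℝ
  -- applies.
  set k : ℝ → ℝ := fun t => K p l (max t 0) + min t 0 with hk
  have hkp : ∀ t, 0 ≤ t → k t = K p l t := fun t ht => by simp [hk, ht]
  have hkn : ∀ t, t ≤ 0 → k t = t := fun t ht => by simp [hk, ht, K_zero]
  have hmono : StrictMono k := by
    intro a b hab
    rcases le_or_gt 0 a with ha | ha
    · rw [hkp a ha, hkp b (ha.trans hab.le)]
      exact h.strictMonoOn_K ha (ha.trans hab.le) hab
    · rw [hkn a ha.le]
      rcases le_or_gt b 0 with hb | hb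
      · rwa [hkn b hb]
      · rw [hkp b hb.le]
        exact ha.trans_le (h.K_nonneg hb.le)
  have hcont : Continuous k := by
    refine Continuous.add ?_ (by fun_prop)
    exact h.continuousOn_K.comp_continuous (by fun_prop) fun x => mem_Ici.2 (le_max_right _ _)
  have htop : Tendsto k atTop atTop := by
    refine h.tendsto_K.congr' ?_
    filter_upwards [eventually_ge_atTop 0] with t ht using (hkp t ht).symm
  have hbot : Tendsto k atBot atBot := by
    refine tendsto_id.congr' ?_
    filter_upwards [eventually_le_atBot 0] with t ht using (hkn t ht).symm
  refine ⟨hmono.orderIsoOfSurjective k (hcont.surjective htop hbot), fun t ht => ?_⟩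
  simp [hkp t ht]

theorem exists_orderIso_Kinv (h : KHyp p l) :
    ∃ e : ℝ ≃o ℝ, (∀ t, 0 ≤ t → e t = K p l t) ∧ ∀ y, 0 ≤ y → Kinv p l y = e.symm y := by
  obtain ⟨e, he⟩ := h.exists_orderIso
  refine ⟨e, he, fun y hy => ?_⟩
  have h0 : e 0 = 0 := by rw [he 0 le_rfl, K_zero]
  have hs : 0 ≤ e.symm y := by rw [← e.le_iff_le]; simpa [h0] using hy
  have hex : ∃ x ∈ Ici (0 : ℝ), K p l x = y := ⟨e.symm y, hs, by rw [← he _ hs]; simp⟩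
  have h1 := Function.invFunOn_mem hex
  have h2 := Function.invFunOn_eq hex
  rw [Kinv, ← e.symm_apply_apply (Function.invFunOn (K p l) (Ici 0) y), he _ h1, h2]

theorem Kinv_nonneg (h : KHyp p l) {y : ℝ} (hy : 0 ≤ y) : 0 ≤ Kinv p l y := by
  obtain ⟨e, he, hi⟩ := h.exists_orderIso_Kinv
  have h0 : e 0 = 0 := by rw [he 0 le_rfl, K_zero]
  rw [hi y hy, ← e.le_iff_le]; simpa [h0] using hy

theorem K_Kinv (h : KHyp p l) {y : ℝ} (hy : 0 ≤ y) : K p l (Kinv p l y) = y := by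
  have := h.Kinv_nonneg hy
  obtain ⟨e, he, hi⟩ := h.exists_orderIso_Kinv
  rw [← he _ this, hi y hy, e.apply_symm_apply]

theorem Kinv_K (h : KHyp p l) {t : ℝ} (ht : 0 ≤ t) : Kinv p l (K p l t) = t := by
  obtain ⟨e, he, hi⟩ := h.exists_orderIso_Kinv
  rw [hi _ (h.K_nonneg ht), ← he t ht, e.symm_apply_apply]

theorem Kinv_zero (h : KHyp p l) : Kinv p l 0 = 0 := by
  conv_lhs => rw [← K_zero (p := p) (l := l)]
  exact h.Kinv_K le_rfl

theorem strictMonoOn_Kinv (h : KHyp p l) : StrictMonoOn (Kinv p l) (Ici 0) := by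
  obtain ⟨e, he, hi⟩ := h.exists_orderIso_Kinv
  exact (e.symm.strictMono.strictMonoOn (Ici 0)).congr fun y hy => (hi y hy).symm

theorem continuousOn_Kinv (h : KHyp p l) : ContinuousOn (Kinv p l) (Ici 0) := by
  obtain ⟨e, he, hi⟩ := h.exists_orderIso_Kinv
  exact e.symm.continuous.continuousOn.congr fun y hy => hi y hy

theorem Kinv_pos (h : KHyp p l) {y : ℝ} (hy : 0 < y) : 0 < Kinv p l y := by
  rw [← h.Kinv_zero]
  exact h.strictMonoOn_Kinv self_mem_Ici hy.le hy

theorem hasDerivAt_Kinv (h : KHyp p l) {y : ℝ} (hy : 0 < y) :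
    HasDerivAt (Kinv p l) (l (Kinv p l y) / ((p - 1) * Kinv p l y ^ (p - 1))) y := by
  have h1 := h.hasDerivAt_K (h.Kinv_pos hy)
  rw [← inv_div]
  refine h1.of_local_left_inverse (h.continuousOn_Kinv.continuousAt (Ici_mem_nhds hy))
    (h.kernel_pos (h.Kinv_pos hy)).ne' ?_
  filter_upwards [Ioi_mem_nhds hy] with z hz using h.K_Kinv (le_of_lt hz)

/-- Near `0` the function `K⁻¹` has infinite slope. -/
theorem exists_mul_le_Kinv (h : KHyp p l) {D : ℝ} (hD : 0 < D) :
    ∃ y₀, 0 < y₀ ∧ ∀ y, 0 ≤ y → y ≤ y₀ → D * y ≤ Kinv p l y := by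
  have h1 := (h.kernel_continuousOn 0 self_mem_Ici)
  have h0 : (p - 1) * (0 : ℝ) ^ (p - 1) / l 0 = 0 := by
    simp [Real.zero_rpow (sub_pos.2 h.one_lt).ne']
  rw [ContinuousWithinAt, h0] at h1
  -- The integrand of K vanishes at 0, so it is below 1/D near 0; integrating gives K(t) ≤ t/D,
  -- which inverts to the claim.
  have h2 := h1.eventually (gt_mem_nhds (inv_pos.2 hD))
  rw [eventually_nhdsWithin_iff, Metric.eventually_nhds_iff] at h2
  obtain ⟨ε, hε, hK⟩ := h2
  have hKle : ∀ t, 0 ≤ t → t < ε → K p l t ≤ D⁻¹ * t := by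
    intro t ht htε
    have : K p l t ≤ ∫ s in (0 : ℝ)..t, D⁻¹ := by
      refine intervalIntegral.integral_mono_on ht ?_ intervalIntegrable_const ?_
      · exact (h.kernel_continuousOn.mono
          (by rw [uIcc_of_le ht]; exact Icc_subset_Ici_self)).intervalIntegrable
      · intro x hx
        refine (hK ?_ hx.1).le
        rw [Real.dist_eq, sub_zero, abs_of_nonneg hx.1]
        exact hx.2.trans_lt htε
    simpa [mul_comm] using this
  refine ⟨K p l (ε / 2), ?_, fun y hy hy' => ?_⟩
  · rw [← K_zero (p := p) (l := l)]
    exact h.strictMonoOn_K self_mem_Ici (by simp only [mem_Ici]; linarith) (by linarith)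
  · have h3 : Kinv p l y ≤ ε / 2 := by
      rw [← h.Kinv_K (t := ε / 2) (by linarith)]
      exact h.strictMonoOn_Kinv.monotoneOn hy (h.K_nonneg (by linarith)) hy'
    have h4 := hKle _ (h.Kinv_nonneg hy) (by linarith)
    rw [h.K_Kinv hy, ← div_eq_inv_mul, le_div_iff₀ hD] at h4
    linarith

/-- `t ^ p / l(t) ≤ C K(t)`. -/
theorem exists_rpow_div_le (h : KHyp p l) :
    ∃ C, 0 < C ∧ ∀ t, 0 < t → t ^ (p - 1) / l t ≤ C * (K p l t / t) := by
  obtain ⟨C, hC, hmon⟩ := h.condL.cmono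
  have hp := h.one_lt
  refine ⟨C * p / (p - 1), div_pos (by nlinarith) (by linarith), fun t ht => ?_⟩
  have hlt := h.condL.pos t ht
  have h1 : (p - 1) / (C * l t) * (t ^ p / p) ≤ K p l t := by
    -- `C`-monotonicity bounds l(s) by C l(t) for s ≤ t, so l leaves the integral with its endpoint
    -- value.
    have h2 : ∫ s in (0 : ℝ)..t, (p - 1) / (C * l t) * s ^ (p - 1) ≤ K p l t := by
      refine intervalIntegral.integral_mono_on_of_le_Ioo ht.le ?_ ?_ ?_
      · exact (intervalIntegral.intervalIntegrable_rpow' (by linarith)).const_mul _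
      · exact (h.kernel_continuousOn.mono
          (by rw [uIcc_of_le ht.le]; exact Icc_subset_Ici_self)).intervalIntegrable
      · intro s hs
        rw [div_mul_eq_mul_div]
        exact div_le_div_of_nonneg_left (mul_nonneg (by linarith) (Real.rpow_nonneg hs.1.le _))
          (h.condL.pos s hs.1) (hmon t ht.le s ⟨hs.1.le, hs.2.le⟩)
    rw [intervalIntegral.integral_const_mul, integral_rpow (Or.inl (by linarith))] at h2
    simpa [Real.zero_rpow (by linarith : p ≠ 0)] using h2
  have h3 : t ^ p = t ^ (p - 1) * t := by
    rw [← Real.rpow_add_one ht.ne']; ring_nf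
  rw [h3] at h1
  calc t ^ (p - 1) / l t = C * p / (p - 1) * ((p - 1) / (C * l t) * (t ^ (p - 1) * t / p) / t) := by
        have : p - 1 ≠ 0 := by linarith
        have : C ≠ 0 := by linarith
        field_simp
    _ ≤ _ := by
        have : 0 ≤ C * p / (p - 1) := (div_pos (by nlinarith) (by linarith)).le
        gcongr

end KHyp

theorem CondF.continuousOn_F (hf : CondF f) : ContinuousOn (F f) (Ici 0) :=
  continuousOn_primitive hf.cont

theorem CondF.hasDerivAt_F (hf : CondF f) {t : ℝ} (ht : 0 < t) : HasDerivAt (F f) (f t) t :=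
  hasDerivAt_primitive hf.cont ht

theorem CondF.strictMonoOn_F (hf : CondF f) : StrictMonoOn (F f) (Ici 0) :=
  strictMonoOn_primitive hf.cont hf.pos

theorem F_zero : F f 0 = 0 := by simp [F]

theorem CondF.F_pos (hf : CondF f) {t : ℝ} (ht : 0 < t) : 0 < F f t := by
  rw [← F_zero (f := f)]
  exact hf.strictMonoOn_F self_mem_Ici ht.le ht

theorem CondF.F_nonneg (hf : CondF f) {t : ℝ} (ht : 0 ≤ t) : 0 ≤ F f t := by
  rw [← F_zero (f := f)]
  exact hf.strictMonoOn_F.monotoneOn self_mem_Ici ht ht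

theorem CondF.intervalIntegrable (hf : CondF f) {t : ℝ} (ht : 0 ≤ t) :
    IntervalIntegrable f volume 0 t :=
  (hf.cont.mono (by rw [uIcc_of_le ht]; exact Icc_subset_Ici_self)).intervalIntegrable

theorem CondF.F_le (hf : CondF f) {t : ℝ} (ht : 0 ≤ t) : F f t ≤ t * f t := by
  have : F f t ≤ ∫ s in (0 : ℝ)..t, f t :=
    intervalIntegral.integral_mono_on ht (hf.intervalIntegrable ht) intervalIntegrable_const
      fun s hs => hf.mono hs.1 ht hs.2
  simpa using this

/-- Substitute s ↦ δs and use f(δs) ≤ f(s). This moves δ inside F, and so transfers the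
Keller-Osserman condition from δ = 1 to every δ ≤ 1. -/
theorem CondF.F_mul_le (hf : CondF f) {δ t : ℝ} (hδ : 0 < δ) (hδ1 : δ ≤ 1) (ht : 0 ≤ t) :
    F f (δ * t) ≤ δ * F f t := by
  have h1 : δ * ∫ s in (0 : ℝ)..t, f (δ * s) = ∫ s in (δ * 0)..(δ * t), f s :=
    intervalIntegral.mul_integral_comp_mul_left (f := f) δ
  rw [mul_zero] at h1
  rw [F, ← h1, F]
  refine mul_le_mul_of_nonneg_left ?_ hδ.le
  refine intervalIntegral.integral_mono_on ht ?_ (hf.intervalIntegrable ht) ?_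
  · refine ContinuousOn.intervalIntegrable ?_
    rw [uIcc_of_le ht]
    exact hf.cont.comp (by fun_prop) fun s hs => mul_nonneg hδ.le hs.1
  · intro s hs
    exact hf.mono (mul_nonneg hδ.le hs.1) hs.1 (mul_le_of_le_one_left hs.1 hδ1)

/-! ### The slope functions K⁻¹(δF) and the choice of δ. -/

/-- The slope function `K⁻¹(δ F(s))`. -/
noncomputable def koSlope (p : ℝ) (f l : ℝ → ℝ) (δ s : ℝ) : ℝ := Kinv p l (δ * F f s)

section slope

variable {δ s : ℝ}

theorem slope_pos (h : KHyp p l) (hf : CondF f) (hδ : 0 < δ) (hs : 0 < s) :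
    0 < koSlope p f l δ s := h.Kinv_pos (mul_pos hδ (hf.F_pos hs))

theorem slope_nonneg (h : KHyp p l) (hf : CondF f) (hδ : 0 < δ) (hs : 0 ≤ s) :
    0 ≤ koSlope p f l δ s := h.Kinv_nonneg (mul_nonneg hδ.le (hf.F_nonneg hs))

theorem slope_zero (h : KHyp p l) : koSlope p f l δ 0 = 0 := by simp [koSlope, F_zero, h.Kinv_zero]

theorem continuousOn_slope (h : KHyp p l) (hf : CondF f) (hδ : 0 < δ) :
    ContinuousOn (koSlope p f l δ) (Ici 0) :=
  h.continuousOn_Kinv.comp (continuousOn_const.mul hf.continuousOn_F)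
    fun _ hs => mul_nonneg hδ.le (hf.F_nonneg hs)

theorem monotoneOn_slope (h : KHyp p l) (hf : CondF f) (hδ : 0 < δ) :
    MonotoneOn (koSlope p f l δ) (Ici 0) := fun _ ha _ hb hab =>
  h.strictMonoOn_Kinv.monotoneOn (mul_nonneg hδ.le (hf.F_nonneg ha))
    (mul_nonneg hδ.le (hf.F_nonneg hb))
    (mul_le_mul_of_nonneg_left (hf.strictMonoOn_F.monotoneOn ha hb hab) hδ.le)

theorem hasDerivAt_slope (h : KHyp p l) (hf : CondF f) (hδ : 0 < δ) (hs : 0 < s) :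
    HasDerivAt (koSlope p f l δ)
      (l (koSlope p f l δ s) / ((p - 1) * koSlope p f l δ s ^ (p - 1)) * (δ * f s)) s :=
  (h.hasDerivAt_Kinv (mul_pos hδ (hf.F_pos hs))).comp s ((hf.hasDerivAt_F hs).const_mul δ)

theorem slope_one_le (h : KHyp p l) (hf : CondF f) (hδ : 0 < δ) (hδ1 : δ ≤ 1) (hs : 0 ≤ s) :
    koSlope p f l 1 (δ * s) ≤ koSlope p f l δ s := by
  rw [koSlope, one_mul, koSlope]
  exact h.strictMonoOn_Kinv.monotoneOn (hf.F_nonneg (mul_nonneg hδ.le hs))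
    (mul_nonneg hδ.le (hf.F_nonneg hs)) (hf.F_mul_le hδ hδ1 hs)

theorem continuousOn_inv_slope (h : KHyp p l) (hf : CondF f) (hδ : 0 < δ) :
    ContinuousOn (fun s => 1 / koSlope p f l δ s) (Ioi 0) :=
  continuousOn_const.div ((continuousOn_slope h hf hδ).mono Ioi_subset_Ici_self)
    fun _ hs => (slope_pos h hf hδ hs).ne'

/-- Under the Keller-Osserman condition `1 / K⁻¹(F)` is integrable on every `(A, ∞)`, `A > 0`. -/
theorem KO.integrableOn (hKO : KO p f l) (h : KHyp p l) (hf : CondF f) {A : ℝ} (hA : 0 < A) :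
    IntegrableOn (fun s => 1 / koSlope p f l 1 s) (Ioi A) := by
  obtain ⟨S, hS, hint⟩ := hKO
  obtain ⟨a, ha⟩ := mem_atTop_sets.1 hS
  have h1 : IntegrableOn (fun s => 1 / koSlope p f l 1 s) (Ici a) := by
    simp only [koSlope, one_mul]
    exact hint.mono_set fun x hx => ha x hx
  have h2 : IntegrableOn (fun s => 1 / koSlope p f l 1 s) (Icc A (max a A)) :=
    ((continuousOn_inv_slope h hf one_pos).mono fun x hx => hA.trans_le hx.1).integrableOn_Icc
  refine (h2.union h1).mono_set fun x hx => ?_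
  rcases le_or_gt a x with h | h
  · exact Or.inr h
  · exact Or.inl ⟨(mem_Ioi.1 hx).le, h.le.trans (le_max_left _ _)⟩

/-- The slope for δ at s is at least the slope for 1 at δs, and a dilation of the variable preserves
integrability. -/
theorem KO.integrableOn_slope (hKO : KO p f l) (h : KHyp p l) (hf : CondF f) (hδ : 0 < δ)
    (hδ1 : δ ≤ 1) {A : ℝ} (hA : 0 < A) :
    IntegrableOn (fun s => 1 / koSlope p f l δ s) (Ioi A) := by
  have h1 := hKO.integrableOn h hf (mul_pos hδ hA)
  rw [← integrableOn_Ioi_comp_mul_left_iff _ _ hδ] at h1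
  refine h1.mono' ?_ ?_
  · exact ((continuousOn_inv_slope h hf hδ).mono fun x hx =>
      hA.trans hx).aestronglyMeasurable measurableSet_Ioi
  · refine (ae_restrict_iff' measurableSet_Ioi).2 (ae_of_all _ fun x hx => ?_)
    have hx0 : 0 < x := hA.trans hx
    rw [Real.norm_of_nonneg (one_div_nonneg.2 (slope_nonneg h hf hδ hx0.le))]
    exact one_div_le_one_div_of_le (slope_pos h hf one_pos (mul_pos hδ hx0))
      (slope_one_le h hf hδ hδ1 hx0.le)

end slope

/-- The supply of slopes for the comparison functions. -/
theorem exists_slope (h : KHyp p l) (hf : CondF f) {A B r₀ c C : ℝ} (r₁ : ℝ)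
    (hA : 0 < A) (hAB : A < B) (hr₀ : 0 < r₀) (hc : 0 < c) (hC : 0 ≤ C) :
    ∃ δ, 0 < δ ∧ δ ≤ 1 ∧ r₁ < (∫ s in A..B, 1 / koSlope p f l δ s) ∧
      ∀ s, A ≤ s → δ * f s * l (koSlope p f l δ s) +
        C / (r₀ + ∫ σ in A..s, 1 / koSlope p f l δ σ) * koSlope p f l δ s ^ (p - 1) <
          c * (f s * l (koSlope p f l δ s)) := by
  -- With k the slope at s and Γ the integral of 1/k from A to s, one has k^(p-1)/l(k) ≤ C' K(k)/k =
  -- C' δ F(s)/k ≤ C' δ s f(s)/k. The term with C is thus absorbed once δs is small against k (r₀ +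
  -- Γ), which is `key`.
  obtain ⟨C', hC', hK⟩ := h.exists_rpow_div_le
  -- requirements on `δ`
  set D : ℝ := (C + 1) * C' * 4 / c with hD
  have hDpos : 0 < D := by positivity
  have hFB : 0 < F f B := hf.F_pos (hA.trans hAB)
  have hFA : 0 < F f A := hf.F_pos hA
  -- The factor is such that at y = δF(A) the bound reads r₀ K⁻¹(δF(A)) ≥ 2ADδ.
  obtain ⟨y₀, hy₀, hlow⟩ := h.exists_mul_le_Kinv (D := D * (2 * A) / (r₀ * F f A)) (by positivity)
  -- As δ → 0 the slope at B tends to 0, so (B - A)/k(B), a lower bound for the integral, exceeds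
  -- r₁.
  have hev : ∀ᶠ δ in 𝓝[>] (0 : ℝ), r₁ * koSlope p f l δ B < B - A := by
    have h1 : Tendsto (fun δ => r₁ * koSlope p f l δ B) (𝓝[>] 0) (𝓝 (r₁ * Kinv p l (0 * F f B))) := by
      refine Tendsto.const_mul _ ?_
      have h2 : ContinuousOn (fun δ => koSlope p f l δ B) (Ici 0) :=
        h.continuousOn_Kinv.comp (by fun_prop) fun _ hs => mul_nonneg hs hFB.le
      exact ((h2 0 self_mem_Ici).mono Ioi_subset_Ici_self).tendsto
    rw [zero_mul, h.Kinv_zero, mul_zero] at h1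
    exact h1.eventually (gt_mem_nhds (by linarith))
  have hev2 : ∀ᶠ δ in 𝓝[>] (0 : ℝ), δ < min 1 (min (c / 4) (min (1 / (2 * D)) (y₀ / F f A))) :=
    nhdsWithin_le_nhds (gt_mem_nhds (by positivity))
  obtain ⟨δ, ⟨hδr, hδs⟩, hδ⟩ := ((hev.and hev2).and self_mem_nhdsWithin).exists
  simp only [lt_min_iff] at hδs
  obtain ⟨hδ1, hδc, hδD, hδy⟩ := hδs
  replace hδ : 0 < δ := hδ
  have hint : ∀ s, A ≤ s → (s - A) / koSlope p f l δ s ≤ ∫ σ in A..s, 1 / koSlope p f l δ σ := by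
    intro s hs
    have : ∫ σ in A..s, 1 / koSlope p f l δ s ≤ ∫ σ in A..s, 1 / koSlope p f l δ σ := by
      refine intervalIntegral.integral_mono_on hs intervalIntegrable_const ?_ ?_
      · refine ContinuousOn.intervalIntegrable ?_
        rw [uIcc_of_le hs]
        exact (continuousOn_inv_slope h hf hδ).mono fun x hx => hA.trans_le hx.1
      · intro x hx
        exact one_div_le_one_div_of_le (slope_pos h hf hδ (hA.trans_le hx.1))
          (monotoneOn_slope h hf hδ (hA.le.trans hx.1) (hA.le.trans hs) hx.2)
    simpa [div_eq_mul_inv] using this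
  refine ⟨δ, hδ, hδ1.le, ?_, fun s hs => ?_⟩
  · refine lt_of_lt_of_le ?_ (hint B hAB.le)
    rwa [lt_div_iff₀ (slope_pos h hf hδ (hA.trans hAB))]
  · have hs0 : 0 < s := hA.trans_le hs
    set k := koSlope p f l δ s with hk
    have hkpos : 0 < k := slope_pos h hf hδ hs0
    have hlk := h.condL.pos k hkpos
    have hfs := hf.pos s hs0
    set Γ := ∫ σ in A..s, 1 / koSlope p f l δ σ with hΓ
    have hΓk : s - A ≤ Γ * k := by
      have := hint s hs
      rwa [div_le_iff₀ hkpos] at this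
    have hΓ0 : 0 ≤ Γ := le_trans (div_nonneg (by linarith) hkpos.le) (hint s hs)
    -- the key inequality `D δ s ≤ k (r₀ + Γ)`
    have key : D * (δ * s) ≤ k * (r₀ + Γ) := by
      -- For s ≥ 2A, Γk ≥ s - A ≥ s/2 suffices. For s < 2A the gap s - A may vanish, and the
      -- infinite slope of K⁻¹ at 0 makes r₀k large enough.
      rcases le_or_gt (2 * A) s with h2 | h2
      · have h3 : D * δ ≤ 1 / 2 := by
          rw [lt_div_iff₀ (by positivity)] at hδD
          linarith
        nlinarith [mul_pos hkpos hr₀]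
      · have h4 : Kinv p l (δ * F f A) ≤ k := monotoneOn_slope h hf hδ hA.le hs0.le hs
        have h5 := hlow (δ * F f A) (by positivity)
          (by rw [lt_div_iff₀ hFA] at hδy; exact hδy.le)
        have h6 : D * (2 * A) / (r₀ * F f A) * (δ * F f A) = D * (2 * A) * δ / r₀ := by
          field_simp
        rw [h6, div_le_iff₀ hr₀] at h5
        have h7 : D * δ * s ≤ D * δ * (2 * A) := by
          have : 0 ≤ D * δ := by positivity
          exact mul_le_mul_of_nonneg_left h2.le this
        nlinarith [mul_nonneg hkpos.le hΓ0, mul_le_mul_of_nonneg_right h4 hr₀.le]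
    have hKk : K p l k = δ * F f s := h.K_Kinv (mul_nonneg hδ.le (hf.F_nonneg hs0.le))
    have h8 : k ^ (p - 1) / l k ≤ C' * (δ * (s * f s) / k) := by
      refine (hK k hkpos).trans ?_
      rw [hKk]
      have := hf.F_le hs0.le
      gcongr
    have hR : 0 < r₀ + Γ := by linarith
    have h9 : C / (r₀ + Γ) * k ^ (p - 1) ≤ c / 4 * (f s * l k) := by
      have h10 : k ^ (p - 1) ≤ C' * (δ * (s * f s) / k) * l k := by
        rwa [div_le_iff₀ hlk] at h8
      -- Using C + 1 instead of C keeps D positive when C = 0.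
      have h11 : (C + 1) * C' * (δ * s) / (k * (r₀ + Γ)) ≤ c / 4 := by
        rw [div_le_iff₀ (by positivity)]
        have : (C + 1) * C' = D * (c / 4) := by rw [hD]; field_simp
        rw [this]
        nlinarith
      calc C / (r₀ + Γ) * k ^ (p - 1) ≤ (C + 1) / (r₀ + Γ) * (C' * (δ * (s * f s) / k) * l k) := by
            gcongr
            linarith
        _ = (C + 1) * C' * (δ * s) / (k * (r₀ + Γ)) * (f s * l k) := by
            field_simp
        _ ≤ _ := by gcongr
    have h12 : 0 < f s * l k := by positivity
    nlinarith

end KellerOsserman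

/-! ### Horizontal fields, gradients and integration by parts. -/

namespace Heisenberg

open scoped Pointwise

variable {m : ℕ}

instance : (volume : Measure ((Fin m → ℝ) × ℝ)).IsAddHaarMeasure :=
  inferInstanceAs ((volume : Measure (Fin m → ℝ)).prod (volume : Measure ℝ)).IsAddHaarMeasure

instance : (volume : Measure (H m)).IsAddHaarMeasure :=
  Measure.prod.instIsAddHaarMeasure (volume : Measure (Fin m → ℝ))
    (volume : Measure ((Fin m → ℝ) × ℝ))

instance : (volume : Measure (H m)).Regular :=
  Measure.Regular.of_sigmaCompactSpace_of_isLocallyFiniteMeasure _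

/-- The vertical component of the left-invariant horizontal fields, as a linear functional of the
base point. -/
noncomputable def vert : Fin m ⊕ Fin m → H m → ℝ
  | Sum.inl j => fun q => 2 * q.2.1 j
  | Sum.inr j => fun q => -2 * q.1 j

/-- The constant component of the left-invariant horizontal fields. -/
def horiz : Fin m ⊕ Fin m → H m
  | Sum.inl j => (Pi.single j 1, 0, 0)
  | Sum.inr j => (0, Pi.single j 1, 0)

/-- The left-invariant horizontal fields `X_j` and `Y_j`, as vectors. -/
noncomputable def field (i : Fin m ⊕ Fin m) (q : H m) : H m :=
  horiz i + vert i q • (0, 0, 1)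

/-- The derivative along a left-invariant horizontal field. -/
noncomputable def D (i : Fin m ⊕ Fin m) (u : H m → ℝ) (q : H m) : ℝ := fderiv ℝ u q (field i q)

theorem gradDot_eq (u v : H m → ℝ) (q : H m) : gradDot u v q = ∑ i, D i u q * D i v q := by
  have hX : ∀ (j : Fin m) (u : H m → ℝ), X j u q = D (Sum.inl j) u q := fun j u => by
    simp only [X, D, field, horiz, vert]; congr 1; simp
  have hY : ∀ (j : Fin m) (u : H m → ℝ), Y j u q = D (Sum.inr j) u q := fun j u => by
    simp only [Y, D, field, horiz, vert]; congr 1; simp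
  simp only [gradDot, hX, hY, Fintype.sum_sum_type, Finset.sum_add_distrib]

theorem gradDot_self_nonneg (u : H m → ℝ) (q : H m) : 0 ≤ gradDot u u q := by
  rw [gradDot_eq]
  exact Finset.sum_nonneg fun i _ => mul_self_nonneg _

theorem gradNorm_nonneg (u : H m → ℝ) (q : H m) : 0 ≤ gradNorm u q := Real.sqrt_nonneg _

theorem gradNorm_sq (u : H m → ℝ) (q : H m) : gradNorm u q ^ 2 = gradDot u u q :=
  Real.sq_sqrt (gradDot_self_nonneg u q)

theorem gradNorm_eq (u : H m → ℝ) (q : H m) : gradNorm u q = √(∑ i, D i u q ^ 2) := by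
  rw [gradNorm, gradDot_eq]
  simp only [sq]

theorem abs_gradDot_le (u v : H m → ℝ) (q : H m) :
    |gradDot u v q| ≤ gradNorm u q * gradNorm v q := by
  rw [gradNorm_eq, gradNorm_eq, gradDot_eq, ← Real.sqrt_mul (Finset.sum_nonneg fun i _ => sq_nonneg _)]
  exact Real.abs_le_sqrt (Finset.sum_mul_sq_le_sq_mul_sq _ _ _)

theorem gradNorm_le_sum (u : H m → ℝ) (q : H m) : gradNorm u q ≤ ∑ i, |D i u q| := by
  rw [gradNorm_eq]
  refine Real.sqrt_le_iff.2 ⟨Finset.sum_nonneg fun i _ => abs_nonneg _, ?_⟩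
  have := Finset.sum_sq_le_sq_sum_of_nonneg (s := Finset.univ) (f := fun i => |D i u q|)
    fun i _ => abs_nonneg _
  simpa only [sq_abs] using this

theorem D_comp {φ : ℝ → ℝ} {φ' : ℝ} {u : H m → ℝ} {q : H m} (i : Fin m ⊕ Fin m)
    (hφ : HasDerivAt φ φ' (u q)) (hu : DifferentiableAt ℝ u q) :
    D i (fun q => φ (u q)) q = φ' * D i u q := by
  have : HasFDerivAt (fun q => φ (u q)) (φ' • fderiv ℝ u q) q :=
    hφ.comp_hasFDerivAt q hu.hasFDerivAt
  rw [D, this.fderiv]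
  simp [D]

theorem D_mul {u v : H m → ℝ} {q : H m} (i : Fin m ⊕ Fin m)
    (hu : DifferentiableAt ℝ u q) (hv : DifferentiableAt ℝ v q) :
    D i (fun q => u q * v q) q = u q * D i v q + v q * D i u q := by
  have : HasFDerivAt (fun q => u q * v q) _ q := hu.hasFDerivAt.mul hv.hasFDerivAt
  rw [D, this.fderiv]
  simp [D]

theorem D_sub {u v : H m → ℝ} {q : H m} (i : Fin m ⊕ Fin m)
    (hu : DifferentiableAt ℝ u q) (hv : DifferentiableAt ℝ v q) :
    D i (fun q => u q - v q) q = D i u q - D i v q := by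
  have : HasFDerivAt (fun q => u q - v q) _ q := hu.hasFDerivAt.sub hv.hasFDerivAt
  rw [D, this.fderiv]
  simp [D]

theorem continuous_vert (i : Fin m ⊕ Fin m) : Continuous (vert i) := by
  rcases i with j | j <;> simp only [vert] <;> fun_prop

theorem contDiff_vert (i : Fin m ⊕ Fin m) : ContDiff ℝ ∞ (vert i) := by
  rcases i with j | j <;> simp only [vert] <;> fun_prop

/-- The coefficient of ∂_t in X_j and Y_j does not involve t. The other coefficients being constant,
the fields are divergence free. -/
theorem fderiv_vert_vertical (i : Fin m ⊕ Fin m) (q : H m) : fderiv ℝ (vert i) q (0, 0, 1) = 0 := by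
  have hl : IsLinearMap ℝ (vert i) := by
    rcases i with j | j <;> simp only [vert] <;>
      exact ⟨fun a b => by simp [mul_add], fun c a => by simp; ring⟩
  have : vert i = LinearMap.toContinuousLinearMap hl.mk' := rfl
  rw [this, ContinuousLinearMap.fderiv]
  rcases i with j | j <;> simp [vert]

theorem continuous_field (i : Fin m ⊕ Fin m) : Continuous (field i) :=
  continuous_const.add ((continuous_vert i).smul continuous_const)

theorem continuous_D {u : H m → ℝ} (hu : ContDiff ℝ 1 u) (i : Fin m ⊕ Fin m) :
    Continuous (D i u) :=
  (hu.continuous_fderiv one_ne_zero).clm_apply (continuous_field i)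

theorem continuous_gradDot {u v : H m → ℝ} (hu : ContDiff ℝ 1 u) (hv : ContDiff ℝ 1 v) :
    Continuous (gradDot u v) := by
  simp only [funext (gradDot_eq u v)]
  exact continuous_finsetSum _ fun i _ => (continuous_D hu i).mul (continuous_D hv i)

theorem continuous_gradNorm {u : H m → ℝ} (hu : ContDiff ℝ 1 u) : Continuous (gradNorm u) :=
  (continuous_gradDot hu hu).sqrt

theorem D_eq_zero_of_notMem {u : H m → ℝ} (i : Fin m ⊕ Fin m) {q : H m} (hq : q ∉ tsupport u) :
    D i u q = 0 := by
  rw [D, fderiv_of_notMem_tsupport (𝕜 := ℝ) hq]; rfl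

theorem hasCompactSupport_D {u : H m → ℝ} (hu : HasCompactSupport u) (i : Fin m ⊕ Fin m) :
    HasCompactSupport (D i u) :=
  HasCompactSupport.intro hu fun _ hx => D_eq_zero_of_notMem i hx

/-- The fields `X_j`, `Y_j` are divergence free. -/
theorem integral_D_eq_zero {ζ : H m → ℝ} (hζ : ContDiff ℝ 1 ζ) (hc : HasCompactSupport ζ)
    (i : Fin m ⊕ Fin m) : ∫ q, D i ζ q = 0 := by
  have hI : ∀ v : H m, Integrable (fun q => fderiv ℝ ζ q v) := fun v =>
    ((hζ.continuous_fderiv one_ne_zero).clm_apply continuous_const).integrable_of_hasCompactSupport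
      ((hc.fderiv ℝ).comp_left (g := fun L : H m →L[ℝ] ℝ => L v) rfl)
  have hI2 : Integrable (fun q => vert i q * fderiv ℝ ζ q (0, 0, 1)) :=
    ((continuous_vert i).mul ((hζ.continuous_fderiv one_ne_zero).clm_apply
      continuous_const)).integrable_of_hasCompactSupport
      (((hc.fderiv ℝ).comp_left (g := fun L : H m →L[ℝ] ℝ => L (0, 0, 1)) rfl).mul_left)
  have hdζ : Differentiable ℝ ζ := hζ.differentiable one_ne_zero
  have h1 : ∫ q, fderiv ℝ ζ q (horiz i) = 0 := by
    have := integral_mul_fderiv_eq_neg_fderiv_mul_of_integrable (μ := volume) (f := fun _ : H m => (1 : ℝ)) (g := ζ)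
      (v := horiz i) (by simp) (by simpa using hI (horiz i))
      (by simpa using hζ.continuous.integrable_of_hasCompactSupport hc)
      (by simp) (fun x _ => hdζ x)
    simpa using this
  have h2 : ∫ q, vert i q * fderiv ℝ ζ q (0, 0, 1) = 0 := by
    have := integral_mul_fderiv_eq_neg_fderiv_mul_of_integrable (μ := volume) (f := vert i) (g := ζ)
      (v := (0, 0, 1)) (by simp [fderiv_vert_vertical]) hI2
      (((continuous_vert i).mul hζ.continuous).integrable_of_hasCompactSupport hc.mul_left)
      (fun x _ => ((contDiff_vert i).differentiable (by simp)) x) (fun x _ => hdζ x)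
    simpa [fderiv_vert_vertical] using this
  have h3 : ∀ q, D i ζ q = fderiv ℝ ζ q (horiz i) + vert i q * fderiv ℝ ζ q (0, 0, 1) := fun q => by
    rw [D, field, map_add, map_smul, smul_eq_mul]
  simp only [h3]
  rw [integral_add (hI _) hI2, h1, h2, add_zero]

/-- A function that is `C^1` near its closed support is `C^1`. -/
theorem contDiff_of_tsupport {E : Type*} [NormedAddCommGroup E] [NormedSpace ℝ E] {n : WithTop ℕ∞}
    {g : E → ℝ} (h : ∀ x ∈ tsupport g, ContDiffAt ℝ n g x) : ContDiff ℝ n g :=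
  contMDiff_iff_contDiff.1 (contMDiff_of_tsupport fun x hx => (h x hx).contMDiffAt)

/-! ### The flux, and the passage from smooth to C¹ test functions. -/

/-- The flux `|∇u|^(p-2) ∇u · ∇ζ`. -/
noncomputable def flux (p : ℝ) (u ζ : H m → ℝ) (q : H m) : ℝ :=
  gradNorm u q ^ (p - 2) * gradDot u ζ q

/-- Cauchy-Schwarz absorbs the possibly negative power: for p > 1 the bound is continuous, which
gives integrability and domination also for p < 2. Where ∇u = 0 the product ∇u · ∇ζ vanishes,
whatever value 0^(p-2) takes. -/
theorem abs_flux_le (p : ℝ) (u ζ : H m → ℝ) (q : H m) :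
    |flux p u ζ q| ≤ gradNorm u q ^ (p - 1) * gradNorm ζ q := by
  have h1 := abs_gradDot_le u ζ q
  rcases (gradNorm_nonneg u q).eq_or_lt with h0 | h0
  · rw [← h0, zero_mul] at h1
    rw [flux, abs_nonpos_iff.1 h1, mul_zero, abs_zero]
    exact mul_nonneg (Real.rpow_nonneg (gradNorm_nonneg u q) _) (gradNorm_nonneg _ _)
  · have h2 : gradNorm u q ^ (p - 1) = gradNorm u q ^ (p - 2) * gradNorm u q := by
      rw [← Real.rpow_add_one h0.ne']; ring_nf
    rw [flux, abs_mul, abs_of_nonneg (Real.rpow_nonneg h0.le _), h2, mul_assoc]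
    exact mul_le_mul_of_nonneg_left h1 (Real.rpow_nonneg h0.le _)

theorem measurable_flux (p : ℝ) {u ζ : H m → ℝ} (hu : ContDiff ℝ 1 u) (hζ : ContDiff ℝ 1 ζ) :
    Measurable (flux p u ζ) :=
  ((continuous_gradNorm hu).measurable.pow_const _).mul (continuous_gradDot hu hζ).measurable

theorem continuous_gradNorm_rpow {p : ℝ} (hp : 1 < p) {u : H m → ℝ} (hu : ContDiff ℝ 1 u) :
    Continuous fun q => gradNorm u q ^ (p - 1) :=
  (continuous_gradNorm hu).rpow_const fun _ => Or.inr (by linarith)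

theorem gradNorm_eq_zero_of_notMem {u : H m → ℝ} {q : H m} (hq : q ∉ tsupport u) :
    gradNorm u q = 0 := by
  simp [gradNorm_eq, D_eq_zero_of_notMem _ hq]

theorem integrable_flux {p : ℝ} (hp : 1 < p) {u ζ : H m → ℝ} (hu : ContDiff ℝ 1 u)
    (hζ : ContDiff ℝ 1 ζ) (hc : HasCompactSupport ζ) : Integrable (flux p u ζ) := by
  have hb : Integrable fun q => gradNorm u q ^ (p - 1) * gradNorm ζ q := by
    refine ((continuous_gradNorm_rpow hp hu).mul
      (continuous_gradNorm hζ)).integrable_of_hasCompactSupport ?_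
    exact (HasCompactSupport.intro hc fun _ h => gradNorm_eq_zero_of_notMem h).mul_left
  exact hb.mono' (measurable_flux p hu hζ).aestronglyMeasurable
    (ae_of_all _ fun q => abs_flux_le p u ζ q)

/-- The mollifiers used below. -/
noncomputable def mollifier (n : ℕ) : ContDiffBump (0 : H m) where
  rIn := 1 / (2 * (n + 1))
  rOut := 1 / (n + 1)
  rIn_pos := by positivity
  rIn_lt_rOut := by
    apply one_div_lt_one_div_of_lt <;> [positivity; (have : (0 : ℝ) ≤ n := n.cast_nonneg; linarith)]

open scoped Convolution in
/-- The mollification of a function. -/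
noncomputable def mollify (w : H m → ℝ) (n : ℕ) : H m → ℝ :=
  (mollifier n).normed volume ⋆[ContinuousLinearMap.lsmul ℝ ℝ, volume] w

theorem tendsto_mollifier : Tendsto (fun n => (mollifier (m := m) n).rOut) atTop (𝓝 0) :=
  tendsto_one_div_add_atTop_nhds_zero_nat

theorem contDiff_mollify {w : H m → ℝ} (hw : Continuous w) (n : ℕ) : ContDiff ℝ ∞ (mollify w n) :=
  (mollifier n).hasCompactSupport_normed.contDiff_convolution_left _ (mollifier n).contDiff_normed
    hw.locallyIntegrable

theorem mollify_nonneg {w : H m → ℝ} (hw : ∀ q, 0 ≤ w q) (n : ℕ) (q : H m) :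
    0 ≤ mollify w n q :=
  integral_nonneg fun t => mul_nonneg ((mollifier n).nonneg_normed t) (hw _)

theorem tendsto_mollify {w : H m → ℝ} (hw : Continuous w) (q : H m) :
    Tendsto (fun n => mollify w n q) atTop (𝓝 (w q)) :=
  ContDiffBump.convolution_tendsto_right_of_continuous tendsto_mollifier hw q

theorem abs_mollify_le {w : H m → ℝ} (hw : Continuous w) {S : ℝ} (hS : ∀ q, |w q| ≤ S) (n : ℕ)
    (q : H m) : |mollify w n q| ≤ 3 * S := by
  have h1 : dist (mollify w n q) (w q) ≤ 2 * S := by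
    refine ContDiffBump.dist_normed_convolution_le hw.aestronglyMeasurable fun x _ => ?_
    rw [Real.dist_eq]
    have := abs_sub (w x) (w q)
    linarith [hS x, hS q]
  rw [Real.dist_eq] at h1
  have := abs_sub_abs_le_abs_sub (mollify w n q) (w q)
  linarith [hS q]

theorem support_mollify_subset (w : H m → ℝ) (n : ℕ) :
    Function.support (mollify w n) ⊆ Metric.closedBall 0 1 + tsupport w := by
  refine (support_convolution_subset _).trans (add_subset_add ?_ (subset_tsupport _))
  rw [ContDiffBump.support_normed_eq]
  refine Metric.ball_subset_closedBall.trans (Metric.closedBall_subset_closedBall ?_)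
  simp only [mollifier]
  rw [div_le_one (by positivity)]
  have : (0 : ℝ) ≤ n := n.cast_nonneg
  linarith

/-- Euclidean mollification commutes with derivatives in a constant direction only. The variable
fields are treated by freezing them at the point where the derivative is taken. -/
theorem fderiv_mollify {w : H m → ℝ} (hw : ContDiff ℝ 1 w) (hc : HasCompactSupport w) (n : ℕ)
    (q v : H m) : fderiv ℝ (mollify w n) q v = mollify (fun a => fderiv ℝ w a v) n q := by
  have hloc : LocallyIntegrable ((mollifier (m := m) n).normed volume) :=
    (mollifier n).continuous_normed.locallyIntegrable
  have := hc.hasFDerivAt_convolution_right (ContinuousLinearMap.lsmul ℝ ℝ) (μ := volume) hloc hw q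
  rw [mollify, this.fderiv, convolution_precompR_apply _ hloc (hc.fderiv ℝ)
    (hw.continuous_fderiv one_ne_zero)]
  rfl

/-- The weak inequality may be tested with `C^1` functions. -/
theorem IsWeakSolution.c1_test {p : ℝ} (hp : 1 < p) {f l : ℝ → ℝ} {u : H m → ℝ}
    (hu : IsWeakSolution p f l u) (hu0 : ∀ q, 0 ≤ u q) (hf : ContinuousOn f (Ici 0))
    (hl : ContinuousOn l (Ici 0)) {w : H m → ℝ} (hw : ContDiff ℝ 1 w) (hc : HasCompactSupport w)
    (hw0 : ∀ q, 0 ≤ w q) :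
    ∫ q, f (u q) * l (gradNorm u q) * w q ≤ -∫ q, flux p u w q := by
  obtain ⟨hu1, htest⟩ := hu
  -- The mollifiers have radius at most 1, so this compact set contains the supports of all
  -- mollifications.
  set K : Set (H m) := Metric.closedBall 0 1 + tsupport w with hK
  have hKc : IsCompact K := (isCompact_closedBall 0 1).add hc
  have hsupp : ∀ n, tsupport (mollify w n) ⊆ K := fun n =>
    closure_minimal (support_mollify_subset w n) hKc.isClosed
  have hcn : ∀ n, HasCompactSupport (mollify w n) := fun n =>
    HasCompactSupport.of_support_subset_isCompact hKc (support_mollify_subset w n)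
  have hsm : ∀ n, ContDiff ℝ 1 (mollify w n) := fun n =>
    (contDiff_mollify hw.continuous n).of_le (by exact_mod_cast le_top)
  obtain ⟨S, hS⟩ := hw.continuous.bounded_above_of_compact_support hc
  obtain ⟨S', hS'⟩ := (hw.continuous_fderiv one_ne_zero).bounded_above_of_compact_support (hc.fderiv ℝ)
  have hfl : Continuous fun q => f (u q) * l (gradNorm u q) :=
    (hf.comp_continuous hu1.continuous hu0).mul
      (hl.comp_continuous (continuous_gradNorm hu1) (gradNorm_nonneg u))
  have hD : ∀ n i q, D i (mollify w n) q = mollify (fun a => fderiv ℝ w a (field i q)) n q :=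
    fun n i q => fderiv_mollify hw hc n q _
  have hcf : ∀ v, Continuous fun a => fderiv ℝ w a v := fun v =>
    (hw.continuous_fderiv one_ne_zero).clm_apply continuous_const
  have hDlim : ∀ i q, Tendsto (fun n => D i (mollify w n) q) atTop (𝓝 (D i w q)) := fun i q => by
    simp only [hD]
    exact tendsto_mollify (hcf _) q
  have hDb : ∀ n i q, |D i (mollify w n) q| ≤ 3 * (S' * ‖field i q‖) := fun n i q => by
    rw [hD]
    refine abs_mollify_le (hcf _) (fun a => ?_) n q
    exact ((fderiv ℝ w a).le_opNorm _).trans (mul_le_mul_of_nonneg_right (hS' a) (norm_nonneg _))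
  have hlim1 : Tendsto (fun n => ∫ q, f (u q) * l (gradNorm u q) * mollify w n q) atTop
      (𝓝 (∫ q, f (u q) * l (gradNorm u q) * w q)) := by
    refine tendsto_integral_of_dominated_convergence
      (K.indicator fun q => |f (u q) * l (gradNorm u q)| * (3 * S))
      (fun n => (hfl.mul (hsm n).continuous).aestronglyMeasurable) ?_ ?_ ?_
    · rw [integrable_indicator_iff hKc.measurableSet]
      exact (hfl.abs.mul continuous_const).continuousOn.integrableOn_compact hKc
    · refine fun n => ae_of_all _ fun q => ?_
      by_cases hq : q ∈ K
      · rw [indicator_of_mem hq, norm_mul]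
        exact mul_le_mul_of_nonneg_left (abs_mollify_le hw.continuous hS n q) (norm_nonneg _)
      · rw [indicator_of_notMem hq, image_eq_zero_of_notMem_tsupport fun h => hq (hsupp n h)]
        simp
    · exact ae_of_all _ fun q => (tendsto_mollify hw.continuous q).const_mul _
  have hlim2 : Tendsto (fun n => ∫ q, flux p u (mollify w n) q) atTop (𝓝 (∫ q, flux p u w q)) := by
    refine tendsto_integral_of_dominated_convergence
      (K.indicator fun q => gradNorm u q ^ (p - 1) * ∑ i, 3 * (S' * ‖field i q‖))
      (fun n => (measurable_flux p hu1 (hsm n)).aestronglyMeasurable) ?_ ?_ ?_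
    · rw [integrable_indicator_iff hKc.measurableSet]
      refine (Continuous.mul (continuous_gradNorm_rpow hp hu1) ?_).continuousOn.integrableOn_compact hKc
      exact continuous_finsetSum _ fun i _ => by have := continuous_field i; fun_prop
    · refine fun n => ae_of_all _ fun q => (abs_flux_le p u _ q).trans ?_
      by_cases hq : q ∈ K
      · rw [indicator_of_mem hq]
        refine mul_le_mul_of_nonneg_left ?_ (Real.rpow_nonneg (gradNorm_nonneg _ _) _)
        exact (gradNorm_le_sum _ q).trans (Finset.sum_le_sum fun i _ => hDb n i q)
      · rw [indicator_of_notMem hq, gradNorm_eq_zero_of_notMem fun h => hq (hsupp n h), mul_zero]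
    · refine ae_of_all _ fun q => Tendsto.const_mul _ ?_
      simp only [gradDot_eq]
      exact tendsto_finsetSum _ fun i _ => (hDlim i q).const_mul _
  exact le_of_tendsto_of_tendsto' hlim1 hlim2.neg fun n =>
    htest _ (contDiff_mollify hw.continuous n) (hcn n) (mollify_nonneg hw0 n)

/-! ### Left translations and the invariance of the inequality. -/

/-- The left translation by `a`. -/
noncomputable def lmul (a q : H m) : H m :=
  (a.1 + q.1, a.2.1 + q.2.1, a.2.2 + q.2.2 + 2 * ∑ i, (a.2.1 i * q.1 i - a.1 i * q.2.1 i))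

theorem lmul_neg_lmul (a q : H m) : lmul (-a) (lmul a q) = q := by
  refine Prod.ext (by simp [lmul]) (Prod.ext (by simp [lmul]) ?_)
  simp only [lmul, Prod.fst_neg, Prod.snd_neg, Pi.neg_apply, Pi.add_apply]
  have : ∑ i, (-a.2.1 i * (a.1 i + q.1 i) - -a.1 i * (a.2.1 i + q.2.1 i)) =
      -∑ i, (a.2.1 i * q.1 i - a.1 i * q.2.1 i) := by
    rw [← Finset.sum_neg_distrib]
    exact Finset.sum_congr rfl fun i _ => by ring
  rw [this]
  ring

theorem contDiff_lmul (a : H m) : ContDiff ℝ ∞ (lmul a) := by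
  unfold lmul
  fun_prop

/-- The left translation by `a` as a homeomorphism. -/
noncomputable def lmulHomeo (a : H m) : H m ≃ₜ H m where
  toFun := lmul a
  invFun := lmul (-a)
  left_inv := lmul_neg_lmul a
  right_inv q := by simpa using lmul_neg_lmul (-a) q
  continuous_toFun := (contDiff_lmul a).continuous
  continuous_invFun := (contDiff_lmul (-a)).continuous

/-- The differential of the translation is the linear map `L`. What it adds to the vertical
component of a horizontal unit vector is `vert i a`, the change of the coefficient from q to `lmul a
q`. This left-invariance makes gradients commute with translations. -/
theorem fderiv_lmul_field (a q : H m) (i : Fin m ⊕ Fin m) :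
    fderiv ℝ (lmul a) q (field i q) = field i (lmul a q) := by
  set L : H m →ₗ[ℝ] H m :=
    { toFun := fun v => (v.1, v.2.1, v.2.2 + 2 * ∑ i, (a.2.1 i * v.1 i - a.1 i * v.2.1 i))
      map_add' := fun v w => by
        refine Prod.ext rfl (Prod.ext rfl ?_)
        simp only [Prod.fst_add, Prod.snd_add, Pi.add_apply, mul_add, Finset.sum_sub_distrib,
          Finset.sum_add_distrib]
        ring
      map_smul' := fun c v => by
        refine Prod.ext rfl (Prod.ext rfl ?_)
        simp only [Prod.smul_fst, Prod.smul_snd, Pi.smul_apply, smul_eq_mul, RingHom.id_apply,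
          mul_add, Finset.mul_sum]
        congr 1
        exact Finset.sum_congr rfl fun i _ => by ring } with hL
  have h1 : lmul a = fun q => a + LinearMap.toContinuousLinearMap L q := by
    funext q
    refine Prod.ext rfl (Prod.ext rfl ?_)
    simp [lmul, hL, add_assoc]
  have h2 : fderiv ℝ (lmul a) q = LinearMap.toContinuousLinearMap L := by
    rw [h1, fderiv_const_add, ContinuousLinearMap.fderiv]
  rw [h2, LinearMap.coe_toContinuousLinearMap', hL]
  rcases i with j | j
  · refine Prod.ext ?_ (Prod.ext ?_ ?_)
    · simp [field, horiz, vert]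
    · simp [field, horiz, vert]
    · simp [field, horiz, vert, lmul, Pi.single_apply]; ring
  · refine Prod.ext ?_ (Prod.ext ?_ ?_)
    · simp [field, horiz, vert]
    · simp [field, horiz, vert]
    · simp [field, horiz, vert, lmul, Pi.single_apply]; ring

theorem D_comp_lmul {u : H m → ℝ} (hu : Differentiable ℝ u) (a q : H m) (i : Fin m ⊕ Fin m) :
    D i (fun q => u (lmul a q)) q = D i u (lmul a q) := by
  have h1 : fderiv ℝ (fun q => u (lmul a q)) q = (fderiv ℝ u (lmul a q)).comp (fderiv ℝ (lmul a) q) :=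
    fderiv_comp q (hu _) ((contDiff_lmul a).differentiable (by simp) q)
  rw [D, h1, ContinuousLinearMap.comp_apply, fderiv_lmul_field, D]

/-- Translate in x, then in y, then in t by an amount depending on (x, y): an iterated skew product
of translations. -/
theorem measurePreserving_lmul (a : H m) : MeasurePreserving (lmul a) := by
  have h2 : ∀ x : Fin m → ℝ, MeasurePreserving (fun r : (Fin m → ℝ) × ℝ => Prod.mk
      (a.2.1 + r.1) (a.2.2 + r.2 + 2 * ∑ i, (a.2.1 i * x i - a.1 i * r.1 i))) := fun x => by
    refine (measurePreserving_add_left volume a.2.1).skew_product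
      (g := fun y t => a.2.2 + t + 2 * ∑ i, (a.2.1 i * x i - a.1 i * y i)) (by fun_prop) ?_
    refine ae_of_all _ fun y => ?_
    simp only [add_comm a.2.2 _, add_assoc]
    exact (measurePreserving_add_right volume _).map_eq
  refine (measurePreserving_add_left volume a.1).skew_product
    (g := fun (x : Fin m → ℝ) (r : (Fin m → ℝ) × ℝ) => (a.2.1 + r.1, a.2.2 + r.2 + 2 * ∑ i, (a.2.1 i * x i - a.1 i * r.1 i)))
    (by fun_prop) (ae_of_all _ fun x => (h2 x).map_eq)

theorem IsWeakSolution.comp_lmul {p : ℝ} {f l : ℝ → ℝ} {u : H m → ℝ}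
    (hu : IsWeakSolution p f l u) (a : H m) : IsWeakSolution p f l (fun q => u (lmul a q)) := by
  have hdu := hu.1.differentiable one_ne_zero
  refine ⟨hu.1.comp ((contDiff_lmul a).of_le (by exact_mod_cast le_top)), fun ζ hζ hc hζ0 => ?_⟩
  set ζ' : H m → ℝ := fun q => ζ (lmul (-a) q) with hζ'
  have hζ'd : ContDiff ℝ ∞ ζ' := hζ.comp (contDiff_lmul (-a))
  have hc' : HasCompactSupport ζ' := hc.comp_homeomorph (lmulHomeo (-a))
  have hback : ζ = fun q => ζ' (lmul a q) := by
    funext q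
    simp [hζ', lmul_neg_lmul]
  have key := hu.2 ζ' hζ'd hc' fun q => hζ0 _
  have hme : MeasurableEmbedding (lmul a) := (lmulHomeo a).measurableEmbedding
  have hgd : ∀ v, Differentiable ℝ v → ∀ q,
      gradDot (fun q => u (lmul a q)) (fun q => v (lmul a q)) q = gradDot u v (lmul a q) :=
    fun v hv q => by simp only [gradDot_eq, D_comp_lmul hdu, D_comp_lmul hv]
  have hgn : ∀ q, gradNorm (fun q => u (lmul a q)) q = gradNorm u (lmul a q) := fun q => by
    rw [gradNorm, hgd u hdu, gradNorm]
  have i1 := (measurePreserving_lmul a).integral_comp hme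
    fun q => gradNorm u q ^ (p - 2) * gradDot u ζ' q
  have i2 := (measurePreserving_lmul a).integral_comp hme
    fun q => f (u q) * l (gradNorm u q) * ζ' q
  rw [← i1, ← i2] at key
  have e1 : ∀ q, gradDot (fun q => u (lmul a q)) ζ q = gradDot u ζ' (lmul a q) := fun q => by
    conv_lhs => rw [hback]
    exact hgd ζ' (hζ'd.differentiable (by simp)) q
  have e2 : ∀ q, ζ q = ζ' (lmul a q) := congrFun hback
  simp only [hgn, e1, e2]
  exact key

end Heisenberg

/-! ### The Korányi gauge and its derivatives. -/

namespace Heisenberg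

variable {m : ℕ}

/-- The coordinates of `z = (x, y)`. -/
def coord : Fin m ⊕ Fin m → H m → ℝ
  | Sum.inl j => fun q => q.1 j
  | Sum.inr j => fun q => q.2.1 j

theorem contDiff_coord (i : Fin m ⊕ Fin m) : ContDiff ℝ ∞ (coord i) := by
  rcases i with j | j <;> simp only [coord] <;> fun_prop

theorem D_of_isLinearMap {g : H m → ℝ} (hg : IsLinearMap ℝ g) (i : Fin m ⊕ Fin m) (q : H m) :
    D i g q = g (field i q) := by
  have : g = LinearMap.toContinuousLinearMap hg.mk' := rfl
  rw [D]
  conv_lhs => rw [this, ContinuousLinearMap.fderiv]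
  rfl

theorem D_coord (i k : Fin m ⊕ Fin m) (q : H m) : D i (coord k) q = if k = i then 1 else 0 := by
  have hl : IsLinearMap ℝ (coord k) := by
    rcases k with j | j <;> simp only [coord] <;> exact ⟨fun a b => by simp, fun c a => by simp⟩
  rw [D_of_isLinearMap hl]
  rcases k with j | j <;> rcases i with k | k <;>
    simp [coord, field, horiz, Pi.single_apply]

theorem D_vert_self (i : Fin m ⊕ Fin m) (q : H m) : D i (vert i) q = 0 := by
  have hl : IsLinearMap ℝ (vert i) := by
    rcases i with j | j <;> simp only [vert] <;>
      exact ⟨fun a b => by simp [mul_add], fun c a => by simp; ring⟩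
  rw [D_of_isLinearMap hl]
  rcases i with j | j <;> simp [vert, field, horiz]

theorem D_vertical (i : Fin m ⊕ Fin m) (q : H m) : D i (fun q : H m => q.2.2) q = vert i q := by
  rw [D_of_isLinearMap ⟨fun a b => by simp, fun c a => by simp⟩]
  rcases i with j | j <;> simp [vert, field, horiz]

theorem D_add {u v : H m → ℝ} {q : H m} (i : Fin m ⊕ Fin m)
    (hu : DifferentiableAt ℝ u q) (hv : DifferentiableAt ℝ v q) :
    D i (fun q => u q + v q) q = D i u q + D i v q := by
  have : HasFDerivAt (fun q => u q + v q) _ q := hu.hasFDerivAt.add hv.hasFDerivAt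
  rw [D, this.fderiv]
  simp [D]

theorem D_sum {ι : Type*} (s : Finset ι) {u : ι → H m → ℝ} {q : H m} (i : Fin m ⊕ Fin m)
    (hu : ∀ k ∈ s, DifferentiableAt ℝ (u k) q) :
    D i (fun q => ∑ k ∈ s, u k q) q = ∑ k ∈ s, D i (u k) q := by
  have : HasFDerivAt (fun q => ∑ k ∈ s, u k q) _ q := HasFDerivAt.fun_sum fun k hk => (hu k hk).hasFDerivAt
  rw [D, this.fderiv]
  simp [D]

/-- `|z|²`. -/
def zsq (q : H m) : ℝ := ∑ i, coord i q ^ 2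

/-- The fourth power `|z|⁴ + t²` of the gauge. -/
def gauge4 (q : H m) : ℝ := zsq q ^ 2 + q.2.2 ^ 2

/-- The Korányi gauge `(|z|⁴ + t²)^(1/4)`. -/
noncomputable def gauge (q : H m) : ℝ := gauge4 q ^ (1 / 4 : ℝ)

theorem zsq_nonneg (q : H m) : 0 ≤ zsq q := Finset.sum_nonneg fun _ _ => sq_nonneg _

theorem gauge4_nonneg (q : H m) : 0 ≤ gauge4 q := by unfold gauge4; positivity

theorem gauge_nonneg (q : H m) : 0 ≤ gauge q := Real.rpow_nonneg (gauge4_nonneg q) _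

theorem gauge_pow (q : H m) : gauge q ^ 4 = gauge4 q := by
  rw [gauge, ← Real.rpow_natCast, ← Real.rpow_mul (gauge4_nonneg q)]
  norm_num

theorem contDiff_zsq : ContDiff ℝ ∞ (zsq (m := m)) :=
  ContDiff.sum fun i _ => (contDiff_coord i).pow 2

theorem contDiff_gauge4 : ContDiff ℝ ∞ (gauge4 (m := m)) := by
  unfold gauge4
  exact (contDiff_zsq.pow 2).add (by fun_prop)

theorem continuous_gauge : Continuous (gauge (m := m)) :=
  contDiff_gauge4.continuous.rpow_const fun _ => Or.inr (by norm_num)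

theorem contDiffAt_gauge {q : H m} (hq : 0 < gauge4 q) {n : ℕ∞} : ContDiffAt ℝ n gauge q :=
  (contDiff_gauge4.contDiffAt.of_le (by exact_mod_cast le_top)).rpow_const_of_ne hq.ne'

theorem sum_vert_sq (q : H m) : ∑ i, vert i q ^ 2 = 4 * zsq q := by
  simp only [zsq, Fintype.sum_sum_type, vert, coord, mul_pow, ← Finset.mul_sum]
  ring

/-- The vector of vertical coefficients is 2(y, -x), orthogonal to z = (x, y); this removes the
mixed terms in the sums below. -/
theorem sum_coord_mul_vert (q : H m) : ∑ i, coord i q * vert i q = 0 := by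
  simp only [Fintype.sum_sum_type, vert, coord, ← Finset.sum_add_distrib]
  exact Finset.sum_eq_zero fun i _ => by ring

theorem D_zsq (i : Fin m ⊕ Fin m) (q : H m) : D i zsq q = 2 * coord i q := by
  have hd : ∀ k, DifferentiableAt ℝ (coord (m := m) k) q := fun k =>
    (contDiff_coord k).differentiable (by simp) q
  have h1 : D i zsq q = ∑ k, D i (fun q => coord k q ^ 2) q :=
    D_sum _ i fun k _ => (hd k).pow 2
  have h2 : ∀ k, D i (fun q => coord k q ^ 2) q = if k = i then 2 * coord i q else 0 := fun k => by
    simp only [sq]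
    rw [D_mul i (hd k) (hd k), D_coord]
    split_ifs with h
    · subst h; ring
    · ring
  rw [h1]
  simp [h2]

theorem D_gauge4 (i : Fin m ⊕ Fin m) (q : H m) :
    D i gauge4 q = 4 * (zsq q * coord i q) + 2 * (q.2.2 * vert i q) := by
  have hz : DifferentiableAt ℝ (zsq (m := m)) q := contDiff_zsq.differentiable (by simp) q
  have ht : DifferentiableAt ℝ (fun q : H m => q.2.2) q := by fun_prop
  have h1 : D i gauge4 q = D i (fun q => zsq q ^ 2) q + D i (fun q : H m => q.2.2 ^ 2) q :=
    D_add i (hz.pow 2) (ht.pow 2)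
  rw [h1]
  simp only [sq]
  rw [D_mul i hz hz, D_mul i ht ht, D_zsq, D_vertical]
  ring

theorem contDiff_D_gauge4 (i : Fin m ⊕ Fin m) : ContDiff ℝ ∞ (D i (gauge4 (m := m))) := by
  rw [funext (D_gauge4 (m := m) i)]
  have := contDiff_coord (m := m) i
  have := contDiff_vert (m := m) i
  have := contDiff_zsq (m := m)
  fun_prop

theorem D_D_gauge4 (i : Fin m ⊕ Fin m) (q : H m) :
    D i (D i gauge4) q = 8 * coord i q ^ 2 + 4 * zsq q + 2 * vert i q ^ 2 := by
  have hz : DifferentiableAt ℝ (zsq (m := m)) q := contDiff_zsq.differentiable (by simp) q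
  have ht : DifferentiableAt ℝ (fun q : H m => q.2.2) q := by fun_prop
  have hc : DifferentiableAt ℝ (coord (m := m) i) q := (contDiff_coord i).differentiable (by simp) q
  have hv : DifferentiableAt ℝ (vert (m := m) i) q := (contDiff_vert i).differentiable (by simp) q
  have h0 : ∀ c : ℝ, D i (fun _ : H m => c) q = 0 := fun c => by simp [D]
  have hzc : DifferentiableAt ℝ (fun q => zsq q * coord i q) q := hz.mul hc
  have htv : DifferentiableAt ℝ (fun q => q.2.2 * vert i q) q := ht.mul hv
  rw [funext (D_gauge4 (m := m) i), D_add i (u := fun q => 4 * (zsq q * coord i q))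
      (v := fun q => 2 * (q.2.2 * vert i q)) (hzc.const_mul 4) (htv.const_mul 2),
    D_mul i (differentiableAt_const 4) hzc, D_mul i (differentiableAt_const 2) htv,
    D_mul i hz hc, D_mul i ht hv, D_zsq, D_vertical, D_vert_self, D_coord, h0, h0]
  simp only [if_true]
  ring

theorem sum_D_gauge4_sq (q : H m) : ∑ i, D i gauge4 q ^ 2 = 16 * zsq q * gauge4 q := by
  have h : ∀ i, D i gauge4 q ^ 2 = 16 * zsq q ^ 2 * coord i q ^ 2 +
      16 * zsq q * q.2.2 * (coord i q * vert i q) + 4 * q.2.2 ^ 2 * vert i q ^ 2 := fun i => by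
    rw [D_gauge4]; ring
  simp only [h, Finset.sum_add_distrib, ← Finset.mul_sum, sum_coord_mul_vert, sum_vert_sq]
  rw [← zsq, gauge4]
  ring

theorem sum_coord_mul_D_gauge4 (q : H m) : ∑ i, coord i q * D i gauge4 q = 4 * zsq q ^ 2 := by
  have h : ∀ i, coord i q * D i gauge4 q = 4 * zsq q * coord i q ^ 2 +
      2 * q.2.2 * (coord i q * vert i q) := fun i => by
    rw [D_gauge4]; ring
  simp only [h, Finset.sum_add_distrib, ← Finset.mul_sum, sum_coord_mul_vert]
  rw [← zsq]
  ring

theorem sum_D_D_gauge4 (q : H m) : ∑ i, D i (D i gauge4) q = (8 * m + 16) * zsq q := by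
  simp only [D_D_gauge4, Finset.sum_add_distrib, ← Finset.mul_sum, sum_vert_sq]
  rw [← zsq]
  simp
  ring

theorem gradNorm_gauge4 (q : H m) : gradNorm gauge4 q = 4 * √(zsq q) * √(gauge4 q) := by
  rw [gradNorm_eq, sum_D_gauge4_sq, mul_assoc, Real.sqrt_mul (by norm_num),
    Real.sqrt_mul (zsq_nonneg q), ← mul_assoc]
  norm_num

theorem D_gauge (i : Fin m ⊕ Fin m) {q : H m} (hq : 0 < gauge4 q) :
    D i gauge q = 1 / 4 * gauge4 q ^ (-(3 / 4) : ℝ) * D i gauge4 q := by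
  have h := D_comp (φ := fun x : ℝ => x ^ (1 / 4 : ℝ)) (u := gauge4) i
    (Real.hasDerivAt_rpow_const (Or.inl hq.ne')) (contDiff_gauge4.differentiable (by simp) q)
  rw [show ((1 / 4 : ℝ) - 1) = -(3 / 4) by norm_num] at h
  exact h

theorem gradNorm_gauge {q : H m} (hq : 0 < gauge4 q) :
    gradNorm gauge q = zsq q ^ (1 / 2 : ℝ) * gauge4 q ^ (-(1 / 4) : ℝ) := by
  have h1 : ∑ i, D i gauge q ^ 2 = zsq q * (gauge4 q ^ (-(1 / 4) : ℝ)) ^ 2 := by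
    simp only [D_gauge _ hq, mul_pow, ← Finset.mul_sum, sum_D_gauge4_sq]
    have e : (gauge4 q ^ (-(3 / 4) : ℝ)) ^ 2 * gauge4 q = (gauge4 q ^ (-(1 / 4) : ℝ)) ^ 2 := by
      rw [← Real.rpow_natCast, ← Real.rpow_natCast, ← Real.rpow_mul hq.le, ← Real.rpow_mul hq.le,
        ← Real.rpow_add_one hq.ne']
      norm_num
    rw [← e]
    ring
  rw [gradNorm_eq, h1, Real.sqrt_mul (zsq_nonneg q), Real.sqrt_sq (Real.rpow_nonneg hq.le _),
    Real.sqrt_eq_rpow]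

/-- |∇r| = |z|/r ≤ 1. In the comparison this puts |∇g|/2 in [0, 1] when the gradients are
comparable, where the scaling hypothesis on l applies. -/
theorem gradNorm_gauge_le_one {q : H m} (hq : 0 < gauge4 q) : gradNorm gauge q ≤ 1 := by
  have h1 : zsq q ^ 2 ≤ gauge4 q := by
    unfold gauge4
    nlinarith [sq_nonneg q.2.2]
  have h2 : zsq q ^ (1 / 2 : ℝ) ≤ gauge4 q ^ (1 / 4 : ℝ) := by
    calc zsq q ^ (1 / 2 : ℝ) = (zsq q ^ 2) ^ (1 / 4 : ℝ) := by
          rw [← Real.rpow_natCast, ← Real.rpow_mul (zsq_nonneg q)]; norm_num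
      _ ≤ _ := Real.rpow_le_rpow (sq_nonneg _) h1 (by norm_num)
  rw [gradNorm_gauge hq, Real.rpow_neg hq.le, ← div_eq_mul_inv,
    div_le_one (Real.rpow_pos_of_pos hq _)]
  exact h2

theorem coord_abs_le_gauge (i : Fin m ⊕ Fin m) (q : H m) : |coord i q| ≤ gauge q := by
  have h1 : coord i q ^ 2 ≤ zsq q :=
    Finset.single_le_sum (f := fun i => coord i q ^ 2) (fun _ _ => sq_nonneg _) (Finset.mem_univ i)
  have h2 : coord i q ^ 4 ≤ gauge q ^ 4 := by
    rw [gauge_pow, gauge4]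
    nlinarith [sq_nonneg q.2.2, sq_nonneg (coord i q), zsq_nonneg q]
  refine le_of_pow_le_pow_left₀ (n := 4) (by norm_num) (gauge_nonneg q) ?_
  have : |coord i q| ^ 4 = coord i q ^ 4 := by
    rw [show 4 = 2 * 2 by norm_num, pow_mul, pow_mul, sq_abs]
  rwa [this]

theorem abs_vertical_le_gauge_sq (q : H m) : |q.2.2| ≤ gauge q ^ 2 := by
  refine abs_le_of_sq_le_sq ?_ (sq_nonneg _)
  rw [← pow_mul, show 2 * 2 = 4 by norm_num, gauge_pow, gauge4]
  nlinarith [sq_nonneg (zsq q)]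

theorem norm_le_of_gauge_le {R : ℝ} {q : H m} (hq : gauge q ≤ R) : ‖q‖ ≤ max R (R ^ 2) := by
  have hR : 0 ≤ R := (gauge_nonneg q).trans hq
  rw [norm_prod_le_iff, norm_prod_le_iff]
  refine ⟨?_, ?_, ?_⟩
  · refine ((pi_norm_le_iff_of_nonneg hR).2 fun j => ?_).trans (le_max_left _ _)
    exact (coord_abs_le_gauge (Sum.inl j) q).trans hq
  · refine ((pi_norm_le_iff_of_nonneg hR).2 fun j => ?_).trans (le_max_left _ _)
    exact (coord_abs_le_gauge (Sum.inr j) q).trans hq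
  · refine ((abs_vertical_le_gauge_sq q).trans ?_).trans (le_max_right _ _)
    exact pow_le_pow_left₀ (gauge_nonneg q) hq 2

theorem isCompact_gauge_le (R : ℝ) : IsCompact {q : H m | gauge q ≤ R} := by
  refine Metric.isCompact_of_isClosed_isBounded (isClosed_le continuous_gauge continuous_const) ?_
  refine isBounded_iff_forall_norm_le.2 ⟨_, fun q hq => norm_le_of_gauge_le hq⟩

theorem gauge4_pos {q : H m} (hq : 0 < gauge q) : 0 < gauge4 q := by
  rw [← gauge_pow]
  exact pow_pos hq 4

/-! ### The p-Laplacian of the gauge. -/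

/-- The regularization of the field `|∇r|^(p-2) ∇r`, `r` the gauge, is
`(|z|² + ε)^((p-2)/2) (|z|⁴+t²)^(-(p+1)/4) ∇(|z|⁴+t²) / 4`. -/
theorem integral_regularized_flux {p ε : ℝ} (hε : 0 < ε) {w : H m → ℝ} (hw : ContDiff ℝ 1 w)
    (hc : HasCompactSupport w) (h0 : ∀ q ∈ tsupport w, 0 < gauge4 q) :
    ∫ q, (zsq q + ε) ^ ((p - 2) / 2) * (1 / 4 * gauge4 q ^ (-(p + 1) / 4)) * gradDot gauge4 w q =
      -∫ q, (zsq q + ε) ^ ((p - 2) / 2) * (zsq q * (1 / 4 * gauge4 q ^ (-(p + 1) / 4)) *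
        (4 * (p - 2) * (zsq q / (zsq q + ε)) + (8 * m + 16) - 4 * (p + 1))) * w q := by
  -- On the axis z = 0 the gradient ∇r vanishes and |∇r|^(p-2) ∇r need not be differentiable. With
  -- |z|² + ε the field is smooth away from the origin, and its divergence is classical.
  set a : Fin m ⊕ Fin m → H m → ℝ := fun i q =>
    (zsq q + ε) ^ ((p - 2) / 2) * (1 / 4 * gauge4 q ^ (-(p + 1) / 4)) * D i gauge4 q with ha
  have hpos : ∀ q : H m, 0 < zsq q + ε := fun q => by linarith [zsq_nonneg q]
  have hE : ContDiff ℝ ∞ fun q : H m => (zsq q + ε) ^ ((p - 2) / 2) :=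
    (contDiff_zsq.add contDiff_const).rpow_const_of_ne fun q => (hpos q).ne'
  have hG : ∀ q : H m, 0 < gauge4 q →
      ContDiffAt ℝ ∞ (fun q => 1 / 4 * gauge4 q ^ (-(p + 1) / 4)) q := fun q hq =>
    contDiffAt_const.mul (contDiff_gauge4.contDiffAt.rpow_const_of_ne hq.ne')
  have ha1 : ∀ i q, 0 < gauge4 q → ContDiffAt ℝ ∞ (a i) q := fun i q hq =>
    (hE.contDiffAt.mul (hG q hq)).mul (contDiff_D_gauge4 i).contDiffAt
  have hsub : ∀ i, tsupport (fun q => a i q * w q) ⊆ tsupport w := fun i =>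
    tsupport_mul_subset_right
  have haw : ∀ i, ContDiff ℝ 1 fun q => a i q * w q := fun i =>
    contDiff_of_tsupport fun q hq =>
      ((ha1 i q (h0 q (hsub i hq))).of_le (by exact_mod_cast le_top)).mul hw.contDiffAt
  have hcw : ∀ i, HasCompactSupport fun q => a i q * w q := fun i => hc.mul_left
  have hsum : ∫ q, ∑ i, D i (fun q => a i q * w q) q = 0 := by
    rw [integral_finsetSum _ fun i _ =>
      (continuous_D (haw i) i).integrable_of_hasCompactSupport (hasCompactSupport_D (hcw i) i)]
    exact Finset.sum_eq_zero fun i _ => integral_D_eq_zero (haw i) (hcw i) i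
  set A : H m → ℝ := fun q =>
    (zsq q + ε) ^ ((p - 2) / 2) * (1 / 4 * gauge4 q ^ (-(p + 1) / 4)) * gradDot gauge4 w q with hA
  set B : H m → ℝ := fun q =>
    (zsq q + ε) ^ ((p - 2) / 2) * (zsq q * (1 / 4 * gauge4 q ^ (-(p + 1) / 4)) *
        (4 * (p - 2) * (zsq q / (zsq q + ε)) + (8 * m + 16) - 4 * (p + 1))) * w q with hB
  have hpt : ∀ q, ∑ i, D i (fun q => a i q * w q) q = A q + B q := fun q => by
    by_cases hq : q ∈ tsupport w
    · have hρ := h0 q hq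
      set E := (zsq q + ε) ^ ((p - 2) / 2) with hEq
      set g := gauge4 q ^ (-(p + 1) / 4) with hg
      have dE : DifferentiableAt ℝ (fun q : H m => (zsq q + ε) ^ ((p - 2) / 2)) q :=
        hE.differentiable (by simp) q
      have dG := (hG q hρ).differentiableAt (by simp)
      have hDE : ∀ i, D i (fun q : H m => (zsq q + ε) ^ ((p - 2) / 2)) q =
          (p - 2) * (E / (zsq q + ε)) * coord i q := fun i => by
        have := D_comp (φ := fun x : ℝ => (x + ε) ^ ((p - 2) / 2)) (u := zsq) i
          (((hasDerivAt_id _).add_const ε).rpow_const (Or.inl (hpos q).ne'))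
          (contDiff_zsq.differentiable (by simp) q)
        simp only [id] at this
        rw [this, D_zsq, Real.rpow_sub_one (hpos q).ne']
        ring
      have hDG : ∀ i, D i (fun q : H m => 1 / 4 * gauge4 q ^ (-(p + 1) / 4)) q =
          1 / 4 * (-(p + 1) / 4 * (g / gauge4 q)) * D i gauge4 q := fun i => by
        have := D_comp (φ := fun x : ℝ => 1 / 4 * x ^ (-(p + 1) / 4)) (u := gauge4) i
          ((Real.hasDerivAt_rpow_const (Or.inl hρ.ne')).const_mul (1 / 4))
          (contDiff_gauge4.differentiable (by simp) q)
        rw [this, Real.rpow_sub_one hρ.ne']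
      have hDa : ∀ i, D i (a i) q = (p - 2) * (E / (zsq q + ε)) * (1 / 4 * g) *
          (coord i q * D i gauge4 q) + E * (1 / 4 * (-(p + 1) / 4 * (g / gauge4 q))) *
          D i gauge4 q ^ 2 + E * (1 / 4 * g) * D i (D i gauge4) q := fun i => by
        simp only [ha]
        have dEG : DifferentiableAt ℝ (fun q : H m => (zsq q + ε) ^ ((p - 2) / 2) *
            (1 / 4 * gauge4 q ^ (-(p + 1) / 4))) q := dE.mul dG
        rw [D_mul i dEG ((contDiff_D_gauge4 i).differentiable (by simp) q),
          D_mul i dE dG, hDE, hDG]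
        ring
      have hD : ∀ i, D i (fun q => a i q * w q) q = E * (1 / 4 * g) * (D i gauge4 q * D i w q) +
          w q * D i (a i) q := fun i => by
        rw [D_mul i ((ha1 i q hρ).differentiableAt (by simp)) (hw.differentiable one_ne_zero q)]
        simp only [ha]
        ring
      -- With E and g as set above, the divergence of the field is E |z|² (g/4) times
      -- 4(p-2)|z|²/(|z|²+ε) + (8m+16) - 4(p+1).
      simp only [hD, hDa, mul_add, Finset.sum_add_distrib, ← Finset.mul_sum, ← mul_assoc]
      simp only [hA, hB, gradDot_eq, mul_assoc, ← Finset.mul_sum]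
      simp only [sum_D_gauge4_sq, sum_coord_mul_D_gauge4, sum_D_D_gauge4]
      have := (hpos q).ne'
      rw [← hEq, ← hg]
      field_simp
      ring
    · have hz : ∀ i, D i (fun q => a i q * w q) q = 0 := fun i =>
        D_eq_zero_of_notMem i fun h => hq (hsub i h)
      simp only [hA, hB, gradDot_eq, hz, D_eq_zero_of_notMem _ hq,
        image_eq_zero_of_notMem_tsupport hq]
      simp
  have hBi : Integrable B := by
    refine Continuous.integrable_of_hasCompactSupport ?_ hc.mul_left
    refine ContDiff.continuous (n := 1) (𝕜 := ℝ) (contDiff_of_tsupport fun q hq => ?_)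
    have hρ := h0 q (tsupport_mul_subset_right hq)
    refine ContDiffAt.mul (ContDiffAt.mul (hE.contDiffAt.of_le (by exact_mod_cast le_top)) ?_)
      hw.contDiffAt
    refine ContDiffAt.of_le (n := ∞) ?_ (by exact_mod_cast le_top)
    refine (contDiff_zsq.contDiffAt.mul (hG q hρ)).mul ?_
    exact ((contDiffAt_const.mul (contDiff_zsq.contDiffAt.div
      (contDiff_zsq.contDiffAt.add contDiffAt_const) (hpos q).ne')).add contDiffAt_const).sub
      contDiffAt_const
  have hAi : Integrable A := by
    have h1 : A = fun q => (∑ i, D i (fun q => a i q * w q) q) - B q := by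
      funext q; rw [hpt]; ring
    rw [h1]
    refine Integrable.sub (integrable_finsetSum _ fun i _ => ?_) hBi
    exact (continuous_D (haw i) i).integrable_of_hasCompactSupport (hasCompactSupport_D (hcw i) i)
  simp only [hpt] at hsum
  rw [integral_add hAi hBi] at hsum
  linarith

theorem flux_gauge {p : ℝ} (w : H m → ℝ) {q : H m} (hq : 0 < gauge4 q) :
    flux p gauge w q =
      zsq q ^ ((p - 2) / 2) * (1 / 4 * gauge4 q ^ (-(p + 1) / 4)) * gradDot gauge4 w q := by
  have h1 : gradDot gauge w q = 1 / 4 * gauge4 q ^ (-(3 / 4) : ℝ) * gradDot gauge4 w q := by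
    simp only [gradDot_eq, D_gauge _ hq, mul_assoc, Finset.mul_sum]
  have h2 : gauge4 q ^ (-(p + 1) / 4) =
      gauge4 q ^ (-(1 / 4) * (p - 2)) * gauge4 q ^ (-(3 / 4) : ℝ) := by
    rw [← Real.rpow_add hq]; ring_nf
  rw [flux, gradNorm_gauge hq, h1, Real.mul_rpow (Real.rpow_nonneg (zsq_nonneg q) _)
    (Real.rpow_nonneg hq.le _), ← Real.rpow_mul (zsq_nonneg q), ← Real.rpow_mul hq.le, h2,
    show 1 / 2 * (p - 2) = (p - 2) / 2 by ring]
  ring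

/-- The factor 8m + 4 is the limit, as ε → 0, of the bracket in `integral_regularized_flux`: 4(p-2)
+ (8m+16) - 4(p+1), in which p cancels. -/
theorem gradNorm_gauge_rpow {p : ℝ} {q : H m} (hq : 0 < gauge4 q) :
    (2 * m + 1) / gauge q * gradNorm gauge q ^ p =
      zsq q ^ (p / 2) * (1 / 4 * gauge4 q ^ (-(p + 1) / 4)) * (8 * m + 4) := by
  have h2 : gauge4 q ^ (-(p + 1) / 4) =
      gauge4 q ^ (-(1 / 4) * p) * (gauge4 q ^ (1 / 4 : ℝ))⁻¹ := by
    rw [← Real.rpow_neg hq.le, ← Real.rpow_add hq]; ring_nf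
  rw [gradNorm_gauge hq, Real.mul_rpow (Real.rpow_nonneg (zsq_nonneg q) _)
    (Real.rpow_nonneg hq.le _), ← Real.rpow_mul (zsq_nonneg q), ← Real.rpow_mul hq.le, h2,
    show 1 / 2 * p = p / 2 by ring, gauge]
  ring

/-- A bound uniform in ε even for negative b: the factor s^a, supplied by the gradient or the
divergence of the gauge, compensates the singularity of (s+ε)^b. -/
theorem add_rpow_mul_le {a : ℝ} {b ε s : ℝ} (ha : 0 ≤ a) (hab : 0 ≤ b + a) (hs : 0 ≤ s)
    (hε : 0 < ε) (hε1 : ε ≤ 1) : (s + ε) ^ b * s ^ a ≤ (s + 1) ^ (b + a) :=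
  calc (s + ε) ^ b * s ^ a ≤ (s + ε) ^ b * (s + ε) ^ a := by
        gcongr
        linarith
    _ = (s + ε) ^ (b + a) := (Real.rpow_add (by linarith) _ _).symm
    _ ≤ _ := Real.rpow_le_rpow (by linarith) (by linarith) hab

/-- The weak form of `Δ^p r = (2m+1)/r |∇r|^p` for the gauge `r`, away from the origin. -/
theorem integral_flux_gauge {p : ℝ} (hp : 1 < p) {w : H m → ℝ} (hw : ContDiff ℝ 1 w)
    (hc : HasCompactSupport w) (h0 : ∀ q ∈ tsupport w, 0 < gauge4 q) :
    Integrable (flux p gauge w) ∧ Integrable (fun q => (2 * m + 1) / gauge q * gradNorm gauge q ^ p * w q) ∧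
      ∫ q, flux p gauge w q = -∫ q, (2 * m + 1) / gauge q * gradNorm gauge q ^ p * w q := by
  set ε : ℕ → ℝ := fun n => 1 / (n + 1) with hε
  have hεpos : ∀ n, 0 < ε n := fun n => by positivity
  have hε1 : ∀ n, ε n ≤ 1 := fun n => by
    rw [hε]; simp only; rw [div_le_one (by positivity)]
    have : (0 : ℝ) ≤ n := n.cast_nonneg
    linarith
  have hεlim : Tendsto ε atTop (𝓝 0) := tendsto_one_div_add_atTop_nhds_zero_nat
  set A : ℕ → H m → ℝ := fun n q =>
    (zsq q + ε n) ^ ((p - 2) / 2) * (1 / 4 * gauge4 q ^ (-(p + 1) / 4)) * gradDot gauge4 w q with hA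
  set B : ℕ → H m → ℝ := fun n q =>
    (zsq q + ε n) ^ ((p - 2) / 2) * (zsq q * (1 / 4 * gauge4 q ^ (-(p + 1) / 4)) *
        (4 * (p - 2) * (zsq q / (zsq q + ε n)) + (8 * m + 16) - 4 * (p + 1))) * w q with hB
  have hg4 : ContDiff ℝ 1 (gauge4 (m := m)) := contDiff_gauge4.of_le (by exact_mod_cast le_top)
  have hGon : ContinuousOn (fun q : H m => 1 / 4 * gauge4 q ^ (-(p + 1) / 4)) (tsupport w) :=
    continuousOn_const.mul (contDiff_gauge4.continuous.continuousOn.rpow_const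
      fun q hq => Or.inl (h0 q hq).ne')
  have hG0 : ∀ q : H m, 0 ≤ 1 / 4 * gauge4 q ^ (-(p + 1) / 4) := fun q =>
    mul_nonneg (by norm_num) (Real.rpow_nonneg (gauge4_nonneg q) _)
  -- dominating functions
  set bA : H m → ℝ := (tsupport w).indicator fun q =>
    (zsq q + 1) ^ ((p - 1) / 2) * (1 / 4 * gauge4 q ^ (-(p + 1) / 4)) * (4 * √(gauge4 q)) *
      gradNorm w q with hbA
  set Cb : ℝ := 4 * |p - 2| + (8 * m + 16) + 4 * (p + 1) with hCb
  set bB : H m → ℝ := (tsupport w).indicator fun q =>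
    (zsq q + 1) ^ (p / 2) * (1 / 4 * gauge4 q ^ (-(p + 1) / 4)) * Cb * |w q| with hbB
  have hz1 : ∀ s : ℝ, Continuous fun q : H m => (zsq q + 1) ^ s := fun s =>
    (contDiff_zsq.continuous.add continuous_const).rpow_const fun q =>
      Or.inl (by have := zsq_nonneg q; simp only [Pi.add_apply]; linarith)
  have hbAi : Integrable bA := by
    rw [hbA, integrable_indicator_iff (isClosed_tsupport w).measurableSet]
    refine ContinuousOn.integrableOn_compact (K := tsupport w) hc ?_
    exact (((hz1 _).continuousOn.mul hGon).mul
      (continuousOn_const.mul contDiff_gauge4.continuous.sqrt.continuousOn)).mul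
      (continuous_gradNorm hw).continuousOn
  have hbBi : Integrable bB := by
    rw [hbB, integrable_indicator_iff (isClosed_tsupport w).measurableSet]
    refine ContinuousOn.integrableOn_compact (K := tsupport w) hc ?_
    exact (((hz1 _).continuousOn.mul hGon).mul continuousOn_const).mul hw.continuous.abs.continuousOn
  have hAm : ∀ n, AEStronglyMeasurable (A n) := fun n => by
    refine Measurable.aestronglyMeasurable ?_
    exact ((((contDiff_zsq.continuous.measurable).add_const _).pow_const _).mul
      ((contDiff_gauge4.continuous.measurable.pow_const _).const_mul _)).mul
      (continuous_gradDot hg4 hw).measurable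
  have hzm : Measurable (zsq (m := m)) := contDiff_zsq.continuous.measurable
  have hgm : Measurable (gauge4 (m := m)) := contDiff_gauge4.continuous.measurable
  have hwm : Measurable w := hw.continuous.measurable
  have hBm : ∀ n, AEStronglyMeasurable (B n) := fun n => by
    refine Measurable.aestronglyMeasurable ?_
    simp only [hB]
    fun_prop
  have hAb : ∀ n q, ‖A n q‖ ≤ bA q := fun n q => by
    by_cases hq : q ∈ tsupport w
    · rw [hbA, indicator_of_mem hq, Real.norm_eq_abs]
      have h1 := abs_gradDot_le gauge4 w q
      rw [gradNorm_gauge4] at h1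
      have h2 := add_rpow_mul_le (a := 1 / 2) (b := (p - 2) / 2) (by norm_num) (by linarith)
        (zsq_nonneg q) (hεpos n) (hε1 n)
      rw [show (p - 2) / 2 + 1 / 2 = (p - 1) / 2 by ring, ← Real.sqrt_eq_rpow] at h2
      have hE0 : 0 ≤ (zsq q + ε n) ^ ((p - 2) / 2) :=
        Real.rpow_nonneg (by linarith [zsq_nonneg q, hεpos n]) _
      rw [hA]
      simp only
      rw [abs_mul, abs_of_nonneg (mul_nonneg hE0 (hG0 q))]
      calc _ ≤ (zsq q + ε n) ^ ((p - 2) / 2) * (1 / 4 * gauge4 q ^ (-(p + 1) / 4)) *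
            (4 * √(zsq q) * √(gauge4 q) * gradNorm w q) :=
            mul_le_mul_of_nonneg_left h1 (mul_nonneg hE0 (hG0 q))
        _ = ((zsq q + ε n) ^ ((p - 2) / 2) * √(zsq q)) * ((1 / 4 * gauge4 q ^ (-(p + 1) / 4)) *
            (4 * √(gauge4 q)) * gradNorm w q) := by ring
        _ ≤ (zsq q + 1) ^ ((p - 1) / 2) * ((1 / 4 * gauge4 q ^ (-(p + 1) / 4)) *
            (4 * √(gauge4 q)) * gradNorm w q) := by
            refine mul_le_mul_of_nonneg_right h2 ?_
            exact mul_nonneg (mul_nonneg (hG0 q) (by positivity)) (gradNorm_nonneg w q)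
        _ = _ := by ring
    · rw [hbA, indicator_of_notMem hq, hA]
      simp [gradDot_eq, D_eq_zero_of_notMem _ hq]
  have hBb : ∀ n q, ‖B n q‖ ≤ bB q := fun n q => by
    by_cases hq : q ∈ tsupport w
    · rw [hbB, indicator_of_mem hq, Real.norm_eq_abs]
      have h2 := add_rpow_mul_le (a := 1) (b := (p - 2) / 2) (by norm_num) (by linarith)
        (zsq_nonneg q) (hεpos n) (hε1 n)
      rw [show (p - 2) / 2 + 1 = p / 2 by ring, Real.rpow_one] at h2
      have hden : 0 < zsq q + ε n := by linarith [zsq_nonneg q, hεpos n]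
      have hE0 : 0 ≤ (zsq q + ε n) ^ ((p - 2) / 2) := Real.rpow_nonneg hden.le _
      have hbr : |4 * (p - 2) * (zsq q / (zsq q + ε n)) + (8 * m + 16) - 4 * (p + 1)| ≤ Cb := by
        have hr1 : zsq q / (zsq q + ε n) ≤ 1 := by
          rw [div_le_one hden]; linarith [hεpos n]
        have hr0 : 0 ≤ zsq q / (zsq q + ε n) := div_nonneg (zsq_nonneg q) hden.le
        have h3 : |4 * (p - 2) * (zsq q / (zsq q + ε n))| ≤ 4 * |p - 2| := by
          rw [abs_mul, abs_mul, abs_of_nonneg hr0]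
          norm_num
          exact mul_le_of_le_one_right (by positivity) hr1
        have h4 := abs_le.1 h3
        have hm0 : (0 : ℝ) ≤ m := m.cast_nonneg
        rw [abs_le]
        constructor <;> linarith
      rw [hB]
      simp only
      rw [abs_mul, abs_mul, abs_mul, abs_of_nonneg hE0,
        abs_of_nonneg (mul_nonneg (zsq_nonneg q) (hG0 q))]
      calc _ = ((zsq q + ε n) ^ ((p - 2) / 2) * zsq q) * ((1 / 4 * gauge4 q ^ (-(p + 1) / 4)) *
            |4 * (p - 2) * (zsq q / (zsq q + ε n)) + (8 * m + 16) - 4 * (p + 1)| * |w q|) := by ring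
        _ ≤ (zsq q + 1) ^ (p / 2) * ((1 / 4 * gauge4 q ^ (-(p + 1) / 4)) * Cb * |w q|) := by
            refine mul_le_mul h2 ?_ ?_ (Real.rpow_nonneg (by linarith [zsq_nonneg q]) _)
            · exact mul_le_mul_of_nonneg_right (mul_le_mul_of_nonneg_left hbr (hG0 q)) (abs_nonneg _)
            · exact mul_nonneg (mul_nonneg (hG0 q) (abs_nonneg _)) (abs_nonneg _)
        _ = _ := by ring
    · rw [hbB, indicator_of_notMem hq, hB]
      simp [image_eq_zero_of_notMem_tsupport hq]
  have hElim : ∀ q : H m, 0 < zsq q → Tendsto (fun n => (zsq q + ε n) ^ ((p - 2) / 2)) atTop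
      (𝓝 (zsq q ^ ((p - 2) / 2))) := fun q hq => by
    have h1 : Tendsto (fun n => zsq q + ε n) atTop (𝓝 (zsq q + 0)) := hεlim.const_add _
    rw [add_zero] at h1
    exact h1.rpow_const (Or.inl hq.ne')
  have hAlim : ∀ q, Tendsto (fun n => A n q) atTop (𝓝 (flux p gauge w q)) := fun q => by
    by_cases hq : q ∈ tsupport w
    · rw [flux_gauge w (h0 q hq)]
      -- On the axis the power of |z|² + ε may blow up as ε → 0, but the gradient of |z|⁴ + t² is
      -- zero there.
      rcases (zsq_nonneg q).eq_or_lt with hz | hz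
      · have : gradDot gauge4 w q = 0 := by
          have := abs_gradDot_le gauge4 w q
          rw [gradNorm_gauge4, ← hz] at this
          simpa using this
        simp [hA, this]
      · exact ((hElim q hz).mul_const _).mul_const _
    · have h1 : flux p gauge w q = 0 := by simp [flux, gradDot_eq, D_eq_zero_of_notMem _ hq]
      have h2 : ∀ n, A n q = 0 := fun n => by simp [hA, gradDot_eq, D_eq_zero_of_notMem _ hq]
      simp [h1, h2]
  have hBlim : ∀ q, Tendsto (fun n => B n q) atTop
      (𝓝 ((2 * m + 1) / gauge q * gradNorm gauge q ^ p * w q)) := fun q => by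
    by_cases hq : q ∈ tsupport w
    · rw [gradNorm_gauge_rpow (h0 q hq)]
      rcases (zsq_nonneg q).eq_or_lt with hz | hz
      · rw [← hz, Real.zero_rpow (by linarith)]
        simp [hB, ← hz]
      · have h1 : Tendsto (fun n => zsq q / (zsq q + ε n)) atTop (𝓝 1) := by
          have h1 : Tendsto (fun n => zsq q + ε n) atTop (𝓝 (zsq q + 0)) := hεlim.const_add _
          rw [add_zero] at h1
          have := (tendsto_const_nhds (x := zsq q)).div h1 hz.ne'
          rwa [div_self hz.ne'] at this
        have h2 := ((hElim q hz).mul ((((h1.const_mul (4 * (p - 2))).add_const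
          (8 * (m : ℝ) + 16)).sub_const (4 * (p + 1))).const_mul
          (zsq q * (1 / 4 * gauge4 q ^ (-(p + 1) / 4))))).mul_const (w q)
        convert h2 using 2
        have : zsq q ^ (p / 2) = zsq q ^ ((p - 2) / 2) * zsq q := by
          rw [← Real.rpow_add_one hz.ne']; ring_nf
        rw [this]
        ring
    · simp [hB, image_eq_zero_of_notMem_tsupport hq]
  have hlimA := tendsto_integral_of_dominated_convergence bA hAm hbAi
    (fun n => ae_of_all _ (hAb n)) (ae_of_all _ hAlim)
  have hlimB := tendsto_integral_of_dominated_convergence bB hBm hbBi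
    (fun n => ae_of_all _ (hBb n)) (ae_of_all _ hBlim)
  refine ⟨?_, ?_, ?_⟩
  · refine hbAi.mono' (aestronglyMeasurable_of_tendsto_ae atTop hAm (ae_of_all _ hAlim)) ?_
    exact ae_of_all _ fun q => le_of_tendsto (hAlim q).norm (Eventually.of_forall fun n => hAb n q)
  · refine hbBi.mono' (aestronglyMeasurable_of_tendsto_ae atTop hBm (ae_of_all _ hBlim)) ?_
    exact ae_of_all _ fun q => le_of_tendsto (hBlim q).norm (Eventually.of_forall fun n => hBb n q)
  · refine tendsto_nhds_unique hlimA (hlimB.neg.congr fun n => ?_)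
    exact (integral_regularized_flux (hεpos n) hw hc h0).symm

end Heisenberg

/-! ### The global one-dimensional profile when the Keller-Osserman condition fails. -/

namespace KellerOsserman

variable {p : ℝ} {f l : ℝ → ℝ}

theorem intervalIntegrable_inv_slope (h : KHyp p l) (hf : CondF f) {δ a b : ℝ} (hδ : 0 < δ)
    (ha : 0 < a) (hb : 0 < b) : IntervalIntegrable (fun s => 1 / koSlope p f l δ s) volume a b := by
  refine ContinuousOn.intervalIntegrable ((continuousOn_inv_slope h hf hδ).mono fun x hx => ?_)
  exact (lt_min ha hb).trans_le hx.1

theorem hasDerivAt_integral_inv_slope (h : KHyp p l) (hf : CondF f) {δ a b : ℝ} (hδ : 0 < δ)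
    (ha : 0 < a) (hb : 0 < b) :
    HasDerivAt (fun x => ∫ s in a..x, 1 / koSlope p f l δ s) (1 / koSlope p f l δ b) b :=
  intervalIntegral.integral_hasDerivAt_right (intervalIntegrable_inv_slope h hf hδ ha hb)
    ((continuousOn_inv_slope h hf hδ).stronglyMeasurableAtFilter isOpen_Ioi b hb)
    ((continuousOn_inv_slope h hf hδ).continuousAt (Ioi_mem_nhds hb))

theorem inv_slope_nonneg (h : KHyp p l) (hf : CondF f) {δ s : ℝ} (hδ : 0 < δ) (hs : 0 < s) :
    0 ≤ 1 / koSlope p f l δ s := one_div_nonneg.2 (slope_pos h hf hδ hs).le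

/-- The partial integrals of a positive function increase; if they did not tend to infinity they
would be bounded and the function integrable. So the profile needs infinite time to blow up. -/
theorem tendsto_integral_inv_slope (h : KHyp p l) (hf : CondF f) (hKO : ¬ KO p f l) :
    Tendsto (fun x => ∫ s in (1 : ℝ)..x, 1 / koSlope p f l 1 s) atTop atTop := by
  by_contra hcon
  refine hKO ?_
  rw [tendsto_atTop] at hcon
  push Not at hcon
  obtain ⟨b, hb⟩ := hcon
  have hbd : ∀ x, 1 ≤ x → ∫ s in (1 : ℝ)..x, 1 / koSlope p f l 1 s ≤ b := by
    intro x hx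
    obtain ⟨y, hy, hxy⟩ := (hb.and_eventually (eventually_ge_atTop x)).exists
    refine le_trans ?_ hy.le
    have h1 := intervalIntegrable_inv_slope h hf one_pos one_pos (zero_lt_one.trans_le hx)
    have h2 := intervalIntegrable_inv_slope h hf one_pos (zero_lt_one.trans_le hx)
      (zero_lt_one.trans_le (hx.trans hxy))
    rw [← intervalIntegral.integral_add_adjacent_intervals h1 h2]
    have := intervalIntegral.integral_nonneg (μ := volume) hxy fun u hu =>
      inv_slope_nonneg h hf one_pos (zero_lt_one.trans_le (hx.trans hu.1))
    linarith
  have hint : IntegrableOn (fun s => 1 / koSlope p f l 1 s) (Ioi 1) := by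
    refine integrableOn_Ioi_of_intervalIntegral_norm_bounded (l := atTop) (b := fun x : ℝ => x) b 1
      (fun x => ?_) tendsto_id ?_
    · refine (((continuousOn_inv_slope h hf one_pos).mono fun y hy => ?_).integrableOn_Icc (a := 1)
        (b := x)).mono_set Ioc_subset_Icc_self
      exact zero_lt_one.trans_le hy.1
    · filter_upwards [eventually_ge_atTop 1] with x hx
      refine le_of_eq_of_le (intervalIntegral.integral_congr fun s hs => ?_) (hbd x hx)
      rw [uIcc_of_le hx] at hs
      exact Real.norm_of_nonneg (inv_slope_nonneg h hf one_pos (zero_lt_one.trans_le hs.1))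
  exact ⟨Ioi 1, Ioi_mem_atTop 1, by simpa only [koSlope, one_mul] using hint⟩

theorem tendsto_integral_inv_slope_zero (h : KHyp p l) (hf : CondF f)
    (hint : ¬ IntegrableOn (fun s => 1 / koSlope p f l 1 s) (Ioc 0 1)) :
    Tendsto (fun x => ∫ s in x..(1 : ℝ), 1 / koSlope p f l 1 s) (𝓝[>] 0) atTop := by
  by_contra hcon
  refine hint ?_
  rw [tendsto_atTop] at hcon
  push Not at hcon
  obtain ⟨b, hb⟩ := hcon
  have hbd : ∀ x, 0 < x → x ≤ 1 → ∫ s in x..(1 : ℝ), 1 / koSlope p f l 1 s ≤ b := by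
    intro x hx0 hx
    obtain ⟨y, hy, hyx⟩ := (hb.and_eventually (Ioo_mem_nhdsGT hx0)).exists
    refine le_trans ?_ hy.le
    have h1 := intervalIntegrable_inv_slope h hf one_pos hyx.1 hx0
    have h2 := intervalIntegrable_inv_slope h hf one_pos hx0 one_pos
    rw [← intervalIntegral.integral_add_adjacent_intervals h1 h2]
    have := intervalIntegral.integral_nonneg (μ := volume) hyx.2.le fun u hu =>
      inv_slope_nonneg h hf one_pos (hyx.1.trans_le hu.1)
    linarith
  have hpos : ∀ n : ℕ, (0 : ℝ) < 1 / (n + 1) := fun n => by positivity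
  refine integrableOn_Ioc_of_intervalIntegral_norm_bounded_left (l := atTop)
    (a := fun n : ℕ => 1 / ((n : ℝ) + 1)) (I := b) (fun n => ?_)
    tendsto_one_div_add_atTop_nhds_zero_nat (Eventually.of_forall fun n => ?_)
  · refine (((continuousOn_inv_slope h hf one_pos).mono fun y hy => ?_).integrableOn_Icc
      (a := 1 / ((n : ℝ) + 1)) (b := 1)).mono_set Ioc_subset_Icc_self
    exact (hpos n).trans_le hy.1
  · have hx : 1 / ((n : ℝ) + 1) ≤ 1 := by
      rw [div_le_one (by positivity)]
      have : (0 : ℝ) ≤ n := n.cast_nonneg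
      linarith
    rw [← intervalIntegral.integral_of_le hx]
    refine le_of_eq_of_le (intervalIntegral.integral_congr fun s hs => ?_) (hbd _ (hpos n) hx)
    rw [uIcc_of_le hx] at hs
    exact Real.norm_of_nonneg (inv_slope_nonneg h hf one_pos ((hpos n).trans_le hs.1))

/-- A nonconstant solution of `V' = K⁻¹(F(|V|))` on `ℝ`, away from the zeros of `V`. -/
theorem exists_profile (h : KHyp p l) (hf : CondF f) (hKO : ¬ KO p f l) :
    ∃ V : ℝ → ℝ, Continuous V ∧ (∀ s, V s = 0 → s = 0) ∧
      (∀ s, V s ≠ 0 → HasDerivAt V (koSlope p f l 1 |V s|) s) ∧ ∃ s₁ s₂, |V s₁| ≠ |V s₂| := by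
  set k := koSlope p f l 1 with hk
  have hkpos : ∀ s, 0 < s → 0 < k s := fun s => slope_pos h hf one_pos
  have htop := tendsto_integral_inv_slope h hf hKO
  -- Followed backwards, the profile meets 0 in finite time exactly when 1/k is integrable at 0.
  by_cases hint : IntegrableOn (fun s => 1 / k s) (Ioc 0 1)
  · -- the profile reaches zero
    set P : ℝ → ℝ := fun x => ∫ s in (0 : ℝ)..x, 1 / k s with hP
    have hII : ∀ x, 0 ≤ x → IntervalIntegrable (fun s => 1 / k s) volume 0 x := fun x hx => by
      have h01 : IntervalIntegrable (fun s => 1 / k s) volume 0 1 :=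
        (intervalIntegrable_iff_integrableOn_Ioc_of_le zero_le_one).2 hint
      rcases hx.eq_or_lt with rfl | hx
      · exact IntervalIntegrable.refl
      · exact h01.trans (intervalIntegrable_inv_slope h hf one_pos one_pos hx)
    have hPd : ∀ x, 0 < x → HasDerivAt P (1 / k x) x := fun x hx =>
      intervalIntegral.integral_hasDerivAt_right (hII x hx.le)
        ((continuousOn_inv_slope h hf one_pos).stronglyMeasurableAtFilter isOpen_Ioi x hx)
        ((continuousOn_inv_slope h hf one_pos).continuousAt (Ioi_mem_nhds hx))
    have hPc : ContinuousOn P (Ici 0) := fun x hx => by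
      have hx1 : 0 ≤ x + 1 := by linarith [mem_Ici.1 hx]
      have h1 := intervalIntegral.continuousOn_primitive_interval' (hII (x + 1) hx1)
        left_mem_uIcc
      rw [uIcc_of_le hx1] at h1
      refine (h1 x ⟨hx, by linarith⟩).mono_of_mem_nhdsWithin ?_
      rw [← Ici_inter_Iic]
      exact inter_mem_nhdsWithin _ (Iic_mem_nhds (by linarith))
    have hPm : StrictMonoOn P (Ici 0) := by
      refine strictMonoOn_of_deriv_pos (convex_Ici 0) hPc fun x hx => ?_
      rw [interior_Ici] at hx
      rw [(hPd x hx).deriv]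
      exact one_div_pos.2 (hkpos x hx)
    have hP0 : P 0 = 0 := by simp [hP]
    have hPtop : Tendsto P atTop atTop := by
      refine (tendsto_atTop_add_const_left _ (P 1) htop).congr' ?_
      filter_upwards [eventually_ge_atTop 1] with x hx
      exact intervalIntegral.integral_add_adjacent_intervals (hII 1 zero_le_one)
        (intervalIntegrable_inv_slope h hf one_pos one_pos (zero_lt_one.trans_le hx))
    -- The odd extension of P: time as a function of the signed height. The profile is its inverse.
    set Q : ℝ → ℝ := fun x => P (max x 0) - P (max (-x) 0) with hQ
    have hQp : ∀ x, 0 ≤ x → Q x = P x := fun x hx => by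
      simp [hQ, max_eq_left hx, max_eq_right (neg_nonpos.2 hx), hP0]
    have hQn : ∀ x, x ≤ 0 → Q x = -P (-x) := fun x hx => by
      simp [hQ, max_eq_right hx, max_eq_left (neg_nonneg.2 hx), hP0]
    have hQc : Continuous Q :=
      (hPc.comp_continuous (by fun_prop) fun x => mem_Ici.2 (le_max_right _ _)).sub
        (hPc.comp_continuous (by fun_prop) fun x => mem_Ici.2 (le_max_right _ _))
    have hQm : StrictMono Q := by
      intro x y hxy
      rcases le_or_gt y 0 with hy | hy
      · rw [hQn y hy, hQn x (hxy.le.trans hy), neg_lt_neg_iff]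
        exact hPm (neg_nonneg.2 hy) (neg_nonneg.2 (hxy.le.trans hy)) (neg_lt_neg hxy)
      · have h1 : P (max x 0) < P (max y 0) := by
          refine hPm (mem_Ici.2 (le_max_right _ _)) (mem_Ici.2 (le_max_right _ _)) ?_
          rw [max_eq_left hy.le]
          exact max_lt hxy hy
        have h2 : P (max (-y) 0) ≤ P (max (-x) 0) :=
          hPm.monotoneOn (mem_Ici.2 (le_max_right _ _)) (mem_Ici.2 (le_max_right _ _))
            (max_le_max (neg_le_neg hxy.le) le_rfl)
        simp only [hQ]
        linarith
    have hQtop : Tendsto Q atTop atTop := by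
      refine hPtop.congr' ?_
      filter_upwards [eventually_ge_atTop 0] with x hx using (hQp x hx).symm
    have hQbot : Tendsto Q atBot atBot := by
      refine (tendsto_neg_atTop_atBot.comp (hPtop.comp tendsto_neg_atBot_atTop)).congr' ?_
      filter_upwards [eventually_le_atBot 0] with x hx using (hQn x hx).symm
    set e := hQm.orderIsoOfSurjective Q (hQc.surjective hQtop hQbot) with he
    have heQ : ∀ x, e x = Q x := fun x => rfl
    have hQd : ∀ x, x ≠ 0 → HasDerivAt Q (1 / k |x|) x := fun x hx => by
      rcases hx.lt_or_gt with hx | hx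
      · rw [abs_of_neg hx]
        have h1 : HasDerivAt (fun y => -P (-y)) (1 / k (-x)) x := by
          have := ((hPd (-x) (neg_pos.2 hx)).comp x (hasDerivAt_neg x)).neg
          rw [mul_neg_one, neg_neg] at this
          exact this
        refine h1.congr_of_eventuallyEq ?_
        filter_upwards [Iio_mem_nhds hx] with y hy using hQn y (le_of_lt hy)
      · rw [abs_of_pos hx]
        refine (hPd x hx).congr_of_eventuallyEq ?_
        filter_upwards [Ioi_mem_nhds hx] with y hy using hQp y (le_of_lt hy)
    refine ⟨e.symm, e.symm.continuous, fun s hs => ?_, fun s hs => ?_, e 0, e 1, ?_⟩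
    · rw [← e.apply_symm_apply s, hs, heQ, hQp 0 le_rfl, hP0]
    · have h1 := hQd (e.symm s) hs
      have h2 : k |e.symm s| ≠ 0 := (hkpos _ (abs_pos.2 hs)).ne'
      have := h1.of_local_left_inverse e.symm.continuous.continuousAt (one_div_ne_zero h2)
        (Eventually.of_forall fun y => e.apply_symm_apply y)
      simpa using this
    · simp
  · -- the profile stays positive
    have hbot := tendsto_integral_inv_slope_zero h hf hint
    -- Height is written as exp x, so that time, divergent at both ends, becomes a bijection of ℝ.
    set Q : ℝ → ℝ := fun x => ∫ s in (1 : ℝ)..(Real.exp x), 1 / k s with hQ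
    have hQd : ∀ x, HasDerivAt Q (1 / k (Real.exp x) * Real.exp x) x := fun x =>
      (hasDerivAt_integral_inv_slope h hf one_pos one_pos (Real.exp_pos x)).comp x
        (Real.hasDerivAt_exp x)
    have hQpos : ∀ x, 0 < 1 / k (Real.exp x) * Real.exp x := fun x =>
      mul_pos (one_div_pos.2 (hkpos _ (Real.exp_pos x))) (Real.exp_pos x)
    have hQm : StrictMono Q := strictMono_of_deriv_pos fun x => by
      rw [(hQd x).deriv]; exact hQpos x
    have hQc : Continuous Q := continuous_iff_continuousAt.2 fun x => (hQd x).continuousAt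
    have hQtop : Tendsto Q atTop atTop := htop.comp Real.tendsto_exp_atTop
    have hQbot : Tendsto Q atBot atBot := by
      refine (tendsto_neg_atTop_atBot.comp (hbot.comp Real.tendsto_exp_atBot_nhdsGT)).congr
        fun x => ?_
      simp only [Function.comp, hQ]
      rw [intervalIntegral.integral_symm, neg_neg]
    set e := hQm.orderIsoOfSurjective Q (hQc.surjective hQtop hQbot) with he
    have hV : ∀ s, 0 < Real.exp (e.symm s) := fun s => Real.exp_pos _
    refine ⟨fun s => Real.exp (e.symm s), Real.continuous_exp.comp e.symm.continuous,
      fun s hs => absurd hs (hV s).ne', fun s _ => ?_, e 0, e 1, ?_⟩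
    · have h1 := (hQd (e.symm s)).of_local_left_inverse e.symm.continuous.continuousAt
        (hQpos _).ne' (Eventually.of_forall fun y => e.apply_symm_apply y)
      have h2 := h1.exp
      rw [abs_of_pos (hV s)]
      convert h2 using 1
      have := (hkpos _ (hV s)).ne'
      have := (hV s).ne'
      field_simp
    · simp only [e.symm_apply_apply, abs_of_pos (Real.exp_pos _)]
      exact (Real.exp_strictMono zero_lt_one).ne

end KellerOsserman

/-! ### The entire solution built from the profile. -/

namespace Heisenberg

open KellerOsserman

variable {m : ℕ} {p : ℝ} {f l : ℝ → ℝ}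

/-- A one-dimensional profile gives an entire solution depending on `x_j` only. -/
theorem isWeakSolution_of_profile (h : KHyp p l) (hf : CondF f) (j : Fin m) {V : ℝ → ℝ}
    (hVc : Continuous V) (hV0 : ∀ s, V s = 0 → s = 0)
    (hVd : ∀ s, V s ≠ 0 → HasDerivAt V (koSlope p f l 1 |V s|) s) :
    IsWeakSolution p f l (fun q : H m => |V (q.1 j)|) := by
  have hp := h.one_lt
  set k := koSlope p f l 1 with hk
  have hkc : ContinuousOn k (Ici 0) := continuousOn_slope h hf one_pos
  have hkpos : ∀ s, 0 < s → 0 < k s := fun s => slope_pos h hf one_pos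
  have hk0 : k 0 = 0 := slope_zero h
  have hkn : ∀ s, 0 ≤ s → 0 ≤ k s := fun s => slope_nonneg h hf one_pos
  -- `W'` is sign(V) k(|V|) and `g` is sign(V) k(|V|)^(p-1). Positive and negative parts make their
  -- continuity visible, since k(0) = 0.
  set W' : ℝ → ℝ := fun s => k (max (V s) 0) - k (max (-V s) 0) with hW'
  set g : ℝ → ℝ := fun s => k (max (V s) 0) ^ (p - 1) - k (max (-V s) 0) ^ (p - 1) with hg
  set g' : ℝ → ℝ := fun s => f |V s| * l (k |V s|) with hg'
  have hmax1 : Continuous fun s => k (max (V s) 0) :=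
    hkc.comp_continuous (by fun_prop) fun x => mem_Ici.2 (le_max_right _ _)
  have hmax2 : Continuous fun s => k (max (-V s) 0) :=
    hkc.comp_continuous (by fun_prop) fun x => mem_Ici.2 (le_max_right _ _)
  have hW'c : Continuous W' := hmax1.sub hmax2
  have hgc : Continuous g :=
    (hmax1.rpow_const fun _ => Or.inr (by linarith)).sub
      (hmax2.rpow_const fun _ => Or.inr (by linarith))
  have hkabs : Continuous fun s => k |V s| :=
    hkc.comp_continuous (by fun_prop) fun x => mem_Ici.2 (abs_nonneg _)
  have hg'c : Continuous g' :=
    (hf.cont.comp_continuous (by fun_prop) fun x => mem_Ici.2 (abs_nonneg _)).mul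
      (h.condL.cont.comp_continuous hkabs fun x => mem_Ici.2 (hkn _ (abs_nonneg _)))
  have h0p : (0 : ℝ) ^ (p - 1) = 0 := Real.zero_rpow (by linarith)
  have e1 : ∀ s, 0 < V s → W' s = k |V s| ∧ g s = k |V s| ^ (p - 1) := fun s hs => by
    simp [hW', hg, max_eq_left hs.le, max_eq_right (neg_nonpos.2 hs.le), abs_of_pos hs, hk0, h0p]
  have e2 : ∀ s, V s < 0 → W' s = -k |V s| ∧ g s = -k |V s| ^ (p - 1) := fun s hs => by
    simp [hW', hg, max_eq_right hs.le, max_eq_left (neg_nonneg.2 hs.le), abs_of_neg hs, hk0, h0p]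
  -- Differentiating K(k) = F gives (p-1) k^(p-1) k' / l(k) = f, hence (k^(p-1))' = f l(k)/k. Along
  -- |V|, whose derivative is ±k, the denominator cancels.
  have hkd : ∀ s, 0 < s → HasDerivAt (fun s => k s ^ (p - 1)) (f s * l (k s) / k s) s := fun s hs => by
    have h1 := (hasDerivAt_slope h hf one_pos hs).rpow_const (p := p - 1) (Or.inl (hkpos s hs).ne')
    convert h1 using 1
    have hks := hkpos s hs
    have h2 : k s ^ (p - 1) ≠ 0 := (Real.rpow_pos_of_pos hks _).ne'
    have h3 : p - 1 ≠ 0 := by linarith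
    rw [← hk, Real.rpow_sub_one hks.ne' (p - 1)]
    field_simp
  have hWd : ∀ s, V s ≠ 0 → HasDerivAt (fun s => |V s|) (W' s) s := fun s hs => by
    rcases hs.lt_or_gt with hs' | hs'
    · rw [(e2 s hs').1]
      refine (hVd s hs).neg.congr_of_eventuallyEq ?_
      filter_upwards [hVc.continuousAt.eventually (gt_mem_nhds hs')] with y hy
      exact abs_of_neg hy
    · rw [(e1 s hs').1]
      refine (hVd s hs).congr_of_eventuallyEq ?_
      filter_upwards [hVc.continuousAt.eventually (lt_mem_nhds hs')] with y hy
      exact abs_of_pos hy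
  have hgd : ∀ s, V s ≠ 0 → HasDerivAt g (g' s) s := fun s hs => by
    have hap : 0 < |V s| := abs_pos.2 hs
    have hkp := (hkpos _ hap).ne'
    have h1 : HasDerivAt (fun s => k |V s| ^ (p - 1)) (f |V s| * l (k |V s|) / k |V s| * W' s) s :=
      HasDerivAt.comp (h₂ := fun x => k x ^ (p - 1)) (h := fun s => |V s|) s (hkd _ hap) (hWd s hs)
    rcases hs.lt_or_gt with hs' | hs'
    · have h2 := h1.neg
      rw [(e2 s hs').1] at h2
      have h3 : HasDerivAt g _ s := h2.congr_of_eventuallyEq (by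
        filter_upwards [hVc.continuousAt.eventually (gt_mem_nhds hs')] with y hy
        exact (e2 y hy).2)
      convert h3 using 1
      simp only [hg']
      field_simp
    · rw [(e1 s hs').1] at h1
      have h3 : HasDerivAt g _ s := h1.congr_of_eventuallyEq (by
        filter_upwards [hVc.continuousAt.eventually (lt_mem_nhds hs')] with y hy
        exact (e1 y hy).2)
      convert h3 using 1
      simp only [hg']
      field_simp
  -- V vanishes at most at s = 0, and the candidate derivative is continuous there, so the
  -- exceptional point is removable. The same holds for `g`.
  have hW : ∀ s, HasDerivAt (fun s => |V s|) (W' s) s :=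
    hasDerivAt_of_hasDerivAt_of_ne' (x := 0) (fun y hy => hWd y fun h => hy (hV0 y h))
      hVc.abs.continuousAt hW'c.continuousAt
  have hgall : ∀ s, HasDerivAt g (g' s) s :=
    hasDerivAt_of_hasDerivAt_of_ne' (x := 0) (fun y hy => hgd y fun h => hy (hV0 y h))
      hgc.continuousAt hg'c.continuousAt
  have hC1 : ∀ {φ φ' : ℝ → ℝ}, (∀ s, HasDerivAt φ (φ' s) s) → Continuous φ' →
      ContDiff ℝ 1 fun q : H m => φ (q.1 j) := fun {φ φ'} hφ hφ' => by
    have h1 : ContDiff ℝ 1 φ := by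
      rw [contDiff_one_iff_deriv]
      refine ⟨fun s => (hφ s).differentiableAt, ?_⟩
      rwa [funext fun s => (hφ s).deriv]
    exact h1.comp (by fun_prop)
  have hu1 := hC1 hW hW'c
  have hg1 := hC1 hgall hg'c
  have hD : ∀ {φ φ' : ℝ → ℝ}, (∀ s, HasDerivAt φ (φ' s) s) → ∀ i q,
      D i (fun q : H m => φ (q.1 j)) q = φ' (q.1 j) * if Sum.inl j = i then 1 else 0 :=
    fun {φ φ'} hφ i q => by
    rw [← D_coord i (Sum.inl j) q]
    exact D_comp (u := coord (Sum.inl j)) i (hφ _) ((contDiff_coord _).differentiable (by simp) q)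
  have hdot : ∀ ζ : H m → ℝ, ∀ q, gradDot (fun q : H m => |V (q.1 j)|) ζ q =
      W' (q.1 j) * D (Sum.inl j) ζ q := fun ζ q => by
    simp [gradDot_eq, hD hW]
  have hnorm : ∀ q : H m, gradNorm (fun q : H m => |V (q.1 j)|) q = k |V (q.1 j)| := fun q => by
    have h1 : gradNorm (fun q : H m => |V (q.1 j)|) q = |W' (q.1 j)| := by
      rw [gradNorm, hdot, hD hW, if_pos rfl, mul_one, ← sq, Real.sqrt_sq_eq_abs]
    rw [h1]
    rcases lt_trichotomy (V (q.1 j)) 0 with hs | hs | hs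
    · rw [(e2 _ hs).1, abs_neg, abs_of_nonneg (hkn _ (abs_nonneg _))]
    · simp [hW', hs, hk0]
    · rw [(e1 _ hs).1, abs_of_nonneg (hkn _ (abs_nonneg _))]
  refine ⟨hu1, fun ζ hζ hc hζ0 => ?_⟩
  have hζ1 : ContDiff ℝ 1 ζ := hζ.of_le (by exact_mod_cast le_top)
  have hfl : ∀ q : H m, k |V (q.1 j)| ^ (p - 2) * (W' (q.1 j) * D (Sum.inl j) ζ q) =
      g (q.1 j) * D (Sum.inl j) ζ q := fun q => by
    rw [← mul_assoc]
    congr 1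
    have hpow : V (q.1 j) ≠ 0 →
        k |V (q.1 j)| ^ (p - 1) = k |V (q.1 j)| ^ (p - 2) * k |V (q.1 j)| := fun hs => by
      rw [← Real.rpow_add_one (hkpos _ (abs_pos.2 hs)).ne']; ring_nf
    rcases lt_trichotomy (V (q.1 j)) 0 with hs | hs | hs
    · rw [(e2 _ hs).1, (e2 _ hs).2, hpow hs.ne]; ring
    · simp [hW', hg, hs]
    · rw [(e1 _ hs).1, (e1 _ hs).2, hpow hs.ne']
  simp only [hnorm, hdot, hfl]
  have hIBP := integral_D_eq_zero (hg1.mul hζ1) hc.mul_left (Sum.inl j)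
  have hprod : ∀ q : H m, D (Sum.inl j) (fun q => g (q.1 j) * ζ q) q =
      g (q.1 j) * D (Sum.inl j) ζ q + f |V (q.1 j)| * l (k |V (q.1 j)|) * ζ q := fun q => by
    rw [D_mul _ (hg1.differentiable one_ne_zero q) (hζ1.differentiable one_ne_zero q), hD hgall]
    simp only [hg', if_true]
    ring
  have i1 : Integrable fun q : H m => g (q.1 j) * D (Sum.inl j) ζ q :=
    (hg1.continuous.mul (continuous_D hζ1 _)).integrable_of_hasCompactSupport
      (hasCompactSupport_D hc _).mul_left
  have i2 : Integrable fun q : H m => f |V (q.1 j)| * l (k |V (q.1 j)|) * ζ q :=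
    ((hg'c.comp (by fun_prop : Continuous fun q : H m => q.1 j)).mul
      hζ.continuous).integrable_of_hasCompactSupport hc.mul_left
  have h5 : ∫ q : H m, D (Sum.inl j) (fun q => g (q.1 j) * ζ q) q = 0 := hIBP
  simp only [hprod] at h5
  rw [integral_add i1 i2] at h5
  linarith

theorem exists_solution_of_not_KO (hm : 1 ≤ m) (h : KHyp p l) (hf : CondF f)
    (hKO : ¬ KO p f l) :
    ∃ u : H m → ℝ, IsWeakSolution p f l u ∧ (∀ q, 0 ≤ u q) ∧ ¬ ∃ c : ℝ, ∀ q, u q = c := by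
  obtain ⟨V, hVc, hV0, hVd, s₁, s₂, hne⟩ := exists_profile h hf hKO
  refine ⟨_, isWeakSolution_of_profile h hf (⟨0, hm⟩ : Fin m) hVc hV0 hVd,
    fun q => abs_nonneg _, fun ⟨c, hc⟩ => hne ?_⟩
  have h1 := hc (fun _ => s₁, 0, 0)
  have h2 := hc (fun _ => s₂, 0, 0)
  exact h1.trans h2.symm

end Heisenberg

/-! ### The pointwise absorption inequality. -/

/-- A quantitative monotonicity of `a ↦ a ^ (p - 1)`. -/
theorem rpow_gap {p a b : ℝ} (hp : 1 < p) (ha : 0 ≤ a) (hab : 2 * a ≤ b) :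
    (1 - 2⁻¹ ^ (p - 1)) / 2 * b ^ p ≤ (b ^ (p - 1) - a ^ (p - 1)) * (b - a) := by
  have hb : 0 ≤ b := by linarith
  have h1 : a ^ (p - 1) ≤ 2⁻¹ ^ (p - 1) * b ^ (p - 1) := by
    rw [← Real.mul_rpow (by norm_num) hb]
    exact Real.rpow_le_rpow ha (by linarith) (by linarith)
  have h2 : b ^ p = b ^ (p - 1) * b := by
    rcases hb.eq_or_lt with rfl | hb
    · rw [mul_zero, Real.zero_rpow (by linarith)]
    · rw [← Real.rpow_add_one hb.ne']; ring_nf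
  have h3 : (0 : ℝ) ≤ 1 - 2⁻¹ ^ (p - 1) := by
    rw [sub_nonneg]
    exact Real.rpow_le_one (by norm_num) (by norm_num) (by linarith)
  have h4 : 0 ≤ b ^ (p - 1) := Real.rpow_nonneg hb _
  calc (1 - 2⁻¹ ^ (p - 1)) / 2 * b ^ p = ((1 - 2⁻¹ ^ (p - 1)) * b ^ (p - 1)) * (b / 2) := by
        rw [h2]; ring
    _ ≤ (b ^ (p - 1) - a ^ (p - 1)) * (b - a) := by
        refine mul_le_mul (by linarith) (by linarith) (by linarith) ?_
        nlinarith [mul_nonneg h3 h4]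

theorem rpow_gap_const_pos {p : ℝ} (hp : 1 < p) : 0 < (1 - (2⁻¹ : ℝ) ^ (p - 1)) / 2 := by
  have := Real.rpow_lt_one (x := (2⁻¹ : ℝ)) (by norm_num) (by norm_num) (sub_pos.2 hp)
  linarith

/-- The absorption inequality behind the comparison argument: `G`, `P` are the lengths of two
gradients, `x` the difference of the functions. -/
theorem absorption {p x G P κ N S σ : ℝ} (hp : 1 < p) (hx : 0 < x) (hG : 0 ≤ G) (hP : 0 ≤ P)
    (hκ : 0 ≤ κ) (hN : 0 ≤ N) (hx' : x * (κ + N) < 2 * ((1 - 2⁻¹ ^ (p - 1)) / 2)) (hS : 0 ≤ S)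
    (hmid : G ≤ 2 * P → (G / 2) ^ p * σ ≤ S) (hσ : 4 ^ p * (κ + N) < σ) :
    x ^ 2 * (κ * G ^ p + N * P ^ p) ≤
      2 * x * ((G ^ (p - 1) - P ^ (p - 1)) * (G - P)) + x ^ 2 * S ∧
    (0 < P → x ^ 2 * (κ * G ^ p + N * P ^ p) <
      2 * x * ((G ^ (p - 1) - P ^ (p - 1)) * (G - P)) + x ^ 2 * S) := by
  set c := (1 - (2⁻¹ : ℝ) ^ (p - 1)) / 2 with hc
  have hx2 : 0 < x ^ 2 := by positivity
  have hGp : 0 ≤ G ^ p := Real.rpow_nonneg hG _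
  have hPp : 0 ≤ P ^ p := Real.rpow_nonneg hP _
  have hxS : 0 ≤ x ^ 2 * S := by positivity
  -- reduction of the two extreme cases
  have extreme : ∀ Q : ℝ, 0 ≤ Q → κ * G ^ p + N * P ^ p ≤ (κ + N) * Q →
      c * Q ≤ (G ^ (p - 1) - P ^ (p - 1)) * (G - P) →
      x ^ 2 * (κ * G ^ p + N * P ^ p) ≤
        2 * x * ((G ^ (p - 1) - P ^ (p - 1)) * (G - P)) + x ^ 2 * S ∧
      (0 < Q → x ^ 2 * (κ * G ^ p + N * P ^ p) <
        2 * x * ((G ^ (p - 1) - P ^ (p - 1)) * (G - P)) + x ^ 2 * S) := by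
    intro Q hQ h1 h2
    have h3 : x ^ 2 * (κ * G ^ p + N * P ^ p) ≤ x * (x * (κ + N)) * Q := by
      have := mul_le_mul_of_nonneg_left h1 hx2.le
      linarith
    have h4 : 2 * x * (c * Q) ≤ 2 * x * ((G ^ (p - 1) - P ^ (p - 1)) * (G - P)) :=
      mul_le_mul_of_nonneg_left h2 (by positivity)
    have h5 : x * (x * (κ + N)) * Q ≤ x * (2 * c) * Q :=
      mul_le_mul_of_nonneg_right (mul_le_mul_of_nonneg_left hx'.le hx.le) hQ
    refine ⟨by linarith, fun hQ' => ?_⟩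
    have h6 : x * (x * (κ + N)) * Q < x * (2 * c) * Q :=
      mul_lt_mul_of_pos_right (mul_lt_mul_of_pos_left hx' hx) hQ'
    linarith
  -- If one of G, P is at least twice the other, the monotonicity term is linear in x and beats the
  -- x² terms because x(κ + N) < 2c. Otherwise both are at most 4(G/2), and S alone dominates.
  rcases le_or_gt (2 * G) P with h1 | h1
  · have h2 : G ^ p ≤ P ^ p := Real.rpow_le_rpow hG (by linarith) (by linarith)
    have h3 : c * P ^ p ≤ (G ^ (p - 1) - P ^ (p - 1)) * (G - P) :=
      (rpow_gap hp hG h1).trans_eq (by ring)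
    obtain ⟨e1, e2⟩ := extreme (P ^ p) hPp (by nlinarith) h3
    exact ⟨e1, fun h => e2 (Real.rpow_pos_of_pos h _)⟩
  · have hGpos : 0 < G := by linarith
    rcases le_or_gt (2 * P) G with h2 | h2
    · have h3 : P ^ p ≤ G ^ p := Real.rpow_le_rpow hP (by linarith) (by linarith)
      have h4 := rpow_gap hp hP h2
      obtain ⟨e1, e2⟩ := extreme (G ^ p) hGp (by nlinarith) h4
      exact ⟨e1, fun _ => e2 (Real.rpow_pos_of_pos hGpos _)⟩
    · have h3 := hmid h2.le
      have h4 : P ^ p ≤ 4 ^ p * (G / 2) ^ p := by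
        rw [← Real.mul_rpow (by norm_num) (by linarith)]
        exact Real.rpow_le_rpow hP (by linarith) (by linarith)
      have h5 : G ^ p ≤ 4 ^ p * (G / 2) ^ p := by
        rw [← Real.mul_rpow (by norm_num) (by linarith)]
        exact Real.rpow_le_rpow hG (by linarith) (by linarith)
      have h6 : 0 ≤ (G ^ (p - 1) - P ^ (p - 1)) * (G - P) := by
        rcases le_total G P with h | h
        · exact mul_nonneg_of_nonpos_of_nonpos
            (sub_nonpos.2 (Real.rpow_le_rpow hG h (by linarith))) (by linarith)
        · exact mul_nonneg (sub_nonneg.2 (Real.rpow_le_rpow hP h (by linarith))) (by linarith)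
      have h7 : 0 < (G / 2) ^ p := Real.rpow_pos_of_pos (by linarith) _
      have h8 : κ * G ^ p + N * P ^ p < S := by
        have a1 := mul_le_mul_of_nonneg_left h5 hκ
        have a2 := mul_le_mul_of_nonneg_left h4 hN
        have a3 := mul_lt_mul_of_pos_left hσ h7
        linarith
      have h9 : x ^ 2 * (κ * G ^ p + N * P ^ p) < x ^ 2 * S := mul_lt_mul_of_pos_left h8 hx2
      have h10 : 0 ≤ 2 * x * ((G ^ (p - 1) - P ^ (p - 1)) * (G - P)) := by positivity
      exact ⟨by linarith, fun _ => by linarith⟩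

/-- The square makes the positive part C¹, hence admissible in `IsWeakSolution.c1_test`. -/
theorem hasDerivAt_posPart_sq (y : ℝ) : HasDerivAt (fun y : ℝ => max y 0 ^ 2) (2 * max y 0) y := by
  refine hasDerivAt_of_hasDerivAt_of_ne' (g := fun y => 2 * max y 0) (x := 0) (fun y hy => ?_)
    (by fun_prop) (by fun_prop) y
  rcases hy.lt_or_gt with h | h
  · rw [max_eq_right h.le, mul_zero]
    refine (hasDerivAt_const y (0 : ℝ)).congr_of_eventuallyEq ?_
    filter_upwards [Iio_mem_nhds h] with z hz
    rw [max_eq_right (le_of_lt hz)]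
    norm_num
  · have h1 : HasDerivAt (fun y : ℝ => y ^ 2) (2 * y) y := by simpa using hasDerivAt_pow 2 y
    rw [max_eq_left h.le]
    refine h1.congr_of_eventuallyEq ?_
    filter_upwards [Ioi_mem_nhds h] with z hz
    rw [max_eq_left (le_of_lt hz)]

theorem contDiff_posPart_sq : ContDiff ℝ 1 (fun y : ℝ => max y 0 ^ 2) := by
  rw [contDiff_one_iff_deriv]
  refine ⟨fun y => (hasDerivAt_posPart_sq y).differentiableAt, ?_⟩
  rw [funext fun y => (hasDerivAt_posPart_sq y).deriv]
  fun_prop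

/-! ### Critical shift and monotonicity of the flux. -/

namespace Heisenberg

variable {m : ℕ}

/-- The axis z = 0 has empty interior. Strict positivity in the comparison needs |∇r| = |z|/r > 0.
-/
theorem exists_zsq_pos (hm : 1 ≤ m) {U : Set (H m)} (hU : IsOpen U) (hne : U.Nonempty) :
    ∃ q ∈ U, 0 < zsq q := by
  obtain ⟨q₀, hq₀⟩ := hne
  rcases (zsq_nonneg q₀).lt_or_eq with h | h
  · exact ⟨q₀, hq₀, h⟩
  · set j : Fin m := ⟨0, hm⟩
    set γ : ℝ → H m := fun s => q₀ + s • (Pi.single j 1, 0, 0) with hγ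
    have hγc : Continuous γ := by fun_prop
    have h1 : ∀ᶠ s in 𝓝[≠] (0 : ℝ), γ s ∈ U :=
      nhdsWithin_le_nhds (hγc.continuousAt.preimage_mem_nhds (hU.mem_nhds (by simp only [hγ, zero_smul, add_zero]; exact hq₀)))
    obtain ⟨s, hs, hs0⟩ := (h1.and self_mem_nhdsWithin).exists
    refine ⟨γ s, hs, ?_⟩
    have h2 : coord (Sum.inl j) q₀ = 0 := by
      have := (Finset.sum_eq_zero_iff_of_nonneg fun i _ => sq_nonneg (coord i q₀)).1 h.symm
        (Sum.inl j) (Finset.mem_univ _)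
      simpa using this
    have h3 : coord (Sum.inl j) (γ s) = s := by
      simp only [coord] at h2
      simp [coord, hγ, h2]
    have h4 : coord (Sum.inl j) (γ s) ^ 2 ≤ zsq (γ s) :=
      Finset.single_le_sum (f := fun i => coord i (γ s) ^ 2) (fun _ _ => sq_nonneg _)
        (Finset.mem_univ _)
    rw [h3] at h4
    have h5 : s ≠ 0 := hs0
    exact (by positivity : 0 < s ^ 2).trans_le h4

/-- Sliding `u` down until it touches the comparison function. -/
theorem exists_shift {Γ : ℝ → ℝ} {L T A τ : ℝ} (hΓ : StrictMono Γ) (hΓA : Γ A = 0) (hL : 0 < L)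
    (hLip : ∀ s t, s ≤ t → Γ t - Γ s ≤ L * (t - s)) (hT : ∀ s, Γ s ≤ T) (hA : 0 ≤ A)
    {u : H m → ℝ} (hu : Continuous u) {b : H m} (hb : gauge b < Γ (u b)) (hτ : 0 < τ) :
    ∃ η, 0 ≤ η ∧ (∃ q, gauge q < Γ (u q - η)) ∧ ∀ q, Γ (u q - η) - gauge q ≤ τ := by
  obtain ⟨U, hU⟩ := (isCompact_gauge_le (m := m) T).bddAbove_image hu.continuousOn
  -- The shifts for which contact persists. Contact points lie in the compact ball r ≤ T at heights
  -- u - η ≥ A, so `Z` is bounded; its supremum is the critical shift.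
  set Z : Set ℝ := {η | 0 ≤ η ∧ ∃ q, gauge q ≤ Γ (u q - η)} with hZ
  have hZb : BddAbove Z := by
    refine ⟨U, fun η ⟨_, q, hq⟩ => ?_⟩
    have h1 : u q ≤ U := hU ⟨q, hq.trans (hT _), rfl⟩
    have h2 : A ≤ u q - η := by
      rw [← hΓ.le_iff_le, hΓA]
      exact (gauge_nonneg q).trans hq
    linarith
  -- By the Lipschitz bound this shift lowers Γ(u b) by at most the gap, so b remains a contact
  -- point and the critical shift is positive.
  set η₁ : ℝ := (Γ (u b) - gauge b) / L with hη₁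
  have hη₁pos : 0 < η₁ := div_pos (by linarith) hL
  have hη₁Z : η₁ ∈ Z := by
    refine ⟨hη₁pos.le, b, ?_⟩
    have h1 := hLip (u b - η₁) (u b) (by linarith)
    have h2 : L * (u b - (u b - η₁)) = Γ (u b) - gauge b := by rw [hη₁]; field_simp; ring
    linarith
  set M := sSup Z with hM
  have hMpos : 0 < M := hη₁pos.trans_le (le_csSup hZb hη₁Z)
  -- At M + ε there is no contact, and the chosen shift is at most 2ε smaller, which raises Γ by at
  -- most 2Lε = τ/2.
  set ε : ℝ := τ / (4 * L) with hε
  have hεpos : 0 < ε := by positivity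
  have hηM : max 0 (M - ε) < M := max_lt hMpos (by linarith)
  refine ⟨max 0 (M - ε), le_max_left _ _, ?_, fun q => ?_⟩
  · obtain ⟨η', ⟨_, q, hq⟩, hlt⟩ := exists_lt_of_lt_csSup ⟨η₁, hη₁Z⟩ hηM
    exact ⟨q, hq.trans_lt (hΓ (by linarith))⟩
  · have h1 : ¬ (0 ≤ M + ε ∧ ∃ q, gauge q ≤ Γ (u q - (M + ε))) := fun h =>
      absurd (le_csSup hZb h) (by rw [← hM]; linarith)
    have h2 : Γ (u q - (M + ε)) < gauge q := by
      by_contra hcon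
      exact h1 ⟨by linarith, q, not_lt.1 hcon⟩
    have h3 := hLip (u q - (M + ε)) (u q - max 0 (M - ε)) (by linarith)
    have h4 : L * (u q - max 0 (M - ε) - (u q - (M + ε))) ≤ L * (2 * ε) :=
      mul_le_mul_of_nonneg_left (by linarith [le_max_right 0 (M - ε)]) hL.le
    have h5 : L * (2 * ε) = τ / 2 := by rw [hε]; field_simp; ring
    linarith

/-- The difference of the fluxes of two functions against the square of the positive part of
their difference. -/
theorem flux_sub_flux_ge {p X : ℝ} (hX : 0 ≤ X) {g r w : H m → ℝ} {q : H m}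
    (hw : ∀ i, D i w q = 2 * X * (D i g q - D i r q)) :
    2 * X * ((gradNorm g q ^ (p - 1) - gradNorm r q ^ (p - 1)) * (gradNorm g q - gradNorm r q)) ≤
      flux p g w q - flux p r w q := by
  have hpow : ∀ a : ℝ, 0 ≤ a → a ^ (p - 2) * a ^ 2 = a ^ (p - 1) * a := fun a ha => by
    rcases ha.eq_or_lt with rfl | ha
    · simp
    · rw [sq, ← mul_assoc, ← Real.rpow_add_one ha.ne']; ring_nf
  have h1 : gradDot g w q = 2 * X * (gradNorm g q ^ 2 - gradDot g r q) := by
    rw [gradNorm_sq]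
    simp only [gradDot_eq, hw, mul_sub, ← Finset.sum_sub_distrib, Finset.mul_sum]
    exact Finset.sum_congr rfl fun i _ => by ring
  have h2 : gradDot r w q = 2 * X * (gradDot r g q - gradNorm r q ^ 2) := by
    rw [gradNorm_sq]
    simp only [gradDot_eq, hw, mul_sub, ← Finset.sum_sub_distrib, Finset.mul_sum]
    exact Finset.sum_congr rfl fun i _ => by ring
  -- Bounding the two cross terms by Cauchy-Schwarz leaves an expression in the two lengths only.
  have h3 := (le_abs_self _).trans (abs_flux_le p g r q)
  have h4 := (le_abs_self _).trans (abs_flux_le p r g q)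
  have h5 := hpow _ (gradNorm_nonneg g q)
  have h6 := hpow _ (gradNorm_nonneg r q)
  have h7 : flux p g w q - flux p r w q = 2 * X * (gradNorm g q ^ (p - 1) * gradNorm g q +
      gradNorm r q ^ (p - 1) * gradNorm r q - flux p g r q - flux p r g q) := by
    rw [← h5, ← h6]
    simp only [flux, h1, h2]
    ring
  rw [h7]
  refine mul_le_mul_of_nonneg_left ?_ (by positivity)
  linarith

end Heisenberg

/-! ### Regularity of the slope, and the function Γ. -/

namespace KellerOsserman

variable {p : ℝ} {f l : ℝ → ℝ}

/-- The derivative of `koSlope`. -/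
noncomputable def koSlopeDeriv (p : ℝ) (f l : ℝ → ℝ) (δ s : ℝ) : ℝ :=
  l (koSlope p f l δ s) / ((p - 1) * koSlope p f l δ s ^ (p - 1)) * (δ * f s)

theorem continuousOn_koSlopeDeriv (h : KHyp p l) (hf : CondF f) {δ : ℝ} (hδ : 0 < δ) :
    ContinuousOn (koSlopeDeriv p f l δ) (Ioi 0) := by
  have h1 := (continuousOn_slope h hf hδ).mono Ioi_subset_Ici_self
  have hp : p - 1 ≠ 0 := by linarith [h.one_lt]
  refine ContinuousOn.mul (ContinuousOn.div ?_ ?_ ?_) ?_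
  · exact h.condL.cont.comp h1 fun s hs => (slope_pos h hf hδ hs).le
  · exact continuousOn_const.mul (h1.rpow_const fun s hs => Or.inl (slope_pos h hf hδ hs).ne')
  · exact fun s hs => mul_ne_zero hp (Real.rpow_pos_of_pos (slope_pos h hf hδ hs) _).ne'
  · exact continuousOn_const.mul (hf.cont.mono Ioi_subset_Ici_self)

theorem contDiffAt_koSlope (h : KHyp p l) (hf : CondF f) {δ s : ℝ} (hδ : 0 < δ) (hs : 0 < s) :
    ContDiffAt ℝ 1 (koSlope p f l δ) s := by
  rw [contDiffAt_one_iff]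
  refine ⟨fun s => ContinuousLinearMap.toSpanSingleton ℝ (koSlopeDeriv p f l δ s), Ioi 0,
    Ioi_mem_nhds hs, ?_, fun x hx => (hasDerivAt_slope h hf hδ hx).hasFDerivAt⟩
  exact (ContinuousLinearMap.toSpanSingletonCLE (𝕜 := ℝ) (E := ℝ)).continuous.comp_continuousOn
    (continuousOn_koSlopeDeriv h hf hδ)

/-- The primitive of `1 / k`, `k` the slope, with `k` frozen below `A`. -/
noncomputable def slopePrimitive (p : ℝ) (f l : ℝ → ℝ) (δ A x : ℝ) : ℝ :=
  ∫ σ in A..x, 1 / koSlope p f l δ (max σ A)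

section

variable {δ A : ℝ}

theorem continuous_inv_slope_max (h : KHyp p l) (hf : CondF f) (hδ : 0 < δ) (hA : 0 < A) :
    Continuous fun σ => 1 / koSlope p f l δ (max σ A) :=
  (continuousOn_inv_slope h hf hδ).comp_continuous (by fun_prop)
    fun _ => hA.trans_le (le_max_right _ _)

theorem hasDerivAt_slopePrimitive (h : KHyp p l) (hf : CondF f) (hδ : 0 < δ) (hA : 0 < A) (x : ℝ) :
    HasDerivAt (slopePrimitive p f l δ A) (1 / koSlope p f l δ (max x A)) x :=
  intervalIntegral.integral_hasDerivAt_right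
    ((continuous_inv_slope_max h hf hδ hA).intervalIntegrable _ _)
    (continuous_inv_slope_max h hf hδ hA).stronglyMeasurable.stronglyMeasurableAtFilter
    (continuous_inv_slope_max h hf hδ hA).continuousAt

theorem contDiff_slopePrimitive (h : KHyp p l) (hf : CondF f) (hδ : 0 < δ) (hA : 0 < A) :
    ContDiff ℝ 1 (slopePrimitive p f l δ A) := by
  rw [contDiff_one_iff_deriv]
  refine ⟨fun x => (hasDerivAt_slopePrimitive h hf hδ hA x).differentiableAt, ?_⟩
  rw [funext fun x => (hasDerivAt_slopePrimitive h hf hδ hA x).deriv]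
  exact continuous_inv_slope_max h hf hδ hA

theorem slopePrimitive_self : slopePrimitive p f l δ A A = 0 := by simp [slopePrimitive]

theorem slopePrimitive_eq {x : ℝ} (hx : A ≤ x) :
    slopePrimitive p f l δ A x = ∫ σ in A..x, 1 / koSlope p f l δ σ := by
  refine intervalIntegral.integral_congr fun σ hσ => ?_
  rw [uIcc_of_le hx] at hσ
  simp only [max_eq_left hσ.1]

theorem strictMono_slopePrimitive (h : KHyp p l) (hf : CondF f) (hδ : 0 < δ) (hA : 0 < A) :
    StrictMono (slopePrimitive p f l δ A) := strictMono_of_deriv_pos fun x => by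
  rw [(hasDerivAt_slopePrimitive h hf hδ hA x).deriv]
  exact one_div_pos.2 (slope_pos h hf hδ (hA.trans_le (le_max_right _ _)))

/-- The slope is non-decreasing and frozen below A, so 1/k(A) bounds Γ' everywhere: the Lipschitz
constant required by `exists_shift`. -/
theorem slopePrimitive_sub_le (h : KHyp p l) (hf : CondF f) (hδ : 0 < δ) (hA : 0 < A) {s t : ℝ}
    (hst : s ≤ t) : slopePrimitive p f l δ A t - slopePrimitive p f l δ A s ≤
      1 / koSlope p f l δ A * (t - s) := by
  refine image_sub_le_mul_sub_of_deriv_le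
    (fun x => (hasDerivAt_slopePrimitive h hf hδ hA x).differentiableAt) (fun x => ?_) hst
  rw [(hasDerivAt_slopePrimitive h hf hδ hA x).deriv]
  exact one_div_le_one_div_of_le (slope_pos h hf hδ hA)
    (monotoneOn_slope h hf hδ hA.le (hA.le.trans (le_max_right _ _)) (le_max_right _ _))

/-- This is where the Keller-Osserman condition acts: a bounded Γ confines {r ≤ Γ(u - η)} to a
compact gauge ball, so the test function has compact support whatever the growth of u. -/
theorem slopePrimitive_le (h : KHyp p l) (hf : CondF f) (hδ : 0 < δ) (hA : 0 < A)
    (hint : IntegrableOn (fun s => 1 / koSlope p f l δ s) (Ioi A)) (x : ℝ) :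
    slopePrimitive p f l δ A x ≤ ∫ s in Ioi A, 1 / koSlope p f l δ s := by
  have hnn : ∀ s ∈ Ioi A, 0 ≤ 1 / koSlope p f l δ s := fun s hs =>
    inv_slope_nonneg h hf hδ (hA.trans hs)
  rcases le_total A x with hx | hx
  · rw [slopePrimitive_eq hx, intervalIntegral.integral_of_le hx]
    exact setIntegral_mono_set hint ((ae_restrict_iff' measurableSet_Ioi).2 (ae_of_all _ hnn))
      Ioc_subset_Ioi_self.eventuallyLE
  · refine ((strictMono_slopePrimitive h hf hδ hA).monotone hx).trans ?_
    rw [slopePrimitive_self]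
    exact setIntegral_nonneg measurableSet_Ioi hnn

end

end KellerOsserman

/-! ### The test function and the change of unknown g = Γ(u - η). -/

namespace Heisenberg

open KellerOsserman

variable {m : ℕ} {p : ℝ} {f l : ℝ → ℝ}

/-- The test function `(Γ(u - η) - r)₊²`, `r` the gauge. -/
noncomputable def gapSq (Γ : ℝ → ℝ) (η : ℝ) (u : H m → ℝ) (q : H m) : ℝ :=
  max (Γ (u q - η) - gauge q) 0 ^ 2

section gapSq

variable {Γ : ℝ → ℝ} {η T : ℝ} {u : H m → ℝ}

theorem tsupport_gapSq_subset (hΓ : Continuous Γ) (hu : Continuous u) :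
    tsupport (gapSq Γ η u) ⊆ {q | gauge q ≤ Γ (u q - η)} := by
  refine closure_minimal (fun q hq => ?_) (isClosed_le continuous_gauge (by fun_prop))
  by_contra hcon
  refine hq ?_
  simp only [mem_ofPred_eq, not_le] at hcon
  rw [gapSq, max_eq_right (by linarith)]
  norm_num

theorem hasCompactSupport_gapSq (hΓ : Continuous Γ) (hu : Continuous u) (hT : ∀ s, Γ s ≤ T) :
    HasCompactSupport (gapSq Γ η u) :=
  (isCompact_gauge_le T).of_isClosed_subset (isClosed_tsupport _) fun _ hq =>
    (tsupport_gapSq_subset hΓ hu hq).trans (hT _)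

theorem contDiff_gapSq (hΓ : ContDiff ℝ 1 Γ) (hu : ContDiff ℝ 1 u)
    (h0 : ∀ q ∈ tsupport (gapSq Γ η u), 0 < gauge4 q) : ContDiff ℝ 1 (gapSq Γ η u) :=
  contDiff_of_tsupport fun q hq => by
    have h1 : ContDiffAt ℝ 1 (fun q => Γ (u q - η) - gauge q) q :=
      ((hΓ.comp (hu.sub contDiff_const)).contDiffAt).sub (contDiffAt_gauge (n := 1) (h0 q hq))
    exact contDiff_posPart_sq.contDiffAt.comp q h1

theorem D_gapSq (hΓ : ContDiff ℝ 1 Γ) (hu : ContDiff ℝ 1 u) {q : H m} (h0 : 0 < gauge4 q)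
    (i : Fin m ⊕ Fin m) : D i (gapSq Γ η u) q = 2 * max (Γ (u q - η) - gauge q) 0 *
      (D i (fun q => Γ (u q - η)) q - D i gauge q) := by
  have hg : DifferentiableAt ℝ (fun q => Γ (u q - η)) q :=
    (hΓ.comp (hu.sub contDiff_const)).differentiable one_ne_zero q
  have hr : DifferentiableAt ℝ (gauge (m := m)) q :=
    (contDiffAt_gauge (n := 1) h0).differentiableAt one_ne_zero
  rw [← D_sub i hg hr]
  exact D_comp (u := fun q => Γ (u q - η) - gauge q) i (hasDerivAt_posPart_sq _) (hg.sub hr)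

end gapSq

/-- The flux of `u` tested with `k(u - η)^(1-p) w`, expressed through `g = Γ(u - η)`, `Γ' = 1/k`. -/
theorem flux_mul_rpow {Γ k : ℝ → ℝ} {k' η : ℝ} {u w : H m → ℝ} {q : H m} (hp : 1 < p)
    (hu : DifferentiableAt ℝ u q) (hw : DifferentiableAt ℝ w q) (hkpos : 0 < k (u q - η))
    (hk : HasDerivAt k k' (u q - η)) (hΓ : HasDerivAt Γ (1 / k (u q - η)) (u q - η)) :
    gradNorm u q = k (u q - η) * gradNorm (fun q => Γ (u q - η)) q ∧
    flux p u (fun q => k (u q - η) ^ (1 - p) * w q) q = flux p (fun q => Γ (u q - η)) w q -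
      (p - 1) * k' * gradNorm (fun q => Γ (u q - η)) q ^ p * w q := by
  set g : H m → ℝ := fun q => Γ (u q - η) with hg
  set κ := k (u q - η) with hκ
  have hs : DifferentiableAt ℝ (fun q => u q - η) q := hu.sub_const η
  have hDs : ∀ i, D i (fun q => u q - η) q = D i u q := fun i => by
    rw [D, fderiv_sub_const]; rfl
  have hDu : ∀ i, D i u q = κ * D i g q := fun i => by
    rw [D_comp (u := fun q => u q - η) i hΓ hs, hDs]
    field_simp
  have hnorm : gradNorm u q = κ * gradNorm g q := by
    have h1 : gradDot u u q = κ ^ 2 * gradDot g g q := by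
      simp only [gradDot_eq, hDu, Finset.mul_sum]
      exact Finset.sum_congr rfl fun i _ => by ring
    rw [gradNorm, h1, Real.sqrt_mul (sq_nonneg _), Real.sqrt_sq hkpos.le, gradNorm]
  refine ⟨hnorm, ?_⟩
  have hkd : DifferentiableAt ℝ (fun q => k (u q - η) ^ (1 - p)) q :=
    ((hk.comp_hasFDerivAt q hs.hasFDerivAt).differentiableAt).rpow_const (Or.inl hkpos.ne')
  have hDk : ∀ i, D i (fun q => k (u q - η) ^ (1 - p)) q =
      k' * (1 - p) * κ ^ (-p) * (κ * D i g q) := fun i => by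
    rw [D_comp (φ := fun x => k x ^ (1 - p)) (u := fun q => u q - η) i
      (hk.rpow_const (Or.inl hkpos.ne')) hs, hDs, hDu]
    rw [show 1 - p - 1 = -p by ring]
  have hdot : gradDot u (fun q => k (u q - η) ^ (1 - p) * w q) q =
      κ * κ ^ (1 - p) * gradDot g w q +
        k' * (1 - p) * (κ ^ (-p) * κ ^ 2) * w q * gradNorm g q ^ 2 := by
    rw [gradNorm_sq]
    simp only [gradDot_eq, D_mul _ hkd hw, hDu, hDk, Finset.mul_sum, ← Finset.sum_add_distrib]
    exact Finset.sum_congr rfl fun i _ => by ring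
  -- With the weight k^(1-p) all powers of κ cancel, leaving the p-Laplacian of g and a term in k'.
  have e1 : κ ^ (p - 2) * (κ * κ ^ (1 - p)) = 1 := by
    have : κ ^ (1 + (1 - p)) = κ * κ ^ (1 - p) := by rw [Real.rpow_add hkpos, Real.rpow_one]
    rw [← this, ← Real.rpow_add hkpos, show p - 2 + (1 + (1 - p)) = 0 by ring, Real.rpow_zero]
  have e2 : κ ^ (p - 2) * (κ ^ (-p) * κ ^ 2) = 1 := by
    rw [← Real.rpow_natCast, ← Real.rpow_add hkpos, ← Real.rpow_add hkpos, ← Real.rpow_zero κ]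
    norm_num
  have e3 : gradNorm g q ^ (p - 2) * gradNorm g q ^ 2 = gradNorm g q ^ p := by
    rcases (gradNorm_nonneg g q).eq_or_lt with h0 | h0
    · rw [← h0, Real.zero_rpow (by linarith : p ≠ 0)]; simp
    · rw [← Real.rpow_natCast, ← Real.rpow_add h0]
      norm_num
  rw [flux, hdot, hnorm, Real.mul_rpow hkpos.le (gradNorm_nonneg g q), flux, ← e3]
  calc _ = (κ ^ (p - 2) * (κ * κ ^ (1 - p))) * (gradNorm g q ^ (p - 2) * gradDot g w q) +
        (κ ^ (p - 2) * (κ ^ (-p) * κ ^ 2)) * (k' * (1 - p) * w q *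
          (gradNorm g q ^ (p - 2) * gradNorm g q ^ 2)) := by ring
    _ = _ := by rw [e1, e2]; ring

end Heisenberg

/-! ### The comparison argument under the Keller-Osserman condition. -/

namespace Heisenberg

open KellerOsserman

variable {m : ℕ} {p : ℝ} {f l : ℝ → ℝ}

/-- The strict inequality that the slope function has to satisfy at a point of the test region. -/
theorem slope_condition {k fs fu lk N Γ r r₀ δ c₀ M κ : ℝ} (hk : 0 < k) (hr₀ : 0 < r₀)
    (hr : r₀ < r) (hΓ : Γ - r₀ ≤ r) (hΓ0 : 0 ≤ Γ) (hM : 0 ≤ M) (hlk : 0 ≤ lk) (hfu : fs ≤ fu)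
    (hc₀ : 0 < c₀) (hN : N = M / r) (hκ : κ * k ^ (p - 1) = δ * fs * lk)
    (hs : δ * fs * lk + 3 * M / (r₀ + Γ) * k ^ (p - 1) < 1 / (4 ^ p * c₀) * (fs * lk)) :
    4 ^ p * (κ + N) < k ^ (1 - p) * fu * lk / c₀ := by
  have hkp : 0 < k ^ (p - 1) := Real.rpow_pos_of_pos hk _
  have h4 : (0 : ℝ) < 4 ^ p := Real.rpow_pos_of_pos (by norm_num) _
  have hrpos : 0 < r := hr₀.trans hr
  -- r₀ + Γ ≤ r + 2r₀ < 3r, whence the factor 3.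
  have hN' : N ≤ 3 * M / (r₀ + Γ) := by
    rw [hN, div_le_div_iff₀ hrpos (by linarith)]
    nlinarith
  have h1 : (κ + N) * k ^ (p - 1) < 1 / (4 ^ p * c₀) * (fs * lk) := by
    have := mul_le_mul_of_nonneg_right hN' hkp.le
    linarith
  have h2 : k ^ (1 - p) = (k ^ (p - 1))⁻¹ := by rw [← Real.rpow_neg hk.le]; ring_nf
  have h3 : κ + N < 1 / (4 ^ p * c₀) * (fs * lk) / k ^ (p - 1) := by rwa [lt_div_iff₀ hkp]
  calc 4 ^ p * (κ + N) < 4 ^ p * (1 / (4 ^ p * c₀) * (fs * lk) / k ^ (p - 1)) :=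
        mul_lt_mul_of_pos_left h3 h4
    _ = k ^ (1 - p) * fs * lk / c₀ := by rw [h2]; field_simp
    _ ≤ _ := by
        have : 0 ≤ k ^ (1 - p) := Real.rpow_nonneg hk.le _
        gcongr

/-- Under the Keller-Osserman condition no entire solution exceeds its value at the origin. -/
theorem IsWeakSolution.le_zero_value_of_KO (hm : 1 ≤ m) (h : KHyp p l) (hf : CondF f)
    (hKO : KO p f l) {Λ : ℝ} (hΛ : 0 < Λ)
    (hL2 : ∀ s ∈ Icc (0 : ℝ) 1, ∀ t : ℝ, 0 ≤ t → l t * s ^ p ≤ Λ * l (s * t))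
    {u : H m → ℝ} (hu : IsWeakSolution p f l u) (hu0 : ∀ q, 0 ≤ u q) (b : H m) : u b ≤ u 0 := by
  by_contra hlt
  rw [not_le] at hlt
  have hp := h.one_lt
  obtain ⟨C₀, hC₀, hmon⟩ := h.condL.cmono
  have hu1 : ContDiff ℝ 1 u := hu.1
  have huc : Continuous u := hu1.continuous
  set A : ℝ := (u 0 + u b) / 2 with hA
  have hAb : A < u b := by linarith
  have h0A : u 0 < A := by linarith
  have hApos : 0 < A := (hu0 0).trans_lt h0A
  -- the hole around the origin
  obtain ⟨r₀, hr₀, hhole⟩ : ∃ r₀, 0 < r₀ ∧ ∀ q, gauge q ≤ r₀ → u q < A := by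
    have h1 : ∀ᶠ q in 𝓝 (0 : H m), u q < A := huc.continuousAt.eventually (gt_mem_nhds h0A)
    obtain ⟨ε, hε, hball⟩ := Metric.eventually_nhds_iff.1 h1
    -- A radius at most 1 makes its square, which bounds |t|, no larger than the radius.
    refine ⟨min 1 (ε / 2), by positivity, fun q hq => hball ?_⟩
    have h2 := norm_le_of_gauge_le hq
    have h3 : min 1 (ε / 2) ≤ 1 := min_le_left _ _
    have h4 : 0 ≤ min 1 (ε / 2) := by positivity
    have h5 : (min 1 (ε / 2)) ^ 2 ≤ min 1 (ε / 2) := by nlinarith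
    rw [max_eq_left h5] at h2
    rw [dist_zero_right]
    have := min_le_right 1 (ε / 2)
    linarith
  have hM0 : (0 : ℝ) ≤ 2 * m + 1 := by positivity
  have hCΛ : 0 < C₀ * Λ := by positivity
  have h4p : (0 : ℝ) < 4 ^ p := Real.rpow_pos_of_pos (by norm_num) _
  -- r₁ = r(b) makes b a contact point already for η = 0. The constant 1/(4^p C₀Λ) accounts for the
  -- losses from comparable gradients, `C`-monotonicity and the scaling of l.
  obtain ⟨δ, hδ, hδ1, hδB, hδs⟩ := exists_slope h hf (gauge b) hApos hAb hr₀
    (c := 1 / (4 ^ p * (C₀ * Λ))) (by positivity) (C := 3 * (2 * m + 1)) (by positivity)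
  set k := koSlope p f l δ with hk
  set Γ := slopePrimitive p f l δ A with hΓ
  have hΓm : StrictMono Γ := strictMono_slopePrimitive h hf hδ hApos
  have hΓ1 : ContDiff ℝ 1 Γ := contDiff_slopePrimitive h hf hδ hApos
  have hΓA : Γ A = 0 := slopePrimitive_self
  obtain ⟨T, hT⟩ : ∃ T, ∀ s, Γ s ≤ T :=
    ⟨_, slopePrimitive_le h hf hδ hApos (hKO.integrableOn_slope h hf hδ hδ1 hApos)⟩
  have hkpos : ∀ s, A < s → 0 < k s := fun s hs => slope_pos h hf hδ (hApos.trans hs)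
  -- bounds on the region where the comparison takes place
  obtain ⟨U, hU⟩ := (isCompact_gauge_le (m := m) T).bddAbove_image huc.continuousOn
  -- Heights u - η on the contact set lie in [A, U], so this bounds (p-1)k' there.
  obtain ⟨M₁, hM₁⟩ := (isCompact_Icc (a := A) (b := U)).exists_bound_of_continuousOn
    ((continuousOn_koSlopeDeriv h hf hδ).const_smul (p - 1) |>.mono
      fun x hx => hApos.trans_le hx.1)
  set c := (1 - (2⁻¹ : ℝ) ^ (p - 1)) / 2 with hc
  have hcpos : 0 < c := rpow_gap_const_pos hp
  set M₂ : ℝ := |M₁| + (2 * m + 1) / r₀ + 1 with hM₂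
  have hM₂pos : 0 < M₂ := by positivity
  -- The bound r₀ serves `slope_condition`; the bound c/M₂ gives (g - r)₊ (κ + N) ≤ c < 2c for
  -- `absorption`.
  set τ : ℝ := min r₀ (c / M₂) with hτ
  have hτpos : 0 < τ := by positivity
  have hbΓ : gauge b < Γ (u b) := by rw [hΓ, slopePrimitive_eq hAb.le]; exact hδB
  obtain ⟨η, hη, ⟨q₀, hq₀⟩, hητ⟩ := exists_shift hΓm hΓA
    (one_div_pos.2 (slope_pos h hf hδ hApos)) (fun s t => slopePrimitive_sub_le h hf hδ hApos)
    hT hApos.le huc hbΓ hτpos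
  -- In the hole u < A, hence Γ(u - η) < 0 ≤ r. Contact thus avoids both the singularity of the
  -- gauge and the heights where k is frozen.
  have hregion : ∀ q, gauge q ≤ Γ (u q - η) → r₀ < gauge q ∧ A < u q - η := by
    intro q hq
    have h1 : r₀ < gauge q := by
      by_contra hcon
      have h2 := hhole q (not_lt.1 hcon)
      have h3 : Γ (u q - η) < 0 := by rw [← hΓA]; exact hΓm (by linarith)
      linarith [gauge_nonneg q]
    refine ⟨h1, ?_⟩
    rw [← hΓm.lt_iff_lt, hΓA]
    linarith
  -- the test function
  set W : H m → ℝ := gapSq Γ η u with hW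
  have hts : ∀ q ∈ tsupport W, gauge q ≤ Γ (u q - η) := fun q hq =>
    tsupport_gapSq_subset hΓ1.continuous huc hq
  have hg4 : ∀ q ∈ tsupport W, 0 < gauge4 q := fun q hq =>
    gauge4_pos (hr₀.trans (hregion q (hts q hq)).1)
  have hWc : HasCompactSupport W := hasCompactSupport_gapSq hΓ1.continuous huc hT
  have hW1 : ContDiff ℝ 1 W := contDiff_gapSq hΓ1 hu1 hg4
  set w : H m → ℝ := fun q => k (u q - η) ^ (1 - p) * W q with hw
  have hwsub : tsupport w ⊆ tsupport W := tsupport_mul_subset_right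
  have hwc : HasCompactSupport w := hWc.mul_left
  have hw1 : ContDiff ℝ 1 w := contDiff_of_tsupport fun q hq => by
    have h1 := (hregion q (hts q (hwsub hq))).2
    have h2 : ContDiffAt ℝ 1 (fun q => k (u q - η)) q :=
      (contDiffAt_koSlope h hf hδ (hApos.trans h1)).comp
        (f := fun q => u q - η) q (hu1.sub contDiff_const).contDiffAt
    exact (h2.rpow_const_of_ne (hkpos _ h1).ne').mul hW1.contDiffAt
  have hw0 : ∀ q, 0 ≤ w q := fun q => by
    by_cases hq : q ∈ tsupport W
    · exact mul_nonneg (Real.rpow_nonneg (hkpos _ (hregion q (hts q hq)).2).le _) (sq_nonneg _)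
    · rw [hw]
      simp only
      rw [image_eq_zero_of_notMem_tsupport hq, mul_zero]
  have hweak := hu.c1_test hp hu0 hf.cont h.condL.cont hw1 hwc hw0
  obtain ⟨hgi, hNi, hgauge⟩ := integral_flux_gauge hp hW1 hWc hg4
  have hui := integrable_flux hp hu1 hw1 hwc
  have hfi : Integrable fun q => f (u q) * l (gradNorm u q) * w q :=
    (((hf.cont.comp_continuous huc hu0).mul (h.condL.cont.comp_continuous
      (continuous_gradNorm hu1) (gradNorm_nonneg u))).mul hw1.continuous).integrable_of_hasCompactSupport
      hwc.mul_left
  -- The tested inequality for u minus the tested equation for r, so that ∫ J ≤ 0.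
  set J : H m → ℝ := fun q => (flux p u w q + f (u q) * l (gradNorm u q) * w q) -
    (flux p gauge W q + (2 * m + 1) / gauge q * gradNorm gauge q ^ p * W q) with hJ
  have hJi : Integrable J := (hui.add hfi).sub (hgi.add hNi)
  have hJint : ∫ q, J q ≤ 0 := by
    have e : ∫ q, J q = (∫ q, flux p u w q) + (∫ q, f (u q) * l (gradNorm u q) * w q) -
        ((∫ q, flux p gauge W q) +
          ∫ q, (2 * m + 1) / gauge q * gradNorm gauge q ^ p * W q) := by
      rw [← integral_add hui hfi, ← integral_add hgi hNi]
      exact integral_sub (hui.add hfi) (hgi.add hNi)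
    rw [e, hgauge]
    linarith
  have hpoint : ∀ q ∈ tsupport W, 0 ≤ J q ∧
      (gauge q < Γ (u q - η) → 0 < zsq q → 0 < J q) := by
    intro q hq
    obtain ⟨hr, hs⟩ := hregion q (hts q hq)
    have hρ := hg4 q hq
    have hrpos : 0 < gauge q := hr₀.trans hr
    set s := u q - η with hsdef
    have hspos : 0 < s := hApos.trans hs
    have hks := hkpos s hs
    set κ := (p - 1) * koSlopeDeriv p f l δ s with hκ
    obtain ⟨hnorm, hflux⟩ := flux_mul_rpow (Γ := Γ) (k := k) (k' := koSlopeDeriv p f l δ s)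
      (η := η) (w := W) hp (hu1.differentiable one_ne_zero q) (hW1.differentiable one_ne_zero q)
      hks (hasDerivAt_slope h hf hδ hspos) (by
        have := hasDerivAt_slopePrimitive h hf hδ hApos s
        rwa [max_eq_left hs.le] at this)
    set g : H m → ℝ := fun q => Γ (u q - η) with hg
    set G := gradNorm g q with hG
    set P := gradNorm gauge q with hP
    set N : ℝ := (2 * m + 1) / gauge q with hN
    set X := max (Γ s - gauge q) 0 with hX
    have hX0 : 0 ≤ X := le_max_right _ _
    have hWX : W q = X ^ 2 := rfl
    have hfx := flux_sub_flux_ge (p := p) hX0 (g := g) (r := gauge) (w := W) (q := q)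
      (fun i => D_gapSq hΓ1 hu1 hρ i)
    set S := k s ^ (1 - p) * f (u q) * l (k s * G) with hS
    have hJq : J q = (flux p g W q - flux p gauge W q) + X ^ 2 * S -
        X ^ 2 * (κ * G ^ p + N * P ^ p) := by
      simp only [hJ]
      rw [hflux, hnorm, hWX]
      simp only [hw, hWX]
      ring
    have hG0 : 0 ≤ G := gradNorm_nonneg _ _
    have hP0 : 0 ≤ P := gradNorm_nonneg _ _
    have hP1 : P ≤ 1 := gradNorm_gauge_le_one hρ
    rcases hX0.eq_or_lt with hXz | hXpos
    · refine ⟨?_, fun hlt _ => ?_⟩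
      · rw [hJq, ← hXz]
        rw [← hXz] at hfx
        linarith
      · have : 0 < X := lt_max_of_lt_left (by linarith)
        linarith
    · have hlk : 0 < l (k s) := h.condL.pos _ hks
      have hfs : 0 < f s := hf.pos s hspos
      have hfu : f s ≤ f (u q) := hf.mono hspos.le (hu0 q) (by linarith)
      have hkp : 0 < k s ^ (p - 1) := Real.rpow_pos_of_pos hks _
      have hk1p : 0 ≤ k s ^ (1 - p) := Real.rpow_nonneg hks.le _
      have hκk : κ * k s ^ (p - 1) = δ * f s * l (k s) := by
        rw [hκ, koSlopeDeriv, ← hk]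
        have : p - 1 ≠ 0 := by linarith
        field_simp
      have hκ0 : 0 ≤ κ := by
        have : 0 ≤ κ * k s ^ (p - 1) := by rw [hκk]; positivity
        exact nonneg_of_mul_nonneg_left this hkp
      have hN0 : 0 ≤ N := by positivity
      have hΓs : Γ s - gauge q ≤ τ := hητ q
      have hXτ : X ≤ τ := max_le hΓs hτpos.le
      have hΓ0 : 0 ≤ Γ s := by rw [← hΓA]; exact hΓm.monotone hs.le
      have hcond : 4 ^ p * (κ + N) < k s ^ (1 - p) * f (u q) * l (k s) / (C₀ * Λ) := by
        refine slope_condition hks hr₀ hr ?_ hΓ0 hM0 hlk.le hfu hCΛ hN hκk ?_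
        · linarith [min_le_left r₀ (c / M₂)]
        · have := hδs s hs.le
          rwa [← slopePrimitive_eq hs.le] at this
      have hsmall : X * (κ + N) < 2 * c := by
        have h1 : κ ≤ |M₁| := by
          have hsU : s ≤ U := by
            have : u q ≤ U := hU ⟨q, (hts q hq).trans (hT _), rfl⟩
            linarith
          have := hM₁ s ⟨hs.le, hsU⟩
          exact (le_abs_self _).trans (this.trans (le_abs_self _))
        have h2 : N ≤ (2 * m + 1) / r₀ := div_le_div_of_nonneg_left hM0 hr₀ hr.le
        have h3 : X ≤ c / M₂ := hXτ.trans (min_le_right _ _)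
        calc X * (κ + N) ≤ c / M₂ * M₂ := by
              refine mul_le_mul h3 (by linarith) (by linarith) (by positivity)
          _ = c := by field_simp
          _ < 2 * c := by linarith
      have hlG : 0 ≤ l (k s * G) := h.condL.nonneg (by positivity)
      have hS0 : 0 ≤ S := mul_nonneg (mul_nonneg hk1p (hfs.le.trans hfu)) hlG
      have hmid : G ≤ 2 * P →
          (G / 2) ^ p * (k s ^ (1 - p) * f (u q) * l (k s) / (C₀ * Λ)) ≤ S := by
        intro hGP
        -- G/2 ≤ P ≤ 1 is an admissible scaling factor. Applied at 2k it produces l(kG), and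
        -- `C`-monotonicity returns from l(2k) to l(k).
        have h1 := hL2 (G / 2) ⟨by linarith, by linarith⟩ (2 * k s) (by linarith)
        rw [show G / 2 * (2 * k s) = k s * G by ring] at h1
        have h2 := hmon (2 * k s) (by linarith) (k s) ⟨hks.le, by linarith⟩
        have h3 : 0 ≤ (G / 2) ^ p := Real.rpow_nonneg (by linarith) _
        have h4 : (G / 2) ^ p * l (k s) / (C₀ * Λ) ≤ l (k s * G) := by
          rw [div_le_iff₀ hCΛ]
          have h5 := mul_le_mul_of_nonneg_left h2 h3
          have h6 := mul_le_mul_of_nonneg_left h1 (zero_le_one.trans hC₀)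
          linarith
        calc _ = k s ^ (1 - p) * f (u q) * ((G / 2) ^ p * l (k s) / (C₀ * Λ)) := by ring
          _ ≤ _ := mul_le_mul_of_nonneg_left h4 (mul_nonneg hk1p (hfs.le.trans hfu))
      obtain ⟨a1, a2⟩ := absorption hp hXpos hG0 hP0 hκ0 hN0 hsmall hS0 hmid hcond
      refine ⟨by rw [hJq]; linarith, fun _ hz => ?_⟩
      have hPpos : 0 < P := by
        rw [hP, gradNorm_gauge hρ]
        exact mul_pos (Real.rpow_pos_of_pos hz _) (Real.rpow_pos_of_pos hρ _)
      have := a2 hPpos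
      rw [hJq]
      linarith
  have hJ0 : ∀ q, 0 ≤ J q := fun q => by
    by_cases hq : q ∈ tsupport W
    · exact (hpoint q hq).1
    · have h1 : W q = 0 := image_eq_zero_of_notMem_tsupport hq
      have h2 : w q = 0 := by simp [hw, h1]
      simp only [hJ, h1, h2, flux, gradDot_eq, D_eq_zero_of_notMem _ hq,
        D_eq_zero_of_notMem _ fun hh => hq (hwsub hh)]
      simp
  -- the contradiction: `J` is positive on a nonempty open set
  set O : Set (H m) := {q | gauge q < Γ (u q - η)} with hO
  have hOo : IsOpen O := isOpen_lt continuous_gauge (hΓ1.continuous.comp (huc.sub continuous_const))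
  have hOo' : IsOpen (O ∩ {q | 0 < zsq q}) :=
    hOo.inter (isOpen_lt continuous_const contDiff_zsq.continuous)
  obtain ⟨q₁, hq₁, hz₁⟩ := exists_zsq_pos hm hOo ⟨q₀, hq₀⟩
  have hsub : O ∩ {q | 0 < zsq q} ⊆ Function.support J := fun q ⟨hq, hz⟩ => by
    have hqs : q ∈ tsupport W := by
      refine subset_tsupport _ ?_
      have : 0 < max (Γ (u q - η) - gauge q) 0 := lt_max_of_lt_left (sub_pos.2 hq)
      exact (pow_pos this 2).ne'
    exact ((hpoint q hqs).2 hq hz).ne'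
  have hpos := (integral_pos_iff_support_of_nonneg hJ0 hJi).2
    ((hOo'.measure_pos volume ⟨q₁, hq₁, hz₁⟩).trans_le (measure_mono hsub))
  linarith

/-- Under the Keller-Osserman condition the non-negative entire solutions are constant. -/
theorem IsWeakSolution.eq_of_KO (hm : 1 ≤ m) (h : KHyp p l) (hf : CondF f)
    (hKO : KO p f l) {Λ : ℝ} (hΛ : 0 < Λ)
    (hL2 : ∀ s ∈ Icc (0 : ℝ) 1, ∀ t : ℝ, 0 ≤ t → l t * s ^ p ≤ Λ * l (s * t))
    {u : H m → ℝ} (hu : IsWeakSolution p f l u) (hu0 : ∀ q, 0 ≤ u q) (q : H m) : u q = u 0 := by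
  -- Translation by a carries the base point 0 to a, so every value of u bounds every other.
  have key : ∀ a b : H m, u b ≤ u a := fun a b => by
    have h1 := (hu.comp_lmul a).le_zero_value_of_KO hm h hf hKO hΛ hL2 (fun q => hu0 _) (lmul (-a) b)
    have h2 : lmul a (lmul (-a) b) = b := by simpa using lmul_neg_lmul (-a) b
    have h3 : lmul a 0 = a := by simp [lmul]
    simpa only [h2, h3] using h1
  exact le_antisymm (key 0 q) (key q 0)

end Heisenberg

theorem mainTheorem2 (m : ℕ) (hm : 1 ≤ m) (p : ℝ) (hp : 1 < p) (f l : ℝ → ℝ)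
    (hf : KellerOsserman.CondF f) (hl : KellerOsserman.CondL l)
    (hpl : Tendsto (fun t : ℝ => t ^ (p - 1) / l t) (𝓝[>] 0) (𝓝 0))
    (B₁ B₂ μ : ℝ) (hB₁ : 0 < B₁) (hB₂ : 0 < B₂) (hμ₀ : 0 ≤ μ) (hμ₁ : μ < 1)
    (hgrowth : ∀ t : ℝ, 0 ≤ t → l t ≤ B₁ + B₂ * t ^ μ)
    (Λ : ℝ) (hΛ : 0 < Λ)
    (hL2 : ∀ s ∈ Icc (0 : ℝ) 1, ∀ t : ℝ, 0 ≤ t → l t * s ^ p ≤ Λ * l (s * t)) :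
    (∃ u : Heisenberg.H m → ℝ, Heisenberg.IsWeakSolution p f l u ∧
        (∀ q, 0 ≤ u q) ∧ ¬ ∃ c : ℝ, ∀ q, u q = c) ↔
      ¬ KellerOsserman.KO p f l := by
  have h : KellerOsserman.KHyp p l := ⟨hp, hl, hpl, B₁, B₂, μ, hB₁, hB₂, hμ₀, hμ₁, hgrowth⟩
  refine ⟨fun ⟨u, hu, hu0, hne⟩ hKO => hne ⟨u 0, hu.eq_of_KO hm h hf hKO hΛ hL2 hu0⟩,
    Heisenberg.exists_solution_of_not_KO hm h hf⟩
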